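/- **The calculus.** A PROP is a symmetric strict monoidal category with set of objects $\mathbb{N}$ and with $\otimes$ given by addition on objects. String diagrams $n\to m$ are the morphisms of the PROP $\mathbf{SD}[T_c]$ freely generated by dualities $\cup:0\to 2$, $\cap:2\to 0$, satisfying the zigzag equations and invariant under the braiding $\sigma:2\to2$, and by the following set $T_c$ of generators: for each $n\in\mathbb{N}$ an $n$-ary black vertex and an $n$-ary white vertex (morphisms $0\to n$), and the crossing $\times:2\to 2$. Using $\cap$, one regards the vertices as vertices with $k$ inputs and $n-k$ outputs, for any $k \le n$. Let * $X:1\to1$ be the binary black vertex and $S:1\to1$ the binary white vertex; * $\mu_n:n\to1$ be the black vertex with $n$ inputs and one output, followed by $X$; and $\delta_n:1\to n$ be $X$ followed by the black vertex with one input and $n$ outputs; * $c_n:1\to n$ be $S$ followed by the white vertex with one input and $n$ outputs. The rules $\mathrm{ZW}_c$ of the condensed ZW calculus are the following, for all $n,m\in\mathbb{N}$ (composition is from right to left). 1. All black and white vertices are invariant under permutation of their legs. 2. $XX=\mathrm{id}$ and $SS=\mathrm{id}$. 3. (Trace) Joining two legs of the ternary black (white) vertex gives the unary black (white) vertex. 4.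 (Spider) Two black vertices with $n+1$ and $m+1$ legs, connected by a wire with an $X$ on it, equal the $(n+m)$-ary black vertex. Two white vertices with $n+1$ and $m+1$ legs, connected by a wire with an $S$ on it, equal the $(n+m)$-ary white vertex. 5. (Phase) For every white vertex, an $S$ on one leg can be moved to any other leg. 6. (Automorphism) $\delta_n S=S^{\otimes n}\delta_n$ and $c_nX=X^{\otimes n}c_n$. 7. (Bialgebra I) $\delta_m\mu_n=\mu_n^{\otimes m}\circ\chi_{n,m}\circ\delta_m^{\otimes n}$, where $\chi_{n,m}:nm\to mn$ connects the $j$-th output of the $i$-th $\delta_m$ with the $i$-th input of the $j$-th $\mu_n$, wires intersecting in crossings $\times$. 8. (Loop I) $\mu_{n+2m}\circ(\mathrm{id}_{n+m}\otimes S^{\otimes m})\circ\delta_{n+2m}=\mu_n\delta_n$. 9. (Bialgebra II) $c_{m+1}\mu_n=\mu_n^{\otimes (m+1)}\circ\chi'_{n,m+1}\circ c_{m+1}^{\otimes n}$, where $\chi'_{n,m+1}$ is defined as $\chi_{n,m+1}$ but with braidings $\sigma$ instead of crossings. 10. (Loop II) $\mu_{n+2}c_{n+2}=\mu_0\delta_0$.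 11. $\times\circ(\mu_2\otimes\mathrm{id}_1)=(\mathrm{id}_1\otimes\mu_2)\circ(\times\otimes\mathrm{id}_1)\circ(\mathrm{id}_1\otimes\times)$ and $\times\circ(X\otimes\mathrm{id}_1)=(S\otimes X)\circ\times$. 12. (Elimination of crossings) Let $b$ be the black vertex with one input and two outputs, $w$ the white vertex with two inputs and one output. Then $\times\circ(w\otimes w)\circ(\mathrm{id}_1\otimes b\otimes\mathrm{id}_1)=\sigma\circ(w\otimes w)\circ(\mathrm{id}_1\otimes b\otimes\mathrm{id}_1)$. A diagram $\mathcal{G}$ can be *rewritten* into $\mathcal{H}$ if $\mathcal{G}=\mathcal{H}$ in $\mathbf{SD}[T_c/\mathrm{ZW}_c]$, that is, if they are identified by the congruence generated by these rules and by the axioms of a self-dual compact closed PROP. **The normal form.** Let $|0\rangle,|1\rangle$ be the generators of $\mathbb{Z}\oplus\mathbb{Z}$. Every $\psi\in(\mathbb{Z}\oplus\mathbb{Z})^{\otimes n}$ is uniquely (up to the order of the terms, which we fix once and for all) a sum $\sum_{i=1}^q(-1)^{p_i}m_i|b_{i,1}\ldots b_{i,n}\rangle$ with $m_i>0$, $p_i,b_{i,j}\in\{0,1\}$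 and distinct bit strings $b_{i,1}\ldots b_{i,n}$. Then $N(\psi):0\to n$ is the following diagram: a $q$-ary black vertex; on its $i$-th leg the loop $\mu_{m_i}\delta_{m_i}$, then $S$ if $p_i=1$, then $c_{k_i}$ with $k_i=\sum_j b_{i,j}$; and for the $j$-th output a $\mu_{l_j}$ with $l_j=\sum_i b_{i,j}$; where the $i$-th $c_{k_i}$ is connected to the $j$-th $\mu_{l_j}$ by one wire if $b_{i,j}=1$, and by none if $b_{i,j}=0$ (wires intersecting in braidings). For a homomorphism $f:(\mathbb{Z}\oplus\mathbb{Z})^{\otimes n}\to(\mathbb{Z}\oplus\mathbb{Z})^{\otimes m}$, let $\psi_f\in(\mathbb{Z}\oplus\mathbb{Z})^{\otimes (n+m)}$ be the state in which the coefficient of $|xy\rangle$ is the coefficient of $|y\rangle$ in $f|x\rangle$; $N(f):n\to m$ is $N(\psi_f)$ with the first $n$ outputs turned into inputs by means of $\cap$. **Theorem.** Every string diagram of the condensed ZW calculus can be rewritten in normal form: for all $n,m\in\mathbb{N}$ and every string diagram $\mathcal{G}:n\to m$ there is a homomorphism $f:(\mathbb{Z}\oplus\mathbb{Z})^{\otimes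 n}\to(\mathbb{Z}\oplus\mathbb{Z})^{\otimes m}$ such that $\mathcal{G}$ can be rewritten into $N(f)$ using the rules $\mathrm{ZW}_c$. -/

import Mathlib

open scoped TensorProduct

namespace ZW

/-! ### String diagrams

Terms for the morphisms of the free self-dual compact closed PROP on the generators of the
condensed ZW calculus. Composition is written in diagrammatic order: `f ⨟ g` is `f` followed by
`g`. The two families of vertices are introduced as states, with `n` outputs and no inputs;
`cross` is the (fermionic) crossing and `braid a b` the symmetric braiding of `a` wires with `b`
wires. -/
inductive Diagram : ℕ → ℕ → Type
  | wires (n : ℕ) : Diagram n n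
  | comp {a b c : ℕ} (f : Diagram a b) (g : Diagram b c) : Diagram a c
  | tensor {a b c d : ℕ} (f : Diagram a b) (g : Diagram c d) : Diagram (a + c) (b + d)
  | braid (a b : ℕ) : Diagram (a + b) (b + a)
  | cup : Diagram 0 2
  | cap : Diagram 2 0
  | black (n : ℕ) : Diagram 0 n
  | white (n : ℕ) : Diagram 0 n
  | cross : Diagram 2 2

infixl:65 " ⨟ " => Diagram.comp
infixl:70 " ⊠ " => Diagram.tensor

open Diagram

/-- Transport along equalities of the numbers of inputs and outputs. -/
def Diagram.cast {a b a' b' : ℕ} (ha : a = a') (hb : b = b') (f : Diagram a b) :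
    Diagram a' b' :=
  match a', b', ha, hb with
  | _, _, rfl, rfl => f

/-! ### Bending wires -/

/-- `n` parallel caps: the `i`-th wire of the first bundle is joined to the `i`-th wire of the
second bundle. -/
def caps : (n : ℕ) → Diagram (n + n) 0
  | 0 => wires 0
  | n + 1 =>
    (wires n ⊠ braid 1 n ⊠ wires 1).cast (by omega : n + (1 + n) + 1 = n + 1 + (n + 1))
        (by omega : n + (n + 1) + 1 = n + n + 2) ⨟
      (caps n ⊠ cap)

/-- Turn the first `n` outputs of a state into inputs, by means of the dualities. -/
def bend (n m : ℕ) (s : Diagram 0 (n + m)) : Diagram n m :=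
  ((wires n ⊠ s).cast (Nat.add_zero n) (Nat.add_assoc n n m).symm ⨟ (caps n ⊠ wires m)).cast rfl
    (Nat.zero_add m)

/-- The black vertex with `n` inputs and `m` outputs. -/
def blackV (n m : ℕ) : Diagram n m := bend n m (black (n + m))

/-- The white vertex with `n` inputs and `m` outputs. -/
def whiteV (n m : ℕ) : Diagram n m := bend n m (white (n + m))

/-- The binary black vertex, interpreted as the negation `|0⟩ ↔ |1⟩`. -/
def blackBin : Diagram 1 1 := blackV 1 1

/-- The binary white vertex, interpreted as the sign changer `|0⟩ ↦ |0⟩`, `|1⟩ ↦ -|1⟩`. -/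
def whiteBin : Diagram 1 1 := whiteV 1 1

/-- The `n`-ary multiplication of the black monoid (its unit when `n = 0`). -/
def blackMul (n : ℕ) : Diagram n 1 := blackV n 1 ⨟ blackBin

/-- The `n`-ary comultiplication of the black comonoid (its counit when `n = 0`). -/
def blackComul (n : ℕ) : Diagram 1 n := blackBin ⨟ blackV 1 n

/-- The `n`-ary comultiplication of the white comonoid (its counit when `n = 0`);
it copies `|0⟩` and `|1⟩`. -/
def whiteComul (n : ℕ) : Diagram 1 n := whiteBin ⨟ whiteV 1 n

/-! ### Juxtapositions and bipartite wirings -/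

/-- `k` copies of a one-wire diagram, side by side. -/
def power (f : Diagram 1 1) : (k : ℕ) → Diagram k k
  | 0 => wires 0
  | k + 1 => power f k ⊠ f

/-- The juxtaposition of a finite family of diagrams. -/
def juxt : {q : ℕ} → {a b : Fin q → ℕ} → ((i : Fin q) → Diagram (a i) (b i)) →
    Diagram (∑ i, a i) (∑ i, b i)
  | 0, _, _, _ => (wires 0).cast (by simp) (by simp)
  | _ + 1, _, _, f =>
    (juxt (fun i => f i.castSucc) ⊠ f (Fin.last _)).cast
      (by rw [Fin.sum_univ_castSucc]) (by rw [Fin.sum_univ_castSucc])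

/-- One wire crosses a bundle of `q` wires, using the crossing `cross`. -/
def crossOne : (q : ℕ) → Diagram (1 + q) (q + 1)
  | 0 => wires 1
  | q + 1 => (crossOne q ⊠ wires 1 :) ⨟ (wires q ⊠ cross :)

/-- A bundle of `p` wires crosses a bundle of `q` wires, using the crossing `cross`. -/
def crossBundle : (p q : ℕ) → Diagram (p + q) (q + p)
  | 0, q => (wires q).cast (by omega) (by omega)
  | p + 1, q =>
    ((wires p ⊠ crossOne q :) ⨟ (crossBundle p q ⊠ wires 1 :) :).cast (by omega) (by omega)

/-- Wires in two groups, the `j`-th bundle of the first group having `c j` wires and that of the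
second group `d j` wires: put the two `j`-th bundles next to each other for all `j`. Here `K`
says how a bundle is moved past another one. -/
def merge (K : (p q : ℕ) → Diagram (p + q) (q + p)) :
    {n : ℕ} → (c d : Fin n → ℕ) → Diagram ((∑ j, c j) + ∑ j, d j) (∑ j, (c j + d j))
  | 0, _, _ => (wires 0).cast (by simp) (by simp)
  | n + 1, c, d =>
    ((wires (∑ j : Fin n, c j.castSucc) ⊠ K (c (Fin.last n)) (∑ j : Fin n, d j.castSucc) ⊠
        wires (d (Fin.last n))).cast rfl (by omega :
          _ = (∑ j : Fin n, c j.castSucc) + (∑ j : Fin n, d j.castSucc) +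
            (c (Fin.last n) + d (Fin.last n))) ⨟
      (merge K (fun j => c j.castSucc) (fun j => d j.castSucc) ⊠
        wires (c (Fin.last n) + d (Fin.last n)))).cast
      (by simp only [Fin.sum_univ_castSucc]; omega) (by rw [Fin.sum_univ_castSucc])

/-- Given `b i j` wires from the `i`-th bottom vertex to the `j`-th top vertex, ordered by `i`
and then by `j` at the bottom, reorder them by `j` and then by `i`. -/
def wiring (K : (p q : ℕ) → Diagram (p + q) (q + p)) {n : ℕ} :
    {q : ℕ} → (b : Fin q → Fin n → ℕ) → Diagram (∑ i, ∑ j, b i j) (∑ j, ∑ i, b i j)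
  | 0, _ => (wires 0).cast (by simp) (by simp)
  | q + 1, b =>
    ((wiring K (fun i : Fin q => b i.castSucc) ⊠ wires (∑ j, b (Fin.last q) j)) ⨟
      merge K (fun j => ∑ i : Fin q, b i.castSucc j) (b (Fin.last q))).cast
      (by rw [Fin.sum_univ_castSucc]) (by simp only [Fin.sum_univ_castSucc])

/-- The diagram with `q` bottom vertices, the `i`-th being `f i` with one input, `n` top vertices,
each being `g` with one output, and `b i j` wires from the `i`-th bottom vertex to the `j`-th top
vertex. -/
def bipartite (K : (p q : ℕ) → Diagram (p + q) (q + p)) {q n : ℕ} (b : Fin q → Fin n → ℕ)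
    (f : Fin q → (k : ℕ) → Diagram 1 k) (g : (k : ℕ) → Diagram k 1) : Diagram q n :=
  (juxt (fun i => f i (∑ j, b i j)) ⨟ wiring K b ⨟ juxt (fun j => g (∑ i, b i j))).cast
    (by simp) (by simp)

/-! ### The rules of the condensed ZW calculus -/

/-- The rewrite rules of the condensed ZW calculus. -/
inductive Rule : {a b : ℕ} → Diagram a b → Diagram a b → Prop
  /-- The vertices are symmetric. -/
  | sym_black (i j : ℕ) :
      Rule (black (i + 2 + j) ⨟ (wires i ⊠ braid 1 1 ⊠ wires j)) (black (i + 2 + j))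
  | sym_white (i j : ℕ) :
      Rule (white (i + 2 + j) ⨟ (wires i ⊠ braid 1 1 ⊠ wires j)) (white (i + 2 + j))
  /-- Trace rules. -/
  | tr_black : Rule (black 3 ⨟ (wires 1 ⊠ cap :)) (black 1)
  | tr_white : Rule (white 3 ⨟ (wires 1 ⊠ cap :)) (white 1)
  /-- Spider rules. -/
  | sp_black (n m : ℕ) : Rule (blackV n 1 ⨟ blackBin ⨟ blackV 1 m) (blackV n m)
  | sp_white (n m : ℕ) : Rule (whiteV n 1 ⨟ whiteBin ⨟ whiteV 1 m) (whiteV n m)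
  /-- The binary vertices are involutions. -/
  | inv_black : Rule (blackBin ⨟ blackBin) (wires 1)
  | inv_white : Rule (whiteBin ⨟ whiteBin) (wires 1)
  /-- Phase rule, for the white vertex with `n + 2` legs. -/
  | ph (n : ℕ) : Rule (whiteBin ⨟ whiteV 1 (n + 1)) (whiteV 1 (n + 1) ⨟ (wires n ⊠ whiteBin))
  /-- Automorphism rules. -/
  | am_black (n : ℕ) : Rule (whiteBin ⨟ blackComul n) (blackComul n ⨟ power whiteBin n)
  | am_white (n : ℕ) : Rule (blackBin ⨟ whiteComul n) (whiteComul n ⨟ power blackBin n)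
  /-- Bialgebra rule for the black monoid and comonoid, with crossings. -/
  | ba_black (n m : ℕ) :
      Rule (blackV n 1 ⨟ blackV 1 m)
        (bipartite crossBundle (fun (_ : Fin n) (_ : Fin m) => 1) (fun _ => blackComul) blackMul)
  /-- Loop rule for the black monoid and comonoid. -/
  | lp_black (n m : ℕ) :
      Rule (blackComul (n + m + m) ⨟ (wires (n + m) ⊠ power whiteBin m) ⨟ blackMul (n + m + m))
        (blackComul n ⨟ blackMul n)
  /-- Bialgebra rule for the black monoid and the white comonoid, with braidings. -/
  | ba (n m : ℕ) :
      Rule (blackMul n ⨟ whiteComul (m + 1))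
        (bipartite braid (fun (_ : Fin n) (_ : Fin (m + 1)) => 1) (fun _ => whiteComul) blackMul)
  /-- Loop rule for the black monoid and the white comonoid. -/
  | lp (n : ℕ) : Rule (whiteComul (n + 2) ⨟ blackMul (n + 2)) (blackComul 0 ⨟ blackMul 0)
  /-- The black multiplication is even, the binary black vertex is odd. -/
  | even_black :
      Rule ((blackMul 2 ⊠ wires 1 :) ⨟ cross)
        ((wires 1 ⊠ cross :) ⨟ (cross ⊠ wires 1 :) ⨟ (wires 1 ⊠ blackMul 2 :))
  | odd_black : Rule ((blackBin ⊠ wires 1 :) ⨟ cross) (cross ⨟ (whiteBin ⊠ blackBin :))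
  /-- Elimination rule: a crossing between legs of two white vertices that are joined to a common black
  vertex is a braiding. -/
  | elim :
      Rule ((wires 1 ⊠ blackV 1 2 ⊠ wires 1 :) ⨟ (whiteV 2 1 ⊠ whiteV 2 1 :) ⨟ cross)
        ((wires 1 ⊠ blackV 1 2 ⊠ wires 1 :) ⨟ (whiteV 2 1 ⊠ whiteV 2 1 :) ⨟ braid 1 1)

/-- `Rewrites f g`: the diagram `f` can be rewritten into `g`, that is, they are the same morphism
of the self-dual compact closed PROP presented by the generators and the rewrite rules of the
condensed ZW calculus. The constructors are: congruence, the axioms of a symmetric strict monoidal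
category, self-duality, and the rules. -/
inductive Rewrites : {a b : ℕ} → Diagram a b → Diagram a b → Prop
  | refl {a b : ℕ} (f : Diagram a b) : Rewrites f f
  | symm {a b : ℕ} {f g : Diagram a b} : Rewrites f g → Rewrites g f
  | trans {a b : ℕ} {f g h : Diagram a b} : Rewrites f g → Rewrites g h → Rewrites f h
  | comp_congr {a b c : ℕ} {f f' : Diagram a b} {g g' : Diagram b c} :
      Rewrites f f' → Rewrites g g' → Rewrites (f ⨟ g) (f' ⨟ g')
  | tensor_congr {a b c d : ℕ} {f f' : Diagram a b} {g g' : Diagram c d} :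
      Rewrites f f' → Rewrites g g' → Rewrites (f ⊠ g) (f' ⊠ g')
  | id_comp {a b : ℕ} (f : Diagram a b) : Rewrites (wires a ⨟ f) f
  | comp_id {a b : ℕ} (f : Diagram a b) : Rewrites (f ⨟ wires b) f
  | comp_assoc {a b c d : ℕ} (f : Diagram a b) (g : Diagram b c) (h : Diagram c d) :
      Rewrites (f ⨟ g ⨟ h) (f ⨟ (g ⨟ h))
  | tensor_id (a b : ℕ) : Rewrites (wires a ⊠ wires b) (wires (a + b))
  | interchange {a b c a' b' c' : ℕ} (f : Diagram a b) (g : Diagram b c) (f' : Diagram a' b')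
      (g' : Diagram b' c') : Rewrites ((f ⨟ g) ⊠ (f' ⨟ g')) ((f ⊠ f') ⨟ (g ⊠ g'))
  | tensor_assoc {a b c d a' b' : ℕ} (f : Diagram a b) (g : Diagram c d) (h : Diagram a' b') :
      Rewrites ((f ⊠ g ⊠ h).cast (Nat.add_assoc a c a') (Nat.add_assoc b d b')) (f ⊠ (g ⊠ h))
  | tensor_unit {a b : ℕ} (f : Diagram a b) : Rewrites (f ⊠ wires 0) f
  | unit_tensor {a b : ℕ} (f : Diagram a b) :
      Rewrites ((wires 0 ⊠ f).cast (Nat.zero_add a) (Nat.zero_add b)) f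
  | braid_natural {a b c d : ℕ} (f : Diagram a b) (g : Diagram c d) :
      Rewrites ((f ⊠ g) ⨟ braid b d) (braid a c ⨟ (g ⊠ f))
  | braid_braid (a b : ℕ) : Rewrites (braid a b ⨟ braid b a) (wires (a + b))
  | hexagon (a b c : ℕ) :
      Rewrites (braid a (b + c))
        (((braid a b ⊠ wires c) ⨟
          (wires b ⊠ braid a c).cast (Nat.add_assoc b a c).symm (Nat.add_assoc b c a).symm).cast
            (Nat.add_assoc a b c) rfl)
  | zigzag_left : Rewrites ((wires 1 ⊠ cup :) ⨟ (cap ⊠ wires 1 :)) (wires 1)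
  | zigzag_right : Rewrites ((cup ⊠ wires 1 :) ⨟ (wires 1 ⊠ cap :)) (wires 1)
  | cup_braid : Rewrites (cup ⨟ braid 1 1) cup
  | braid_cap : Rewrites (braid 1 1 ⨟ cap) cap
  | rule {a b : ℕ} {f g : Diagram a b} : Rule f g → Rewrites f g

/-! ### The normal form -/

/-- The bit strings `x` of length `n` with `ψ x ≠ 0`, in a fixed order. -/
def support {n : ℕ} (ψ : (Fin n → Fin 2) → ℤ) : List (Fin n → Fin 2) :=
  ((List.finRange (2 ^ n)).map finFunctionFinEquiv.symm).filter fun x => ψ x ≠ 0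

/-- The part of the normal form that belongs to one summand `z |x⟩`, `z ≠ 0`, where `x` has `k`
bits equal to `1`: a loop made of `|z|` parallel wires between two black vertices, then a sign
changer if `z < 0`, then a white vertex with `k` outputs. -/
def branch (z : ℤ) (k : ℕ) : Diagram 1 k :=
  blackComul z.natAbs ⨟ blackMul z.natAbs ⨟ (if z < 0 then whiteBin else wires 1) ⨟ whiteComul k

/-- The normal form of the state `∑ x, ψ x • |x⟩`: a black vertex with one leg for each non-zero
summand, the branches of the summands, and a black vertex for each output, with a wire from the
`i`-th branch to the `j`-th output whenever the `j`-th bit of the `i`-th summand is `1`. -/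
def normalState {n : ℕ} (ψ : (Fin n → Fin 2) → ℤ) : Diagram 0 n :=
  black (support ψ).length ⨟
    bipartite braid (fun i j => ((support ψ).get i j : ℕ)) (fun i => branch (ψ ((support ψ).get i)))
      blackMul

/-- `(ℤ ⊕ ℤ)^{⊗ n}`. -/
abbrev Qubits (n : ℕ) : Type := ⨂[ℤ] _ : Fin n, ℤ × ℤ

/-- The basis of `(ℤ ⊕ ℤ)^{⊗ n}` given by the elements `|x⟩` for the bit strings `x`. -/
noncomputable def ketBasis (n : ℕ) : Module.Basis (Fin n → Fin 2) ℤ (Qubits n) :=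
  Basis.piTensorProduct fun _ => Module.Basis.finTwoProd ℤ

/-- The coefficients of the state of which `f` is the partial transpose: the coefficient of
`|x y⟩` is that of `|y⟩` in `f |x⟩`. -/
noncomputable def transposeState {n m : ℕ} (f : Qubits n →ₗ[ℤ] Qubits m) :
    (Fin (n + m) → Fin 2) → ℤ := fun z =>
  (ketBasis m).repr (f (ketBasis n fun i => z (Fin.castAdd m i))) fun j => z (Fin.natAdd n j)

/-- The diagram `N(f)` of a homomorphism `f`. -/
noncomputable def N {n m : ℕ} (f : Qubits n →ₗ[ℤ] Qubits m) : Diagram n m :=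
  bend n m (normalState (transposeState f))

end ZW

set_option linter.unusedSimpArgs false

/-! The proof is a structural induction carried out inside the calculus. In the intended
interpretation the black comultiplication δ sends |0⟩ to |00⟩ and |1⟩ to |10⟩ + |01⟩, the black
multiplication μ is its transpose, the white comultiplication c copies |0⟩ and |1⟩, and S changes
the sign of |1⟩. A morphism x : 1 → n with x|0⟩ = |0…0⟩ therefore encodes the vector x|1⟩, and
linear algebra becomes diagrammatic. The sum of two vectors is their convolution: δ on the input, x
beside y, μ on each pair of outputs. Their tensor product copies the input by c, and the negative
precomposes with S. `Vec n` is the commutative monoid under convolution, and `Vec.span n` is its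
part generated by integer multiples of basis vectors. A state is called good (`IsState`) if it is
|1⟩, the unary black vertex, followed by an element of the span.

The heart is `good_mor`: every diagram, applied to some of the wires of a good state, yields a good
state. It suffices to treat generators, composites and juxtapositions. (a) Vertices are good states:
the black one by the recursion `Vec.black_succ` for δ_n, the white one because it is |0…0⟩ − |1…1⟩
(`Vec.whiteM_eq`). (b) Juxtaposition of good states is the tensor product of vectors. The span is
closed under it because the tensor product is additive in each factor on the span
(`Vec.star_mem_span`). Bialgebra II gives the simple distributive laws (`c_delta`); full additivity
needs `c_delta_delta`, where Bialgebra I creates a crossing that the elimination rule turns into a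
braiding. (c) Braidings permute the bits of basis vectors. (d) The cap keeps the components whose
last two bits are 00 or 11 and kills the mixed ones (`Vec.contract_mem_span`). The killing is the
lemma `cut`, which comes from Loop II and the white Frobenius law. (e) The crossing is expressed
through the other generators (`cross_eq`): it is isolated from Bialgebra I by means of S, which Loop
I makes an antipode of the black bialgebra. The same rule gives 1 + (−1) = 0, so that integer
coefficients make sense (`Vec.e_add_neg_e`).

Bending wires then presents an arbitrary diagram n → m as a bent good state (`exists_bendM_eq`). On
the other side, a bipartite diagram below which stands δ_q is literally a q-fold convolution sum
(`bipartite_eq_sum`), and a loop of k wires is multiplication by k (`Vec.iota_natCast`). Hence the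
normal form of ψ is |1⟩ followed by ∑ ψ(b)|b⟩ (`Vec.normalState_mor`). Every element of the span is
such a sum (`Vec.exists_eq_sum`), and every coefficient family comes from a homomorphism
(`exists_transposeState`).

The many diagrammatic identities are verified by computation. A diagram with named wires is a
straight-line program; by coherence for symmetries its meaning depends neither on the order of
independent instructions nor on the names (`Env.Reorder.unique`, `Env.Run.eq_of_perm`). A rewriting
step is therefore a decidable relation between programs (`Env.Eqv.step`). -/

namespace ZW
open Diagram

/-! ### The presented PROP as a strict symmetric monoidal category. -/

/-- Rewriting is an equivalence relation. -/
def rewriteSetoid (a b : ℕ) : Setoid (Diagram a b) :=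
  ⟨Rewrites, ⟨Rewrites.refl, Rewrites.symm, Rewrites.trans⟩⟩

/-- Morphisms of the PROP presented by the condensed ZW calculus, with their numbers of inputs and
outputs as data, so that juxtaposition is associative on the nose. -/
structure Mor where
  dom : ℕ
  cod : ℕ
  hom : Quotient (rewriteSetoid dom cod)

/-- The morphism represented by a diagram. -/
def Diagram.mor {a b : ℕ} (f : Diagram a b) : Mor := ⟨a, b, Quotient.mk _ f⟩

@[simp] theorem Diagram.mor_dom {a b : ℕ} (f : Diagram a b) : f.mor.dom = a := rfl
@[simp] theorem Diagram.mor_cod {a b : ℕ} (f : Diagram a b) : f.mor.cod = b := rfl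

theorem mor_eq_iff {a b : ℕ} {f g : Diagram a b} : f.mor = g.mor ↔ Rewrites f g := by
  constructor
  · intro h
    simp only [Diagram.mor, Mor.mk.injEq, heq_eq_eq, true_and] at h
    exact Quotient.exact h
  · intro h
    simp only [Diagram.mor, Mor.mk.injEq, heq_eq_eq, true_and]
    exact Quotient.sound h

theorem Rewrites.mor_eq {a b : ℕ} {f g : Diagram a b} (h : Rewrites f g) : f.mor = g.mor :=
  mor_eq_iff.2 h

@[simp] theorem mor_cast {a b a' b' : ℕ} (ha : a = a') (hb : b = b') (f : Diagram a b) :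
    (f.cast ha hb).mor = f.mor := by
  subst ha hb; rfl

namespace Mor

/-- Every morphism is represented by a diagram. -/
theorem exists_diagram (f : Mor) : ∃ d : Diagram f.dom f.cod, f = d.mor := by
  obtain ⟨a, b, f⟩ := f
  induction f using Quotient.inductionOn with
  | h d => exact ⟨d, rfl⟩

/-- Juxtaposition. -/
instance : Mul Mor where
  mul f g := ⟨f.dom + g.dom, f.cod + g.cod,
    Quotient.map₂ (fun a b => a ⊠ b) (fun _ _ h _ _ h' => Rewrites.tensor_congr h h') f.hom g.hom⟩

instance : One Mor := ⟨(wires 0).mor⟩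

/-- Sequential composition; a value of no interest if the arities do not match. -/
def comp (f g : Mor) : Mor :=
  if h : f.cod = g.dom then
    ⟨f.dom, g.cod, Quotient.map₂ (fun a b => a ⨟ b)
      (fun _ _ h _ _ h' => Rewrites.comp_congr h h') f.hom
      (h ▸ g.hom : Quotient (rewriteSetoid f.cod g.cod))⟩
  -- Any morphism of these arities would do; the choice makes `comp_dom` and `comp_cod` hold without
  -- a matching hypothesis.
  else (blackV f.dom g.cod).mor

infixl:60 " ⟫ " => Mor.comp

/-- Parallel wires. -/
def wr (n : ℕ) : Mor := (wires n).mor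

/-- The symmetric braiding. -/
def br (a b : ℕ) : Mor := (braid a b).mor

end Mor

open Mor

theorem mor_tensor {a b c d : ℕ} (f : Diagram a b) (g : Diagram c d) :
    (f ⊠ g).mor = f.mor * g.mor := rfl

theorem mor_comp {a b c : ℕ} (f : Diagram a b) (g : Diagram b c) :
    (f ⨟ g).mor = f.mor ⟫ g.mor := by
  simp [Mor.comp, Diagram.mor]

theorem mor_wires (n : ℕ) : (wires n).mor = wr n := rfl
theorem mor_braid (a b : ℕ) : (braid a b).mor = br a b := rfl

namespace Mor

@[simp] theorem mul_dom (f g : Mor) : (f * g).dom = f.dom + g.dom := rfl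
@[simp] theorem mul_cod (f g : Mor) : (f * g).cod = f.cod + g.cod := rfl
@[simp] theorem comp_dom (f g : Mor) : (f ⟫ g).dom = f.dom := by
  unfold comp; split <;> rfl
@[simp] theorem comp_cod (f g : Mor) : (f ⟫ g).cod = g.cod := by
  unfold comp; split <;> rfl
@[simp] theorem one_dom : (1 : Mor).dom = 0 := rfl
@[simp] theorem one_cod : (1 : Mor).cod = 0 := rfl
@[simp] theorem wr_dom (n : ℕ) : (wr n).dom = n := rfl
@[simp] theorem wr_cod (n : ℕ) : (wr n).cod = n := rfl
@[simp] theorem br_dom (a b : ℕ) : (br a b).dom = a + b := rfl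
@[simp] theorem br_cod (a b : ℕ) : (br a b).cod = b + a := rfl

theorem wr_zero : wr 0 = 1 := rfl

instance : Monoid Mor where
  mul_assoc f g h := by
    obtain ⟨f', hf⟩ := f.exists_diagram
    obtain ⟨g', hg⟩ := g.exists_diagram
    obtain ⟨h', hh⟩ := h.exists_diagram
    rw [hf, hg, hh, ← mor_tensor, ← mor_tensor, ← mor_tensor, ← mor_tensor,
      ← (Rewrites.tensor_assoc f' g' h').mor_eq, mor_cast]
  one_mul f := by
    obtain ⟨f', hf⟩ := f.exists_diagram
    have := (Rewrites.unit_tensor f').mor_eq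
    rw [mor_cast, mor_tensor] at this
    rw [hf]; exact this
  mul_one f := by
    obtain ⟨f', hf⟩ := f.exists_diagram
    have := (Rewrites.tensor_unit f').mor_eq
    rw [mor_tensor] at this
    rw [hf]; exact this

theorem comp_assoc {f g h : Mor} (h₁ : f.cod = g.dom) (h₂ : g.cod = h.dom) :
    f ⟫ g ⟫ h = f ⟫ (g ⟫ h) := by
  obtain ⟨a, b, f⟩ := f
  obtain ⟨b', c, g⟩ := g
  obtain ⟨c', d, h⟩ := h
  dsimp only at h₁ h₂
  subst h₁ h₂
  induction f using Quotient.inductionOn with | h f =>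
  induction g using Quotient.inductionOn with | h g =>
  induction h using Quotient.inductionOn with | h h =>
  change f.mor ⟫ g.mor ⟫ h.mor = f.mor ⟫ (g.mor ⟫ h.mor)
  simp only [← mor_comp]
  exact (Rewrites.comp_assoc f g h).mor_eq

theorem wr_comp {f : Mor} {n : ℕ} (h : n = f.dom) : wr n ⟫ f = f := by
  subst h
  obtain ⟨f', hf⟩ := f.exists_diagram
  have := (Rewrites.id_comp f').mor_eq
  rw [mor_comp] at this
  rw [hf]; exact this

theorem comp_wr {f : Mor} {n : ℕ} (h : f.cod = n) : f ⟫ wr n = f := by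
  subst h
  obtain ⟨f', hf⟩ := f.exists_diagram
  have := (Rewrites.comp_id f').mor_eq
  rw [mor_comp] at this
  rw [hf]; exact this

theorem wr_mul_wr (a b : ℕ) : wr a * wr b = wr (a + b) := (Rewrites.tensor_id a b).mor_eq

theorem comp_mul_comp {f g f' g' : Mor} (h : f.cod = g.dom) (h' : f'.cod = g'.dom) :
    (f ⟫ g) * (f' ⟫ g') = (f * f') ⟫ (g * g') := by
  obtain ⟨a, b, f⟩ := f
  obtain ⟨b', c, g⟩ := g
  obtain ⟨a₁, b₁, f'⟩ := f'
  obtain ⟨b₁', c₁, g'⟩ := g'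
  dsimp only at h h'
  subst h h'
  induction f using Quotient.inductionOn with | h f =>
  induction g using Quotient.inductionOn with | h g =>
  induction f' using Quotient.inductionOn with | h f' =>
  induction g' using Quotient.inductionOn with | h g' =>
  change (f.mor ⟫ g.mor) * (f'.mor ⟫ g'.mor) = (f.mor * f'.mor) ⟫ (g.mor * g'.mor)
  simp only [← mor_comp, ← mor_tensor]
  exact (Rewrites.interchange f g f' g').mor_eq

theorem wr_mul_comp {f g : Mor} (n : ℕ) (h : f.cod = g.dom) :
    wr n * (f ⟫ g) = (wr n * f) ⟫ (wr n * g) := by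
  rw [← comp_mul_comp (by simp) h, wr_comp (by simp)]

theorem comp_mul_wr {f g : Mor} (n : ℕ) (h : f.cod = g.dom) :
    (f ⟫ g) * wr n = (f * wr n) ⟫ (g * wr n) := by
  rw [← comp_mul_comp h (by simp), wr_comp (by simp)]

/-- Independent morphisms can be applied in either order. -/
theorem mul_wr_comp_wr_mul {f g : Mor} {a b : ℕ} (ha : a = g.dom) (hb : b = f.cod) :
    (f * wr a) ⟫ (wr b * g) = f * g := by
  rw [← comp_mul_comp (by simp [hb]) (by simp [ha]), comp_wr hb.symm, wr_comp ha]

theorem wr_mul_comp_mul_wr {f g : Mor} {a b : ℕ} (ha : a = f.dom) (hb : b = g.cod) :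
    (wr a * g) ⟫ (f * wr b) = f * g := by
  rw [← comp_mul_comp (by simp [ha]) (by simp [hb]), wr_comp ha, comp_wr hb.symm]

theorem br_natural (f g : Mor) :
    (f * g) ⟫ br f.cod g.cod = br f.dom g.dom ⟫ (g * f) := by
  obtain ⟨f', hf⟩ := f.exists_diagram
  obtain ⟨g', hg⟩ := g.exists_diagram
  have := (Rewrites.braid_natural f' g').mor_eq
  rw [mor_comp, mor_comp, mor_tensor, mor_tensor, ← hf, ← hg] at this
  exact this

theorem br_comp_br (a b : ℕ) : br a b ⟫ br b a = wr (a + b) := by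
  have := (Rewrites.braid_braid a b).mor_eq
  rwa [mor_comp] at this

theorem br_add_right (a b c : ℕ) :
    br a (b + c) = (br a b * wr c) ⟫ (wr b * br a c) := by
  have := (Rewrites.hexagon a b c).mor_eq
  rw [mor_cast, mor_comp, mor_cast] at this
  exact this

/-- Only one hexagon is an axiom. The other follows since the braiding is its own inverse: the
right-hand side is a right inverse of `br c (a + b)`, whose inverse is `br (a + b) c`. -/
theorem br_add_left (a b c : ℕ) :
    br (a + b) c = (wr a * br b c) ⟫ (br a c * wr b) := by
  have h : br c (a + b) ⟫ ((wr a * br b c) ⟫ (br a c * wr b)) = wr (c + (a + b)) := by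
    rw [br_add_right, comp_assoc (by simp [add_assoc]) (by simp [add_assoc]),
      ← comp_assoc (f := wr a * br c b) (by simp) (by simp [add_assoc]),
      ← comp_mul_comp (by simp) (by simp), br_comp_br, wr_comp (by simp), wr_mul_wr,
      wr_comp (by simp [add_assoc]), ← comp_mul_comp (by simp) (by simp), br_comp_br, wr_comp (by simp),
      wr_mul_wr, add_assoc]
  have h₂ : br (a + b) c ⟫ (br c (a + b) ⟫ ((wr a * br b c) ⟫ (br a c * wr b))) =
      br (a + b) c := by
    rw [h, comp_wr (by simp)]
  rw [← h₂, ← comp_assoc (by simp) (by simp [add_assoc]), br_comp_br,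
    wr_comp (by simp [add_assoc])]

/-- The hexagon for a = a, b = c = 0 makes the braiding with no wires idempotent; being invertible,
it is the identity. -/
theorem br_zero_right (a : ℕ) : br a 0 = wr a := by
  have h := br_add_right a 0 0
  have h' : br a 0 = br a 0 ⟫ br a 0 := by
    rw [add_zero, wr_zero, mul_one, one_mul] at h
    exact h
  have h₂ : br 0 a ⟫ br a 0 = br 0 a ⟫ (br a 0 ⟫ br a 0) := by rw [← h']
  rw [← comp_assoc (by simp) (by simp), br_comp_br, wr_comp (by simp)] at h₂
  rw [← h₂, zero_add]

theorem br_zero_left (a : ℕ) : br 0 a = wr a := by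
  have h := br_comp_br 0 a
  rwa [br_zero_right, comp_wr (by simp), zero_add] at h

end Mor
open Diagram Mor

/-! ### Diagrams with named wires -/

/-- The type of a wire name. -/
def ty (x : ℕ) : ℕ := x / 100

/-- An interpretation: each wire type is a number of wires, each operation is a morphism. -/
structure Env where
  dim : ℕ → ℕ
  op : ℕ → Mor

/-- The meaning of the symbols: the identities of the first ten types, then the operations. -/
def Env.sym (E : Env) (k : ℕ) : Mor := if k < 10 then wr (E.dim k) else E.op (k - 10)

/-- An instruction: a symbol, the names of its inputs and the names of its outputs. -/
abbrev Instr := ℕ × List ℕ × List ℕ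

namespace Env
variable (E : Env)

/-- The number of wires in a list of types. -/
def dims (l : List ℕ) : ℕ := (l.map E.dim).sum

/-- The number of wires with the given names. -/
def len (l : List ℕ) : ℕ := E.dims (l.map ty)

@[simp] theorem len_nil : E.len [] = 0 := rfl
@[simp] theorem len_cons (x : ℕ) (l : List ℕ) : E.len (x :: l) = E.dim (ty x) + E.len l := by
  simp [len, dims]
@[simp] theorem len_append (l m : List ℕ) : E.len (l ++ m) = E.len l + E.len m := by
  simp [len, dims]

/-! ### Coherence for composites of braidings. -/

/-- `Reorder l l' f`: `f` is a composite of braidings that takes the wires `l` to the wires `l'`. -/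
inductive Reorder : List ℕ → List ℕ → Mor → Prop
  | nil : Reorder [] [] 1
  | cons {l l' : List ℕ} {f : Mor} (x : ℕ) :
      Reorder l l' f → Reorder (x :: l) (x :: l') (wr (E.dim (ty x)) * f)
  | swap (x y : ℕ) (l : List ℕ) :
      Reorder (x :: y :: l) (y :: x :: l) (br (E.dim (ty x)) (E.dim (ty y)) * wr (E.len l))
  | trans {l l' l'' : List ℕ} {f g : Mor} :
      Reorder l l' f → Reorder l' l'' g → Reorder l l'' (f ⟫ g)

variable {E}

theorem Reorder.perm {l l' : List ℕ} {f : Mor} (h : E.Reorder l l' f) : l.Perm l' := by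
  induction h with
  | nil => exact .nil
  | cons x _ ih => exact ih.cons x
  | swap x y l => exact .swap _ _ _
  | trans _ _ ih ih' => exact ih.trans ih'

theorem Reorder.dom {l l' : List ℕ} {f : Mor} (h : E.Reorder l l' f) : f.dom = E.len l := by
  induction h with
  | nil => rfl
  | cons x _ ih => simp [ih]
  | swap x y l => simp [add_assoc]
  | trans _ _ ih _ => simp [ih]

theorem Reorder.cod {l l' : List ℕ} {f : Mor} (h : E.Reorder l l' f) : f.cod = E.len l' := by
  induction h with
  | nil => rfl
  | cons x _ ih => simp [ih]
  | swap x y l => simp [add_assoc]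
  | trans _ _ _ ih => simp [ih]

theorem Reorder.refl (l : List ℕ) : E.Reorder l l (wr (E.len l)) := by
  induction l with
  | nil => exact .nil
  | cons x l ih => simpa [wr_mul_wr] using ih.cons x

theorem exists_reorder {l l' : List ℕ} (h : l.Perm l') : ∃ f, E.Reorder l l' f := by
  induction h with
  | nil => exact ⟨_, .nil⟩
  | cons x _ ih => exact ⟨_, ih.choose_spec.cons x⟩
  | swap x y l => exact ⟨_, .swap _ _ _⟩
  | trans _ _ ih ih' => exact ⟨_, ih.choose_spec.trans ih'.choose_spec⟩

theorem Reorder.append_left {l l' : List ℕ} {f : Mor} (m : List ℕ) (h : E.Reorder l l' f) :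
    E.Reorder (m ++ l) (m ++ l') (wr (E.len m) * f) := by
  induction m with
  | nil => simpa [wr_zero] using h
  | cons x m ih => simpa [← wr_mul_wr, mul_assoc] using ih.cons x

theorem Reorder.append_right {l l' : List ℕ} {f : Mor} (m : List ℕ) (h : E.Reorder l l' f) :
    E.Reorder (l ++ m) (l' ++ m) (f * wr (E.len m)) := by
  induction h with
  | nil => simpa using Reorder.refl m
  | cons x _ ih => simpa [mul_assoc] using ih.cons x
  | swap x y l => simpa [mul_assoc, wr_mul_wr] using Reorder.swap x y (l ++ m)
  | trans h h' ih ih' =>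
    have := ih.trans ih'
    rwa [← comp_mul_comp (by rw [h.cod, h'.dom]) (by simp), wr_comp (by simp)] at this

theorem Reorder.cons_append (x : ℕ) (b : List ℕ) :
    E.Reorder (x :: b) (b ++ [x]) (br (E.dim (ty x)) (E.len b)) := by
  induction b with
  | nil => simpa [br_zero_right] using Reorder.refl [x]
  | cons y b ih =>
    have := (Reorder.swap x y b).trans (ih.cons y)
    simpa [br_add_right] using this

theorem Reorder.append_comm (a b : List ℕ) :
    E.Reorder (a ++ b) (b ++ a) (br (E.len a) (E.len b)) := by
  induction a with
  | nil => simpa [br_zero_left] using Reorder.refl b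
  | cons x a ih =>
    have := (ih.cons x).trans ((Reorder.cons_append x b).append_right a)
    simpa [br_add_left] using this

/-- `Sel x l m s`: the morphism `s` moves the wire `x` out of `l` to the front, leaving `m`. -/
inductive Sel (E : Env) (x : ℕ) : List ℕ → List ℕ → Mor → Prop
  | here (l : List ℕ) : Sel E x (x :: l) l (wr (E.len (x :: l)))
  | there {l m : List ℕ} {s : Mor} (y : ℕ) : Sel E x l m s →
      Sel E x (y :: l) (y :: m)
        ((wr (E.dim (ty y)) * s) ⟫ (br (E.dim (ty y)) (E.dim (ty x)) * wr (E.len m)))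

theorem Sel.dom {x : ℕ} {l m : List ℕ} {s : Mor} (h : Sel E x l m s) : s.dom = E.len l := by
  induction h with
  | here l => simp
  | there y _ ih => simp [ih]

theorem Sel.cod {x : ℕ} {l m : List ℕ} {s : Mor} (h : Sel E x l m s) :
    s.cod = E.dim (ty x) + E.len m := by
  induction h with
  | here l => simp
  | there y _ ih => simp [add_assoc]

theorem Sel.mem {x : ℕ} {l m : List ℕ} {s : Mor} (h : Sel E x l m s) : x ∈ l := by
  induction h with
  | here l => simp
  | there y _ ih => simp [ih]

theorem Sel.unique {x : ℕ} {l m m' : List ℕ} {s s' : Mor} (h : Sel E x l m s)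
    (h' : Sel E x l m' s') (hl : l.Nodup) : m = m' ∧ s = s' := by
  induction h generalizing m' s' with
  | here l =>
    cases h' with
    | here => exact ⟨rfl, rfl⟩
    | there y h => exact absurd h.mem (List.nodup_cons.1 hl).1
  | there y h ih =>
    cases h' with
    | here => exact absurd h.mem (List.nodup_cons.1 hl).1
    | there y h' =>
      obtain ⟨rfl, rfl⟩ := ih h' (List.nodup_cons.1 hl).2
      exact ⟨rfl, rfl⟩

/-- Naturality of the braiding lets an extraction slide backwards through each elementary exchange.
The only case with content is a wire that lies behind both exchanged ones, where the Yang–Baxter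
equation is needed. -/
theorem Reorder.sel {l l' : List ℕ} {f : Mor} (h : E.Reorder l l' f) {x : ℕ} {m' : List ℕ}
    {s' : Mor} (h' : Sel E x l' m' s') : ∃ m s f', Sel E x l m s ∧ E.Reorder m m' f' ∧
      f ⟫ s' = s ⟫ (wr (E.dim (ty x)) * f') := by
  induction h generalizing m' s' with
  | nil => cases h'
  | @cons l l' f y h ih =>
    cases h' with
    | here =>
      refine ⟨_, _, _, .here _, h, ?_⟩
      rw [comp_wr (by simp [h.cod]), wr_comp (by simp [h.dom])]
    | @there _ m₁ s₁ y h₁ =>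
      obtain ⟨m, s, f', hs, hf, e⟩ := ih h₁
      refine ⟨_, _, _, .there y hs, hf.cons y, ?_⟩
      have e₁ := h.cod
      have e₂ := h₁.dom
      have e₃ := h₁.cod
      have e₄ := hs.cod
      have e₅ := hf.dom
      have e₆ := hf.cod
      generalize E.dim (ty y) = q at *
      generalize E.dim (ty x) = r at *
      have nat : (br q r * wr (E.len m)) ⟫ (wr r * (wr q * f')) =
          (wr q * (wr r * f')) ⟫ (br q r * wr (E.len m₁)) := by
        rw [← mul_assoc, ← mul_assoc, wr_mul_wr, wr_mul_wr,
          mul_wr_comp_wr_mul (by simp [*]) (by simp),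
          wr_mul_comp_mul_wr (by simp [*]) (by simp [*])]
      rw [← comp_assoc (by simp [*]) (by simp [*, add_assoc]), ← wr_mul_comp _ (by simp [*]), e,
        wr_mul_comp _ (by simp [*]), comp_assoc (by simp [*]) (by simp [*, add_assoc]), ← nat,
        comp_assoc (by simp [*, add_assoc]) (by simp [*, add_assoc])]
  | swap a b l =>
    cases h' with
    | here =>
      refine ⟨_, _, _, .there a (.here l), Reorder.refl _, ?_⟩
      rw [comp_wr (by simp [add_assoc])]
      simp only [len_cons, wr_mul_wr]
      rw [wr_comp (by simp [add_assoc]), comp_wr (by simp [add_assoc])]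
    | there _ h₁ =>
      cases h₁ with
      | here =>
        refine ⟨_, _, _, .here _, Reorder.refl _, ?_⟩
        simp only [len_cons, wr_mul_wr]
        rw [wr_comp (by simp [add_assoc]), wr_comp (by simp),
          ← comp_mul_comp (by simp) (by simp), br_comp_br, wr_comp (by simp), wr_mul_wr, add_assoc]
      | @there _ m₁ s₁ _ h₂ =>
        refine ⟨_, _, _, .there a (.there b h₂), .swap a b m₁, ?_⟩
        have e₁ := h₂.dom
        have e₂ := h₂.cod
        simp only [len_cons]
        generalize E.dim (ty a) = p at *
        generalize E.dim (ty b) = q at *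
        generalize E.dim (ty x) = r at *
        have nat : (br p q * wr (E.len l)) ⟫ (wr q * (wr p * s₁)) =
            (wr p * (wr q * s₁)) ⟫ (br p q * wr (r + E.len m₁)) := by
          rw [← mul_assoc, ← mul_assoc, wr_mul_wr, wr_mul_wr,
            mul_wr_comp_wr_mul (by simp [*]) (by simp),
            wr_mul_comp_mul_wr (by simp [*]) (by simp [*])]
        -- Yang–Baxter is naturality of the braiding of two bundles past a third one, expanded by
        -- the second hexagon.
        have yb : (br p q * wr r) ⟫ ((wr q * br p r) ⟫ (br q r * wr p)) =
            (wr p * br q r) ⟫ ((br p r * wr q) ⟫ (wr r * br p q)) := by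
          rw [← br_add_left, ← comp_assoc (by simp [add_assoc]) (by simp [add_assoc]),
            ← br_add_left]
          exact br_natural (br p q) (wr r)
        have yb' := congrArg (· * wr (E.len m₁)) yb
        rw [comp_mul_wr _ (by simp [add_assoc]), comp_mul_wr _ (by simp [add_assoc]),
          comp_mul_wr _ (by simp [add_assoc]), comp_mul_wr _ (by simp [add_assoc])] at yb'
        simp only [mul_assoc, wr_mul_wr] at yb'
        rw [wr_mul_comp _ (by simp [*, add_assoc]), wr_mul_comp _ (by simp [*, add_assoc]),
          comp_assoc (by simp [*, add_assoc]) (by simp [*, add_assoc]),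
          ← comp_assoc (by simp [*, add_assoc]) (by simp [*, add_assoc]), nat,
          comp_assoc (by simp [*, add_assoc]) (by simp [*, add_assoc]), yb',
          comp_assoc (by simp [*, add_assoc]) (by simp [*, add_assoc]),
          comp_assoc (by simp [*, add_assoc]) (by simp [*, add_assoc])]
  | trans h₁ h₂ ih ih' =>
    obtain ⟨m, s, f', hs, hf, e⟩ := ih' h'
    obtain ⟨m₂, s₂, f₂, hs₂, hf₂, e₂⟩ := ih hs
    refine ⟨_, _, _, hs₂, hf₂.trans hf, ?_⟩
    rw [comp_assoc (by rw [h₁.cod, h₂.dom]) (by rw [h₂.cod, h'.dom]), e,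
      ← comp_assoc (by rw [h₁.cod, hs.dom]) (by simp [hs.cod, hf.dom]), e₂,
      comp_assoc (by simp [hs₂.cod, hf₂.dom]) (by simp [hf₂.cod, hf.dom]),
      ← comp_mul_comp (by simp) (by simp [hf₂.cod, hf.dom]), wr_comp (by simp)]

theorem Reorder.eq_one {l l' : List ℕ} {f : Mor} (h : E.Reorder l l' f) (hl : l = []) : f = 1 := by
  induction h with
  | nil => rfl
  | cons => simp at hl
  | swap => simp at hl
  | trans h₁ _ ih ih' =>
    subst hl
    rw [ih rfl, ih' (List.nil_perm.1 h₁.perm), ← wr_zero, wr_comp (by simp)]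

/-- Coherence by induction on the target: `Reorder.sel` makes both composites start by extracting
the first target wire, this extraction is unique because the names are distinct, and what remains
has a shorter target. -/
theorem Reorder.unique {l l' : List ℕ} {f g : Mor} (hl : l.Nodup) (h : E.Reorder l l' f)
    (h' : E.Reorder l l' g) : f = g := by
  induction l' generalizing l f g with
  | nil =>
    have := List.perm_nil.1 h.perm
    rw [h.eq_one this, h'.eq_one this]
  | cons x t ih =>
    obtain ⟨m, s, f', hs, hf, e⟩ := h.sel (.here t)
    obtain ⟨m₂, s₂, g', hs₂, hg, e₂⟩ := h'.sel (.here t)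
    obtain ⟨rfl, rfl⟩ := hs.unique hs₂ hl
    rw [comp_wr h.cod] at e
    rw [comp_wr h'.cod] at e₂
    have hm : (x :: m).Nodup := by
      obtain ⟨k, hk⟩ : ∃ k, E.Reorder (x :: m) (x :: t) k := ⟨_, hf.cons x⟩
      exact (hk.perm.trans h.perm.symm).nodup_iff.2 hl
    rw [e, e₂, ih (List.nodup_cons.1 hm).2 hf hg]

/-! ### Execution of programs and independence of all choices. -/

/-- The names of the outputs of the instructions of a program. -/
def _root_.ZW.outs (P : List Instr) : List ℕ := P.flatMap fun i => i.2.2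

@[simp] theorem outs_nil : outs [] = [] := rfl
@[simp] theorem outs_cons (i : Instr) (P : List Instr) : outs (i :: P) = i.2.2 ++ outs P := rfl
@[simp] theorem outs_append (P Q : List Instr) : outs (P ++ Q) = outs P ++ outs Q := by
  simp [outs]

/-- `Run L P L' f`: executing the program `P` on the wires `L` yields the wires `L'`, and `f` is
the resulting morphism. -/
inductive Run (E : Env) : List ℕ → List Instr → List ℕ → Mor → Prop
  | nil {L L' : List ℕ} {f : Mor} : L.Nodup → E.Reorder L L' f → Run E L [] L' f
  | cons {L R L' : List ℕ} {P : List Instr} {i : Instr} {r g : Mor} : L.Nodup →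
      E.Reorder L (i.2.1 ++ R) r → (E.sym i.1).dom = E.len i.2.1 → (E.sym i.1).cod = E.len i.2.2 →
      Run E (i.2.2 ++ R) P L' g → Run E L (i :: P) L' (r ⟫ ((E.sym i.1 * wr (E.len R)) ⟫ g))

namespace Run

variable {L L' L'' : List ℕ} {P P' : List Instr} {f g : Mor}

theorem nodup (h : Run E L P L' f) : L.Nodup := by cases h <;> assumption

theorem dom (h : Run E L P L' f) : f.dom = E.len L := by
  cases h with
  | nil _ h => exact h.dom
  | cons _ h => simpa using h.dom

theorem cod (h : Run E L P L' f) : f.cod = E.len L' := by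
  induction h with
  | nil _ h => exact h.cod
  | cons _ _ _ _ _ ih => simpa using ih

theorem pre (h : Run E L P L' f) {r : Mor} (hr : E.Reorder L'' L r) :
    Run E L'' P L' (r ⟫ f) := by
  have hn := hr.perm.nodup_iff.2 h.nodup
  cases h with
  | nil _ h => exact .nil hn (hr.trans h)
  | cons _ h h₁ h₂ h₃ =>
    rw [← comp_assoc (by rw [hr.cod, h.dom]) (by simp [h.cod, h₁])]
    exact .cons hn (hr.trans h) h₁ h₂ h₃

theorem post (h : Run E L P L' f) {r : Mor} (hr : E.Reorder L' L'' r) :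
    Run E L P L'' (f ⟫ r) := by
  induction h with
  | nil hn h => exact .nil hn (h.trans hr)
  | cons hn h h₁ h₂ h₃ ih =>
    rw [comp_assoc (by simp [h.cod, h₁]) (by simp [h₃.cod, hr.dom]),
      comp_assoc (by simp [h₂, h₃.dom]) (by simp [h₃.cod, hr.dom])]
    exact .cons hn h h₁ h₂ (ih hr)

theorem append (h : Run E L P L' f) (h' : Run E L' P' L'' g) : Run E L (P ++ P') L'' (f ⟫ g) := by
  induction h with
  | nil hn h => exact h'.pre h
  | cons hn h h₁ h₂ h₃ ih =>
    rw [comp_assoc (by simp [h.cod, h₁]) (by simp [h₃.cod, h'.dom]),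
      comp_assoc (by simp [h₂, h₃.dom]) (by simp [h₃.cod, h'.dom])]
    exact .cons hn h h₁ h₂ (ih h')

theorem split (P : List Instr) (h : Run E L (P ++ P') L'' f) :
    ∃ L' g k, Run E L P L' g ∧ Run E L' P' L'' k ∧ f = g ⟫ k := by
  induction P generalizing L f with
  | nil => exact ⟨L, _, _, .nil h.nodup (Reorder.refl _), h, (wr_comp h.dom.symm).symm⟩
  | cons i P ih =>
    cases h with
    | cons hn h h₁ h₂ h₃ =>
      obtain ⟨L', g, k, hg, hk, rfl⟩ := ih h₃
      refine ⟨L', _, k, .cons hn h h₁ h₂ hg, hk, ?_⟩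
      rw [comp_assoc (by simp [h.cod, h₁]) (by simp [hg.cod, hk.dom]),
        comp_assoc (by simp [h₂, hg.dom]) (by simp [hg.cod, hk.dom])]

/-- The only freedom in an execution is the order in which the untouched wires are kept. Two choices
differ by a reordering of these wires, which commutes with the instruction beside them. -/
theorem unique (h : Run E L P L' f) (h' : Run E L P L' g) : f = g := by
  induction h generalizing g with
  | nil hn h =>
    cases h' with
    | nil _ h' => exact h.unique hn h'
  | @cons L R L' P i r k hn h h₁ h₂ h₃ ih =>
    cases h' with
    | @cons _ R' _ _ _ r' k' _ h' _ _ h₃' =>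
      obtain ⟨ρ, hρ⟩ := exists_reorder (E := E)
        ((List.perm_append_left_iff i.2.1).1 (h.perm.symm.trans h'.perm))
      rw [h'.unique hn (h.trans (hρ.append_left i.2.1)), ih (h₃'.pre (hρ.append_left i.2.2))]
      have e₁ := h.cod
      have e₂ := h₃'.dom
      have e₃ := hρ.dom
      have e₄ := hρ.cod
      simp only [len_append] at e₁ e₂
      rw [comp_assoc (by simp [*]) (by simp [*]), ← comp_assoc (f := E.sym i.1 * wr (E.len R))
        (by simp [*]) (by simp [*]), ← comp_assoc (f := wr (E.len i.2.1) * ρ) (by simp [*])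
        (by simp [*]), mul_wr_comp_wr_mul e₃.symm h₂.symm, wr_mul_comp_mul_wr h₁.symm e₄.symm]

theorem tensor_right (h : Run E L P L' f) {m : List ℕ} (hm : m.Nodup) (hL : ∀ x ∈ m, x ∉ L)
    (hP : ∀ x ∈ m, x ∉ outs P) : Run E (L ++ m) P (L' ++ m) (f * wr (E.len m)) := by
  have hd : ∀ {l : List ℕ}, l.Nodup → (∀ x ∈ m, x ∉ l) → (l ++ m).Nodup := fun h h' =>
    List.nodup_append.2 ⟨h, hm, fun a ha b hb e => h' b hb (e ▸ ha)⟩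
  induction h with
  | nil hn h => exact .nil (hd hn hL) (h.append_right m)
  | @cons L R L' P i r g hn h h₁ h₂ h₃ ih =>
    simp only [outs_cons, List.mem_append, not_or] at hP
    have hR : ∀ x ∈ m, x ∉ R := fun x hx hR =>
      hL x hx (h.perm.mem_iff.2 (List.mem_append_right _ hR))
    have e₁ := h.cod
    have e₂ := h₃.dom
    simp only [len_append] at e₁ e₂
    rw [comp_mul_wr _ (by simp [*]), comp_mul_wr _ (by simp [*]), mul_assoc, wr_mul_wr,
      ← len_append]
    refine .cons (hd hn hL) (by simpa [← List.append_assoc] using h.append_right m) h₁ h₂ ?_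
    rw [← List.append_assoc]
    exact ih (fun x hx => by simp [(hP x hx).1, hR x hx]) fun x hx => (hP x hx).2

theorem tensor_left (h : Run E L P L' f) {m : List ℕ} (hm : m.Nodup) (hL : ∀ x ∈ m, x ∉ L)
    (hP : ∀ x ∈ m, x ∉ outs P) : Run E (m ++ L) P (m ++ L') (wr (E.len m) * f) := by
  have := ((h.tensor_right hm hL hP).pre (Reorder.append_comm m L)).post
    (Reorder.append_comm L' m)
  have e : br (E.len m) (E.len L) ⟫ f * wr (E.len m) ⟫ br (E.len L') (E.len m) =
      wr (E.len m) * f := by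
    have := br_natural (wr (E.len m)) f
    rw [wr_cod, wr_dom, h.dom, h.cod] at this
    rw [← this, comp_assoc (by simp [h.cod]) (by simp), br_comp_br, comp_wr (by simp [h.cod])]
  rwa [e] at this

/-- Only the types of the names enter the morphism. Injectivity is asked on a set S that contains
all names of the run, so ρ may be arbitrary elsewhere. -/
theorem rename (h : Run E L P L' f) (ρ : ℕ → ℕ) (S : List ℕ) (hρ : (S.map ρ).Nodup)
    (hS : L ++ outs P ⊆ S) (ht : ∀ x ∈ S, ty (ρ x) = ty x) :
    Run E (L.map ρ) (P.map fun i => (i.1, i.2.1.map ρ, i.2.2.map ρ)) (L'.map ρ) f := by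
  have hlen : ∀ l : List ℕ, l ⊆ S → E.len (l.map ρ) = E.len l := by
    intro l hl
    induction l with
    | nil => rfl
    | cons x l ih =>
      rw [List.cons_subset] at hl
      simp [ih hl.2, ht x hl.1]
  have hnd : ∀ l : List ℕ, l ⊆ S → l.Nodup → (l.map ρ).Nodup := fun l hl hn =>
    hn.map_on fun x hx y hy e => List.inj_on_of_nodup_map hρ (hl hx) (hl hy) e
  have hre : ∀ {l l' : List ℕ} {r : Mor}, E.Reorder l l' r → l ⊆ S →
      E.Reorder (l.map ρ) (l'.map ρ) r := by
    intro l l' r hr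
    induction hr with
    | nil => exact fun _ => .nil
    | cons x h ih =>
      intro hl
      rw [List.cons_subset] at hl
      have := (ih hl.2).cons (ρ x)
      rwa [ht x hl.1] at this
    | swap x y l =>
      intro hl
      rw [List.cons_subset, List.cons_subset] at hl
      have := Reorder.swap (E := E) (ρ x) (ρ y) (l.map ρ)
      rwa [ht x hl.1, ht y hl.2.1, hlen l hl.2.2] at this
    | trans h₁ _ ih ih' =>
      exact fun hl => (ih hl).trans (ih' fun x hx => hl (h₁.perm.mem_iff.2 hx))
  induction h with
  | nil hn h =>
    simp only [outs_nil, List.append_nil] at hS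
    exact .nil (hnd _ hS hn) (hre h hS)
  | @cons L R L' P i r g hn h h₁ h₂ h₃ ih =>
    simp only [outs_cons, List.append_subset] at hS
    have hiR : i.2.1 ++ R ⊆ S := fun x hx => hS.1 (h.perm.mem_iff.2 hx)
    have hi := List.append_subset.1 hiR
    have := Run.cons (E := E) (i := (i.1, i.2.1.map ρ, i.2.2.map ρ)) (R := R.map ρ)
      (hnd _ hS.1 hn) (by simpa using hre h hS.1) (by simpa [hlen _ hi.1] using h₁)
      (by simpa [hlen _ hS.2.1] using h₂)
      (by simpa using ih (by simp [List.append_subset, hS, hi]))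
    simpa [hlen _ hi.2] using this

theorem perm_diff {a l : List ℕ} (ha : a.Nodup) (h : a ⊆ l) : l.Perm (a ++ l.diff a) := by
  refine (List.subperm_append_diff_self_of_count_le fun x hx => ?_).symm
  rw [List.count_eq_one_of_mem ha hx]
  exact List.count_pos_iff.2 (h hx)

/-- Neither instruction reads what the other writes, so they act on disjoint bundles. By `unique`
both orders may be brought to a standard execution, and these agree by naturality of the braiding.
-/
theorem swap {i j : Instr} (h : Run E L (i :: j :: P) L' f)
    (h₁ : ∀ x ∈ j.2.1, x ∉ i.2.2) (h₂ : ∀ x ∈ i.2.1, x ∉ j.2.2) :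
    Run E L (j :: i :: P) L' f := by
  obtain ⟨k, A, A'⟩ := i
  obtain ⟨k', B, B'⟩ := j
  dsimp only at h₁ h₂
  have hrun := h
  cases h with
  | @cons _ R₁ _ _ _ r g hn hr hd hc hg =>
  cases hg with
  | @cons _ R₂ _ _ _ r' g' hn' hr' hd' hc' hg' =>
  dsimp only at *
  have hB : B ⊆ R₁ := fun x hx => by
    have := hr'.perm.mem_iff.2 (List.mem_append_left R₂ hx)
    rcases List.mem_append.1 this with h | h
    · exact absurd h (h₁ x hx)
    · exact h
  have hBn : B.Nodup := (List.nodup_append.1 (hr'.perm.nodup_iff.1 hn')).1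
  have p₁ := perm_diff hBn hB
  set R := R₁.diff B
  have p₂ : R₂.Perm (A' ++ R) := by
    refine (List.perm_append_left_iff B).1 (hr'.perm.symm.trans ?_)
    refine (p₁.append_left A').trans ?_
    rw [← List.append_assoc, ← List.append_assoc]
    exact List.perm_append_comm.append_right R
  obtain ⟨t, ht⟩ := exists_reorder (E := E) (hr.perm.trans (p₁.append_left A))
  obtain ⟨u, hu⟩ := exists_reorder (E := E) (p₂.symm.append_left B')
  have hg₀ := hg'.pre hu
  have hn₁ : (A' ++ (B ++ R)).Nodup := (p₁.append_left A').nodup_iff.1 hn'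
  have hn₂ : (B' ++ (A' ++ R)).Nodup := hg₀.nodup
  have hn₃ : (B' ++ (A ++ R)).Nodup := by
    have hAR : (A ++ (B ++ R)).Nodup := ht.perm.nodup_iff.1 hn
    simp only [List.nodup_append, List.mem_append] at hn₂ hAR ⊢
    grind
  have sw : ∀ X Y : List ℕ, E.Reorder (X ++ (Y ++ R)) (Y ++ (X ++ R))
      (br (E.len X) (E.len Y) * wr (E.len R)) := fun X Y => by
    simpa using (Reorder.append_comm X Y).append_right R
  have run₁ : Run E L ((k, A, A') :: (k', B, B') :: P) L' _ :=
    .cons hn ht hd hc (.cons hn₁ (sw A' B) hd' hc' hg₀)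
  have run₂ : Run E L ((k', B, B') :: (k, A, A') :: P) L' _ :=
    .cons hn (ht.trans (sw A B)) hd' hc' (.cons hn₃ (sw B' A) hd hc (hg₀.pre (sw A' B')))
  have e₁ := hg₀.dom
  have e₂ := ht.cod
  set Q := u ⟫ g'
  clear_value Q
  simp only [len_append] at e₁ e₂
  have key : (E.sym k * wr (E.len B)) ⟫ (br (E.len A') (E.len B) ⟫ (E.sym k' * wr (E.len A'))) =
      br (E.len A) (E.len B) ⟫ ((E.sym k' * wr (E.len A)) ⟫ (br (E.len B') (E.len A) ⟫
        ((E.sym k * wr (E.len B')) ⟫ br (E.len A') (E.len B')))) := by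
    have n₁ := br_natural (wr (E.len A')) (E.sym k')
    have n₂ := br_natural (wr (E.len A)) (E.sym k')
    simp only [wr_cod, wr_dom, hd', hc'] at n₁ n₂
    rw [← n₁, ← comp_assoc (f := br (E.len A) (E.len B)) (by simp [*]) (by simp [*]), ← n₂,
      comp_assoc (g := br (E.len A) (E.len B')) (by simp [*]) (by simp [*]),
      ← comp_assoc (f := br (E.len A) (E.len B')) (by simp [*]) (by simp [*]), br_comp_br,
      wr_comp (by simp [*]), ← comp_assoc (by simp [*]) (by simp [*]),
      ← comp_assoc (by simp [*]) (by simp [*]),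
      mul_wr_comp_wr_mul (by simp [*]) (by simp [*]),
      wr_mul_comp_mul_wr (by simp [*]) (by simp [*])]
  have key' := congrArg (· * wr (E.len R)) key
  rw [comp_mul_wr _ (by simp [*]), comp_mul_wr _ (by simp [*]), comp_mul_wr _ (by simp [*]),
    comp_mul_wr _ (by simp [*]), comp_mul_wr _ (by simp [*]), comp_mul_wr _ (by simp [*])] at key'
  simp only [mul_assoc, wr_mul_wr] at key'
  rw [hrun.unique run₁]
  convert run₂ using 1
  simp only [len_append]
  rw [comp_assoc (by simp [*, add_assoc]) (by simp [*, add_assoc])]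
  congr 1
  have key'' := congrArg (· ⟫ Q) key'
  rw [comp_assoc (by simp [*, add_assoc]) (by simp [*, add_assoc]),
    comp_assoc (by simp [*, add_assoc]) (by simp [*, add_assoc]),
    comp_assoc (by simp [*, add_assoc]) (by simp [*, add_assoc]),
    comp_assoc (by simp [*, add_assoc]) (by simp [*, add_assoc]),
    comp_assoc (by simp [*, add_assoc]) (by simp [*, add_assoc]),
    comp_assoc (by simp [*, add_assoc]) (by simp [*, add_assoc])] at key''
  exact key''

theorem cod_perm {L₁ L₁' : List ℕ} (h : Run E L P L' f) (h' : Run E L₁ P L₁' g)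
    (hp : L.Perm L₁) : L'.Perm L₁' := by
  induction h generalizing L₁ g with
  | nil _ h =>
    cases h' with
    | nil _ h' => exact h.perm.symm.trans (hp.trans h'.perm)
  | cons _ h _ _ _ ih =>
    cases h' with
    | cons _ h' _ _ h₃ =>
      exact ih h₃ (((List.perm_append_left_iff _).1
        (h.perm.symm.trans (hp.trans h'.perm))).append_left _)

theorem cod_subset (h : Run E L P L' f) : L' ⊆ L ++ outs P := by
  induction h with
  | nil _ h => exact fun x hx => by simpa using h.perm.mem_iff.2 hx
  | cons _ h _ _ _ ih =>
    intro x hx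
    have h₁ := ih hx
    have h₂ := h.perm.mem_iff (a := x)
    simp only [List.mem_append, outs_cons] at h₁ h₂ ⊢
    tauto

theorem subset_of_append {i : Instr} (P : List Instr) (h : Run E L (P ++ i :: P') L' f) :
    i.2.1 ⊆ L ++ outs P := by
  induction P generalizing L f with
  | nil =>
    cases h with
    | cons _ h => exact fun x hx => by simpa using h.perm.mem_iff.2 (List.mem_append_left _ hx)
  | cons j P ih =>
    cases h with
    | @cons _ R _ _ _ _ _ _ h _ _ h₃ =>
      intro x hx
      have := ih h₃ hx
      have hR : x ∈ R → x ∈ L := fun hR => h.perm.mem_iff.2 (List.mem_append_right _ hR)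
      simp only [List.mem_append, outs_cons] at this ⊢
      tauto

/-- Names are never written twice, so an input of i that is present at the beginning cannot have
been consumed before i reads it. Hence i is independent of every earlier instruction and can be
exchanged with each of them. -/
theorem bubble {i : Instr} (P : List Instr) (h : Run E L (P ++ i :: P') L' f) (hi : i.2.1 ⊆ L)
    (hu : (L ++ outs (P ++ i :: P')).Nodup) : Run E L (i :: (P ++ P')) L' f := by
  induction P generalizing L f with
  | nil => exact h
  | cons j P ih =>
    have hsub := h.subset_of_append (j :: P)
    cases h with
    | @cons _ R _ _ _ r g hn hr hd hc hg =>
    have hj : j.2.1 ⊆ L := fun x hx => hr.perm.mem_iff.2 (List.mem_append_left _ hx)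
    have hRL : R ⊆ L := fun x hx => hr.perm.mem_iff.2 (List.mem_append_right _ hx)
    have hsub' := hg.subset_of_append P
    have hu' : ((j.2.2 ++ R) ++ outs (P ++ i :: P')).Nodup := by
      have hR := (List.nodup_append.1 (hr.perm.nodup_iff.1 hn)).2.1
      simp only [List.cons_append, outs_cons, outs_append, List.nodup_append, List.mem_append] at hu ⊢
      grind
    have hiR : i.2.1 ⊆ j.2.2 ++ R := by
      intro x hx
      have h₁ := hsub' hx
      have h₂ := hi hx
      simp only [List.cons_append, outs_cons, outs_append, List.nodup_append, List.mem_append] at hu h₁ ⊢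
      grind
    refine swap (.cons hn hr hd hc (ih hg hiR hu')) ?_ ?_
    · intro x hx hx'
      have h₂ := hi hx
      simp only [List.cons_append, outs_cons, outs_append, List.nodup_append, List.mem_append] at hu
      grind
    · intro x hx hx'
      have h₂ := hj hx
      simp only [List.cons_append, outs_cons, outs_append, List.nodup_append, List.mem_append] at hu
      grind

/-- A program matters only as a graph. The first instruction of P' can be executed at once, hence
bubbles to the front of P, and the induction goes on with the rest. -/
theorem eq_of_perm (h : Run E L P L' f) (h' : Run E L P' L' g) (hp : P.Perm P')
    (hu : (L ++ outs P).Nodup) : f = g := by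
  induction P' generalizing L P f g with
  | nil =>
    rw [List.perm_nil.1 hp] at h
    exact h.unique h'
  | cons i P' ih =>
    obtain ⟨P₁, P₂, rfl⟩ := List.append_of_mem (hp.mem_iff.2 List.mem_cons_self)
    have hp' : (P₁ ++ P₂).Perm P' := (List.perm_cons i).1 (List.perm_middle.symm.trans hp)
    cases h' with
    | @cons _ R _ _ _ r g hn hr hd hc hg =>
    have hi : i.2.1 ⊆ L := fun x hx => hr.perm.mem_iff.2 (List.mem_append_left _ hx)
    have hb := h.bubble P₁ hi hu
    have hb' := hb
    cases hb with
    | @cons _ R' _ _ _ r' g' _ hr' _ _ hg' =>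
    obtain ⟨ρ, hρ⟩ := exists_reorder (E := E)
      ((List.perm_append_left_iff i.2.1).1 (hr.perm.symm.trans hr'.perm))
    have hu' : ((i.2.2 ++ R) ++ outs (P₁ ++ P₂)).Nodup := by
      have hR := (List.nodup_append.1 (hr.perm.nodup_iff.1 hn)).2.1
      have hRL : R ⊆ L := fun x hx => hr.perm.mem_iff.2 (List.mem_append_right _ hx)
      simp only [outs_append, outs_cons, List.nodup_append, List.mem_append] at hu ⊢
      grind
    have hg'' := hg'.pre (hρ.append_left i.2.2)
    rw [← ih hg'' hg hp' hu']
    exact hb'.unique (.cons hn hr hd hc hg'')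

end Run

end Env

/-! ### Decidable tests for well-formedness and rewriting of programs. -/

/-- A typing of the symbols. -/
abbrev Sig := ℕ → Option (List ℕ × List ℕ)

/-- Execute a program on a list of wire names, without its meaning. -/
def exec (σ : Sig) : List ℕ → List Instr → Option (List ℕ)
  | L, [] => some L
  | L, i :: P =>
    if σ i.1 = some (i.2.1.map ty, i.2.2.map ty) ∧ i.2.1.Nodup ∧ i.2.1 ⊆ L then
      exec σ (i.2.2 ++ L.diff i.2.1) P
    else none

/-- The program `P` is well-formed, with input wires `L` and output wires `L'`. -/
def valid (σ : Sig) (L : List ℕ) (P : List Instr) (L' : List ℕ) : Bool :=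
  decide (L ++ outs P).Nodup &&
    match exec σ L P with
    | some L₁ => L₁.isPerm L'
    | none => false

/-- Rename the wires of a program. -/
def renameProg (ρ : ℕ → ℕ) (P : List Instr) : List Instr :=
  P.map fun i => (i.1, i.2.1.map ρ, i.2.2.map ρ)

/-- The function described by a list of pairs. -/
def assoc (ρ : List (ℕ × ℕ)) (x : ℕ) : ℕ := (ρ.lookup x).getD x

/-- The instructions of `R` that can be executed on `L`, followed by the list of the others. -/
def schedule : ℕ → List ℕ → List Instr → List Instr × List Instr
  | 0, _, R => ([], R)
  | n + 1, L, R =>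
    match R.find? fun i => decide (i.2.1 ⊆ L) with
    | some i =>
      let K := schedule n (i.2.2 ++ L.diff i.2.1) (R.erase i)
      (i :: K.1, K.2)
    | none => ([], R)

/-- Renaming by `ρ` is admissible for a program. -/
def renameOk (ρ : ℕ → ℕ) (L : List ℕ) (P : List Instr) : Bool :=
  decide ((L ++ outs P).map ρ).Nodup && (L ++ outs P).all fun x => ty (ρ x) == ty x

/-- Replace the wire `q` by `a`. -/
def subst (q a x : ℕ) : ℕ := if x = q then a else x

/-- Remove the identities from a program, with the exception of those that go from an input wire
to an output wire. -/
def elimIds (L : List ℕ) : ℕ → List Instr → List ℕ → List Instr × List ℕ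
  | 0, P, O => (P, O)
  | _, [], O => ([], O)
  | n + 1, (k, [a], [q]) :: P, O =>
    if k < 10 ∧ ty a = ty q ∧ ¬(a ∈ L ∧ q ∈ O) then
      elimIds L n (renameProg (subst q a) P) (O.map (subst q a))
    else
      let r := elimIds L n P O
      ((k, [a], [q]) :: r.1, r.2)
  | n + 1, i :: P, O =>
    let r := elimIds L n P O
    (i :: r.1, r.2)

/-- Extend a renaming of wires to one that takes the instructions of `P` to instructions of `Q`. -/
def inferRen : ℕ → List Instr → List Instr → List (ℕ × ℕ) → List (ℕ × ℕ)
  | 0, _, _, ρ => ρ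
  | n + 1, P, Q, ρ =>
    let p := match P.find? fun p => (p.2.1 ++ p.2.2).any fun x => (ρ.lookup x).isSome with
      | some p => p
      | none => P.headD (0, [], [])
    let q := Q.find? fun q => q.1 == p.1 &&
      (((p.2.1 ++ p.2.2).zip (q.2.1 ++ q.2.2)).any (fun x => ρ.lookup x.1 == some x.2) ||
        !((p.2.1 ++ p.2.2).any fun x => (ρ.lookup x).isSome))
    match q with
    | some q => inferRen n (P.erase p) (Q.erase q) ((p.2.1 ++ p.2.2).zip (q.2.1 ++ q.2.2) ++ ρ)
    | none => ρ

/-- The program `Q` results from `P` by removing identities, renaming and reordering. -/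
def normOk (σ : Sig) (L : List ℕ) (P : List Instr) (O : List ℕ) (Q : List Instr)
    (O' : List ℕ) : Bool :=
  let r := elimIds L P.length P O
  -- The renaming is found by a greedy search about which nothing is proved; soundness rests on the
  -- tests that follow.
  let ρ := inferRen P.length r.1 Q (L.zip L ++ r.2.zip O')
  decide (L.map (assoc ρ) = L) && decide (r.2.map (assoc ρ) = O') &&
    (renameProg (assoc ρ) r.1).isPerm Q && renameOk (assoc ρ) L r.1 && valid σ L P O &&
    valid σ L (renameProg (assoc ρ) r.1) O' && valid σ L Q O'

/-- The embedding of a pattern `B` into `P` that extends `ρ`, with new names for the remaining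
wires of the replacement `B'`. -/
def embedding (P : List Instr) (L₀ : List ℕ) (B B' : List Instr) (ρ : List (ℕ × ℕ)) :
    List (ℕ × ℕ) :=
  let ρ₁ := inferRen B.length B P ρ
  -- A name is 100 times its type plus a residue, so a shift by 50 keeps the type of names with
  -- residue below 50. Types and freshness are tested afterwards by `renameOk` and `valid`.
  ρ₁ ++ ((L₀ ++ outs B').filter fun x => (ρ₁.lookup x).isNone).map fun x => (x, x + 50)

/-- The program `Q` results from `P` by replacing an instance of `B` by the corresponding
instance of `B'`, and then removing identities and renaming. The pattern `B` is located by means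
of the images `ρ` of some of its wires. -/
def stepOk (σ : Sig) (L : List ℕ) (P : List Instr) (L' L₀ : List ℕ) (B B' : List Instr)
    (ρ : List (ℕ × ℕ)) (Q : List Instr) : Bool :=
  let ρ := embedding P L₀ B B' ρ
  let B₁ := renameProg (assoc ρ) B
  let B₂ := renameProg (assoc ρ) B'
  let R := P.diff B₁
  let K := schedule R.length L R
  let K₂ := (schedule R.length (L ++ outs K.1 ++ outs B₁) K.2).1
  ((exec σ L K.1).any fun L₁ => decide (L₀.map (assoc ρ) ⊆ L₁)) &&
  renameOk (assoc ρ) L₀ B && renameOk (assoc ρ) L₀ B' &&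
    (K.1 ++ B₁ ++ K₂).isPerm P && valid σ L P L' && valid σ L (K.1 ++ B₁ ++ K₂) L' &&
    normOk σ L (K.1 ++ B₂ ++ K₂) L' Q L'

/-! ### Soundness of the tests. -/

namespace Env

/-- The interpretations of the symbols have the arities prescribed by `σ`. -/
def Typed (E : Env) (σ : Sig) : Prop :=
  ∀ k a b, σ k = some (a, b) → (E.sym k).dom = E.dims a ∧ (E.sym k).cod = E.dims b

/-- Two programs have the same meaning. -/
def Eqv (E : Env) (L : List ℕ) (P Q : List Instr) (L' : List ℕ) : Prop :=
  ∃ f, Run E L P L' f ∧ Run E L Q L' f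

variable {E : Env} {σ : Sig} {L L' : List ℕ} {P Q Q' : List Instr}

theorem exists_run_of_exec (hσ : E.Typed σ) {L₁ : List ℕ} (h : exec σ L P = some L₁)
    (hu : (L ++ outs P).Nodup) : ∃ f, Run E L P L₁ f := by
  induction P generalizing L with
  | nil =>
    simp only [exec, Option.some.injEq] at h
    subst h
    exact ⟨_, .nil (by simpa using hu) (Reorder.refl L)⟩
  | cons i P ih =>
    rw [exec] at h
    split_ifs at h with hi
    obtain ⟨h₁, h₂, h₃⟩ := hi
    have hp := Run.perm_diff h₂ h₃
    obtain ⟨r, hr⟩ := exists_reorder (E := E) hp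
    have hu' : ((i.2.2 ++ L.diff i.2.1) ++ outs P).Nodup := by
      have hn := hp.nodup_iff.1 (List.nodup_append.1 hu).1
      have hsub : L.diff i.2.1 ⊆ L := List.diff_subset _ _
      simp only [outs_cons, List.nodup_append, List.mem_append] at hu hn ⊢
      grind
    obtain ⟨f, hf⟩ := ih h hu'
    obtain ⟨e₁, e₂⟩ := hσ _ _ _ h₁
    exact ⟨_, .cons (List.nodup_append.1 hu).1 hr e₁ e₂ hf⟩

theorem exists_run (hσ : E.Typed σ) (h : valid σ L P L' = true) : ∃ f, Run E L P L' f := by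
  simp only [valid, Bool.and_eq_true, decide_eq_true_eq] at h
  obtain ⟨hu, h⟩ := h
  split at h
  · rename_i L₁ hL₁
    obtain ⟨f, hf⟩ := exists_run_of_exec hσ hL₁ hu
    obtain ⟨r, hr⟩ := exists_reorder (E := E) (List.isPerm_iff.1 h)
    exact ⟨_, hf.post hr⟩
  · simp at h

theorem valid_nodup (h : valid σ L P L' = true) : (L ++ outs P).Nodup := by
  simp only [valid, Bool.and_eq_true, decide_eq_true_eq] at h
  exact h.1

theorem Eqv.symm (h : Eqv E L P Q L') : Eqv E L Q P L' := by
  obtain ⟨f, h₁, h₂⟩ := h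
  exact ⟨f, h₂, h₁⟩

theorem Eqv.trans (h : Eqv E L P Q L') (h' : Eqv E L Q Q' L') : Eqv E L P Q' L' := by
  obtain ⟨f, h₁, h₂⟩ := h
  obtain ⟨g, h₃, h₄⟩ := h'
  exact ⟨f, h₁, by rwa [h₂.unique h₃]⟩

theorem Eqv.refl (hσ : E.Typed σ) (h : valid σ L P L' = true := by decide +kernel) : Eqv E L P P L' := by
  obtain ⟨f, hf⟩ := exists_run hσ h
  exact ⟨f, hf, hf⟩

theorem Run.of_perm {f : Mor} (hσ : E.Typed σ) (h : Run E L P L' f) (hp : P.Perm Q)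
    (hP : valid σ L P L' = true) (hQ : valid σ L Q L' = true) : Run E L Q L' f := by
  obtain ⟨g, hg⟩ := exists_run hσ hQ
  rwa [h.eq_of_perm hg hp (valid_nodup hP)]

theorem Run.renameProg {f : Mor} (h : Run E L P L' f) (ρ : ℕ → ℕ)
    (hρ : renameOk ρ L P = true) : Run E (L.map ρ) (renameProg ρ P) (L'.map ρ) f := by
  simp only [renameOk, Bool.and_eq_true, decide_eq_true_eq, List.all_eq_true, beq_iff_eq] at hρ
  exact h.rename ρ _ hρ.1 (List.Subset.refl _) hρ.2

theorem valid_of_normOk {O O' : List ℕ} (h : normOk σ L P O Q O' = true) :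
    valid σ L P O = true := by
  simp only [normOk, Bool.and_eq_true] at h
  exact h.1.1.2

theorem subst_map_of_notMem {q a : ℕ} {l : List ℕ} (h : q ∉ l) : l.map (subst q a) = l := by
  induction l with
  | nil => rfl
  | cons x l ih =>
    simp only [List.mem_cons, not_or] at h
    simp [ih h.2, subst, Ne.symm h.1]

/-- Symbols below 10 denote bundles of plain wires, so the instruction contributes an identity
morphism and its output can take over the name of its input in the rest of the program. -/
theorem Run.elimId {f : Mor} {k a q : ℕ} (hk : k < 10)
    (h : Run E L ((k, [a], [q]) :: P) L' f) (hu : (L ++ outs ((k, [a], [q]) :: P)).Nodup)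
    (ht : ty a = ty q) :
    Run E L (ZW.renameProg (subst q a) P) (L'.map (subst q a)) f := by
  cases h with
  | @cons _ R _ _ _ r g hn hr hd hc hg =>
  simp only [List.cons_append, List.nil_append] at hr hd hc hg
  have hrL := fun x => hr.perm.mem_iff (a := x)
  have hRn := hr.perm.nodup_iff.1 hn
  simp only [outs_cons, List.nodup_append, List.mem_append, List.mem_cons, List.nodup_cons,
    List.not_mem_nil] at hu hrL hRn
  have hq : q ∉ R := fun hq => hu.2.2 q ((hrL q).2 (Or.inr hq)) q (by simp) rfl
  have hS : ((q :: R ++ outs P).map (subst q a)) = a :: R ++ outs P := by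
    rw [List.map_append, List.map_cons, subst_map_of_notMem hq, subst_map_of_notMem]
    · simp [subst]
    · grind
  have hg' := hg.rename (subst q a) (q :: R ++ outs P) (by
    rw [hS]
    simp only [List.nodup_append, List.mem_cons, List.nodup_cons]
    grind) (List.Subset.refl _) (fun x _ => by
      unfold subst; split_ifs with hx
      · rw [hx, ht]
      · rfl)
  rw [List.map_cons, subst_map_of_notMem hq] at hg'
  have : subst q a q = a := by simp [subst]
  rw [this] at hg'
  have hs : E.sym k = wr (E.len [a]) := by
    rw [Env.sym, if_pos hk] at hd ⊢
    rw [← hd, wr_dom]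
  rw [hs, wr_mul_wr, wr_comp (by simpa [ht] using hg.dom.symm)]
  exact hg'.pre hr

theorem Run.elimIds {f : Mor} (L₀ : List ℕ) (n : ℕ) (h : Run E L P L' f)
    (hu : (L ++ outs P).Nodup) :
    Run E L (ZW.elimIds L₀ n P L').1 (ZW.elimIds L₀ n P L').2 f := by
  have hu' : ∀ {L R L' : List ℕ} {i : Instr} {P : List Instr}, (L ++ outs (i :: P)).Nodup →
      L.Perm (i.2.1 ++ R) → ((i.2.2 ++ R) ++ outs P).Nodup := by
    intro L R L' i P hu hp
    have hn := hp.nodup_iff.1 (List.nodup_append.1 hu).1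
    have hm := fun x => hp.mem_iff (a := x)
    simp only [outs_cons, List.nodup_append, List.mem_append] at hu hn hm ⊢
    grind
  fun_induction ZW.elimIds L₀ n P L' generalizing L f with
  | case1 P O => exact h
  | case2 n O => exact h
  | case3 n k a q P O hk ih =>
    refine ih (h.elimId hk.1 hu hk.2.1) ?_
    have : outs (ZW.renameProg (subst q a) P) = outs P := by
      have : outs (ZW.renameProg (subst q a) P) = (outs P).map (subst q a) := by
        simp [outs, ZW.renameProg, List.flatMap_map, List.map_flatMap]
      rw [this, subst_map_of_notMem]
      simp only [outs_cons, List.nodup_append, List.mem_append, List.mem_cons] at hu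
      grind
    rw [this]
    simp only [outs_cons, List.nodup_append, List.mem_append] at hu ⊢
    grind
  | case4 n k a q P O hk r =>
    rename_i ih
    cases h with
    | cons hn hr hd hc hg => exact .cons hn hr hd hc (ih hg (hu' (L' := []) hu hr.perm))
  | case5 n i P O hne r =>
    rename_i ih
    cases h with
    | cons hn hr hd hc hg => exact .cons hn hr hd hc (ih hg (hu' (L' := []) hu hr.perm))

theorem Run.cod_nodup {f : Mor} (h : Run E L P L' f) (hu : (L ++ outs P).Nodup) : L'.Nodup := by
  induction h with
  | nil hn h => exact h.perm.nodup_iff.1 hn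
  | cons hn h _ _ _ ih =>
    refine ih ?_
    have hn := h.perm.nodup_iff.1 hn
    have hm := fun x => h.perm.mem_iff (a := x)
    simp only [outs_cons, List.nodup_append, List.mem_append] at hu hn hm ⊢
    grind

theorem Run.norm {f : Mor} {O O' : List ℕ} (hσ : E.Typed σ)
    (h : Run E L P O f) (hn : normOk σ L P O Q O' = true) : Run E L Q O' f := by
  simp only [normOk, Bool.and_eq_true, decide_eq_true_eq] at hn
  obtain ⟨⟨⟨⟨⟨⟨e₁, e₂⟩, p⟩, r⟩, v₁⟩, v₂⟩, v₃⟩ := hn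
  have h₁ := h.elimIds L P.length (valid_nodup v₁)
  have h₂ := h₁.renameProg _ r
  rw [e₁, e₂] at h₂
  exact h₂.of_perm hσ (List.isPerm_iff.1 p) v₂ v₃

/-- Inserting identities into a program. -/
theorem Eqv.unnorm (hσ : E.Typed σ) (h : Eqv E L P Q L') (Q' : List Instr)
    (hn : normOk σ L Q' L' Q L' = true := by decide +kernel) : Eqv E L P Q' L' := by
  obtain ⟨f, h₁, h₂⟩ := h
  obtain ⟨g, hg⟩ := exists_run hσ (valid_of_normOk hn)
  refine ⟨f, h₁, ?_⟩
  rwa [h₂.unique (hg.norm hσ hn)]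

/-- Replacing a part of a program by an equivalent program. -/
theorem Eqv.step (hσ : E.Typed σ) {L₀ L₀' : List ℕ} {B B' : List Instr} (h : Eqv E L P Q L')
    (hB : Eqv E L₀ B B' L₀') (ρ : List (ℕ × ℕ)) (Q' : List Instr)
    (hs : stepOk σ L Q L' L₀ B B' ρ Q' = true := by decide +kernel) : Eqv E L P Q' L' := by
  refine h.trans ?_
  simp only [stepOk, Bool.and_eq_true] at hs
  obtain ⟨⟨⟨⟨⟨⟨hK, r₁⟩, r₂⟩, p₁⟩, v₁⟩, v₃⟩, hn⟩ := hs
  -- How the embedding and the schedules were found is irrelevant from here on; only the outcomes of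
  -- the tests are used.
  generalize embedding Q L₀ B B' ρ = ρ at *
  generalize (schedule _ L _).1 = K at *
  generalize (schedule _ (L ++ outs K ++ _) _).1 = K₂ at *
  simp only [Option.any_eq_true, decide_eq_true_eq] at hK
  obtain ⟨L₁, hK, hsub⟩ := hK
  obtain ⟨f, hf, hf'⟩ := hB
  replace hf := hf.renameProg _ r₁
  replace hf' := hf'.renameProg _ r₂
  obtain ⟨g, hg⟩ := exists_run hσ v₃
  have u₁ := valid_nodup v₃
  have u₂ := valid_nodup (valid_of_normOk hn)
  rw [List.append_assoc] at hg
  obtain ⟨L₁', g₁, g₂, hg₁, hg₂, rfl⟩ := hg.split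
  obtain ⟨L₂, g₃, g₄, hg₃, hg₄, rfl⟩ := hg₂.split
  obtain ⟨k, hk⟩ := exists_run_of_exec hσ hK (by
    simp only [outs_append, List.nodup_append, List.mem_append] at u₁ ⊢
    grind)
  have hp := Run.perm_diff hf.nodup (l := L₁') fun x hx =>
    (hg₁.cod_perm hk (.refl _)).mem_iff.2 (hsub hx)
  -- The spectator wires, those present at the pattern but not read by it. Both versions of the
  -- pattern act beside M, between a common prefix and a common tail.
  set M := L₁'.diff (L₀.map (assoc ρ))
  have hM : (L₀.map (assoc ρ) ++ M).Nodup := hp.nodup_iff.1 hg₂.nodup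
  have hM' : ∀ x ∈ M, x ∈ L ++ outs K := fun x hx =>
    hg₁.cod_subset (hp.mem_iff.2 (List.mem_append_right _ hx))
  have hM₀ : ∀ x ∈ M, x ∉ L₀.map (assoc ρ) := fun x hx h =>
    (List.nodup_append.1 hM).2.2 x h x hx rfl
  have run₁ := hf.tensor_right (List.nodup_append.1 hM).2.1 hM₀ (fun x hx h => by
    have := hM' x hx
    simp only [outs_append, List.nodup_append, List.mem_append] at u₁ this
    grind)
  have run₂ := hf'.tensor_right (List.nodup_append.1 hM).2.1 hM₀ (fun x hx h => by
    have := hM' x hx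
    simp only [outs_append, List.nodup_append, List.mem_append] at u₂ this
    grind)
  obtain ⟨r, hr⟩ := exists_reorder (E := E) hp
  obtain ⟨s, hs⟩ := exists_reorder (E := E) (run₁.cod_perm hg₃ hp.symm)
  have tail := hg₄.pre hs
  have final₁ := hg₁.append ((run₁.pre hr).append tail)
  have final₂ := hg₁.append ((run₂.pre hr).append tail)
  rw [← List.append_assoc] at final₁ final₂
  exact ⟨_, final₁.of_perm hσ (List.isPerm_iff.1 p₁) v₃ v₁,
    final₂.norm hσ hn⟩

end Env

/-! ### Compiling terms -/

/-- Expressions for morphisms; the numbers are symbols and wire types. -/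
inductive Tm
  | ids (l : List ℕ)
  | swap (a b : List ℕ)
  | sym (k : ℕ)
  | comp (s t : Tm)
  | tens (s t : Tm)

instance : Mul Tm := ⟨Tm.tens⟩

infixl:60 " ⊳ " => Tm.comp

namespace Tm
open Env

/-- The morphism denoted by an expression. -/
def eval (E : Env) : Tm → Mor
  | ids l => wr (E.dims l)
  | swap a b => Mor.br (E.dims a) (E.dims b)
  | sym k => E.sym k
  | comp s t => s.eval E ⟫ t.eval E
  | tens s t => s.eval E * t.eval E

/-- Compile an expression: `n` is a supply of names, `L` are the available wires. The result
consists of a program, its output wires, the unused wires and the remaining supply. -/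
def compile (σ : Sig) : Tm → ℕ → List ℕ → Option (List Instr × List ℕ × List ℕ × ℕ)
  | ids l, n, L =>
    if (L.take l.length).map ty = l then some ([], L.take l.length, L.drop l.length, n) else none
  | swap a b, n, L =>
    if (L.take a.length).map ty = a ∧ ((L.drop a.length).take b.length).map ty = b then
      some ([], (L.drop a.length).take b.length ++ L.take a.length,
        (L.drop a.length).drop b.length, n)
    else none
  | sym k, n, L =>
    match σ k with
    | none => none
    | some (a, b) =>
      -- The counter distinguishes the names, and dividing by 100 recovers the type as long as the
      -- counter is below 100; the next test rejects anything else.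
      let O := b.mapIdx fun i t => 100 * t + n + i
      if (L.take a.length).map ty = a ∧ O.map ty = b then
        some ([(k, L.take a.length, O)], O, L.drop a.length, n + b.length)
      else none
  | comp s t, n, L =>
    match s.compile σ n L with
    | none => none
    | some (P, O, R, n') =>
      match t.compile σ n' O with
      | some (P', O', [], n'') => some (P ++ P', O', R, n'')
      | _ => none
  | tens s t, n, L =>
    match s.compile σ n L with
    | none => none
    | some (P, O, R, n') =>
      match t.compile σ n' R with
      | none => none
      | some (P', O', R', n'') => some (P ++ P', O ++ O', R', n'')

/-- Give the wires that go from an input to an output a new name. -/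
def freshen (L : List ℕ) : ℕ → List ℕ → List Instr × List ℕ
  | _, [] => ([], [])
  | n, x :: O =>
    let r := freshen L (n + 1) O
    if x ∈ L then ((ty x, [x], [100 * ty x + n]) :: r.1, (100 * ty x + n) :: r.2)
    else (r.1, x :: r.2)

/-- The expression `t` compiles to the program `Q` with inputs `L` and outputs `O`. -/
def prog (σ : Sig) (t : Tm) (L : List ℕ) (Q : List Instr) (O : List ℕ) : Bool :=
  -- Residues below 10 are left to the input wires. A clash would be rejected by the distinctness
  -- test below.
  match t.compile σ 10 L with
  | some (P, O', [], n) =>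
    let r := freshen L n O'
    (r.1.all fun i => decide (i.1 < 10 ∧ i.2.1.map ty = [i.1] ∧ i.2.2.map ty = [i.1])) &&
      decide (L ++ outs (P ++ r.1)).Nodup && normOk σ L (P ++ r.1) r.2 Q O
  | _ => false

variable {E : Env} {σ : Sig}

/-- Induction on the expression. The names issued by the counter might collide with those of the
inputs, so distinctness is a premise of the run and not a consequence of compiling. -/
theorem compile_sound (hσ : E.Typed σ) {t : Tm} {n n' : ℕ} {L O R : List ℕ} {P : List Instr}
    (h : t.compile σ n L = some (P, O, R, n')) :
    ∃ L₁, L = L₁ ++ R ∧ ((L₁ ++ outs P).Nodup → E.Run L₁ P O (t.eval E)) := by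
  induction t generalizing n n' L O R P with
  | ids l =>
    simp only [compile] at h
    split_ifs at h with hl
    simp only [Option.some.injEq, Prod.mk.injEq] at h
    obtain ⟨rfl, rfl, rfl, rfl⟩ := h
    refine ⟨L.take l.length, (List.take_append_drop _ _).symm, fun hu => ?_⟩
    have := Env.Run.nil (E := E) (by simpa using hu) (Env.Reorder.refl (L.take l.length))
    rwa [Env.len, hl] at this
  | swap a b =>
    simp only [compile] at h
    split_ifs at h with hl
    simp only [Option.some.injEq, Prod.mk.injEq] at h
    obtain ⟨rfl, rfl, rfl, rfl⟩ := h
    refine ⟨L.take a.length ++ (L.drop a.length).take b.length, ?_, fun hu => ?_⟩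
    · rw [List.append_assoc, List.take_append_drop, List.take_append_drop]
    have := Env.Run.nil (E := E) (by simpa using hu)
      (Env.Reorder.append_comm (L.take a.length) ((L.drop a.length).take b.length))
    rwa [Env.len, Env.len, hl.1, hl.2] at this
  | sym k =>
    simp only [compile] at h
    split at h
    · simp at h
    · rename_i a b hk
      split_ifs at h with hl
      simp only [Option.some.injEq, Prod.mk.injEq] at h
      obtain ⟨rfl, rfl, rfl, rfl⟩ := h
      refine ⟨L.take a.length, (List.take_append_drop _ _).symm, fun hu => ?_⟩
      obtain ⟨e₁, e₂⟩ := hσ _ _ _ hk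
      simp only [outs_cons, outs_nil, List.append_nil, List.nodup_append] at hu
      have := Env.Run.cons (E := E) (R := []) (i := (k, L.take a.length, _)) hu.1
        (by simpa using Env.Reorder.refl (L.take a.length)) (by rw [e₁, Env.len, hl.1])
        (by rw [e₂, Env.len, hl.2])
        (.nil (by simpa using hu.2.1) (by simpa using Env.Reorder.refl _))
      simp only [Env.len_nil, wr_zero, mul_one] at this
      rw [comp_wr (by rw [e₂, Env.len, hl.2]), wr_comp (by rw [e₁, Env.len, hl.1])] at this
      exact this
  | comp s t ih ih' =>
    simp only [compile] at h
    split at h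
    · simp at h
    · rename_i P₁ O₁ R₁ n₁ h₁
      split at h
      · rename_i P₂ O₂ n₂ h₂
        simp only [Option.some.injEq, Prod.mk.injEq] at h
        obtain ⟨rfl, rfl, rfl, rfl⟩ := h
        obtain ⟨L₁, rfl, hr⟩ := ih h₁
        obtain ⟨L₂, rfl, hr'⟩ := ih' h₂
        refine ⟨L₁, rfl, fun hu => ?_⟩
        simp only [outs_append, ← List.append_assoc] at hu
        have run₁ := hr (List.nodup_append.1 hu).1
        rw [List.append_nil] at run₁
        have hsub := run₁.cod_subset
        refine run₁.append (hr' ?_)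
        have hO := run₁.cod_nodup (List.nodup_append.1 hu).1
        simp only [List.nodup_append, List.mem_append] at hu ⊢
        have hsub' : ∀ x ∈ L₂, x ∈ L₁ ∨ x ∈ outs P₁ := fun x hx => List.mem_append.1 (hsub hx)
        grind
      · simp at h
  | tens s t ih ih' =>
    simp only [compile] at h
    split at h
    · simp at h
    · rename_i P₁ O₁ R₁ n₁ h₁
      split at h
      · simp at h
      · rename_i P₂ O₂ R₂ n₂ h₂
        simp only [Option.some.injEq, Prod.mk.injEq] at h
        obtain ⟨rfl, rfl, rfl, rfl⟩ := h
        obtain ⟨L₁, rfl, hr⟩ := ih h₁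
        obtain ⟨L₂, rfl, hr'⟩ := ih' h₂
        refine ⟨L₁ ++ L₂, by simp, fun hu => ?_⟩
        simp only [outs_append] at hu
        have run₁ := hr (by
          simp only [List.nodup_append, List.mem_append] at hu ⊢
          grind)
        have run₂ := hr' (by
          simp only [List.nodup_append, List.mem_append] at hu ⊢
          grind)
        have hsub : ∀ x ∈ O₁, x ∈ L₁ ∨ x ∈ outs P₁ := fun x hx =>
          List.mem_append.1 (run₁.cod_subset hx)
        have hO := run₁.cod_nodup (by
          simp only [List.nodup_append, List.mem_append] at hu ⊢
          grind)
        have r₁ := run₁.tensor_right (m := L₂) (by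
          simp only [List.nodup_append, List.mem_append] at hu ⊢
          grind) (by
          simp only [List.nodup_append, List.mem_append] at hu ⊢
          grind) (by
          simp only [List.nodup_append, List.mem_append] at hu ⊢
          grind)
        have r₂ := run₂.tensor_left hO (by
          simp only [List.nodup_append, List.mem_append] at hu ⊢
          grind) (by
          simp only [List.nodup_append, List.mem_append] at hu ⊢
          grind)
        have := r₁.append r₂
        rwa [mul_wr_comp_wr_mul run₂.dom.symm run₁.cod.symm] at this

theorem run_freshen (L : List ℕ) (n : ℕ) (O : List ℕ)
    (ht : (freshen L n O).1.all
      (fun i => decide (i.1 < 10 ∧ i.2.1.map ty = [i.1] ∧ i.2.2.map ty = [i.1])) = true)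
    (hO : (O ++ outs (freshen L n O).1).Nodup) :
    E.Run O (freshen L n O).1 (freshen L n O).2 (wr (E.len O)) := by
  induction O generalizing n with
  | nil => exact .nil List.nodup_nil (Env.Reorder.refl [])
  | cons x O ih =>
    simp only [freshen] at ht hO ⊢
    split_ifs at ht hO ⊢ with hx
    · simp only [List.all_cons, Bool.and_eq_true, decide_eq_true_eq, List.map_cons, List.map_nil,
        List.cons.injEq, and_true, true_and] at ht
      obtain ⟨⟨h₁, h₂⟩, h₃⟩ := ht
      simp only [outs_cons] at hO
      have hs : E.sym (ty x) = wr (E.dim (ty x)) := by rw [Env.sym, if_pos h₁]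
      have run := (ih (n + 1) h₃ (by
        simp only [List.nodup_append, List.mem_append, List.nodup_cons, List.cons_append] at hO ⊢
        grind)).tensor_left (m := [100 * ty x + n]) (by simp) (by
        simp only [List.nodup_append, List.mem_append, List.nodup_cons, List.cons_append] at hO ⊢
        grind) (by
        simp only [List.nodup_append, List.mem_append, List.nodup_cons, List.cons_append] at hO ⊢
        grind)
      have := Env.Run.cons (E := E) (L := x :: O) (i := (ty x, [x], [100 * ty x + n])) (R := O)
        (List.nodup_append.1 hO).1 (Env.Reorder.refl (x :: O)) (by simp [hs]) (by simp [hs, h₂]) run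
      simp only [hs, wr_mul_wr, Env.len_cons, Env.len_nil, h₂, add_zero] at this
      rw [wr_comp (by simp), wr_comp (by simp)] at this
      simpa using this
    · have run := (ih (n + 1) ht (by
        simp only [List.nodup_append, List.nodup_cons, List.cons_append] at hO ⊢
        grind)).tensor_left (m := [x]) (by simp) (by
        simp only [List.nodup_append, List.nodup_cons, List.cons_append] at hO ⊢
        grind) (by
        simp only [List.nodup_append, List.nodup_cons, List.cons_append] at hO ⊢
        grind)
      simpa [wr_mul_wr] using run

theorem run (hσ : E.Typed σ) {t : Tm} {L O : List ℕ} {Q : List Instr}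
    (h : t.prog σ L Q O = true) : E.Run L Q O (t.eval E) := by
  rw [prog] at h
  split at h
  · rename_i P O' n hc
    simp only [Bool.and_eq_true, decide_eq_true_eq] at h
    obtain ⟨⟨h₁, h₂⟩, h₃⟩ := h
    obtain ⟨L₁, hL, hr⟩ := compile_sound hσ hc
    rw [List.append_nil] at hL
    subst hL
    simp only [outs_append, ← List.append_assoc] at h₂
    have run₁ := hr (List.nodup_append.1 h₂).1
    have hsub : ∀ x ∈ O', x ∈ L ∨ x ∈ outs P := fun x hx =>
      List.mem_append.1 (run₁.cod_subset hx)
    have run₂ := run_freshen (E := E) L n O' h₁ (by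
      have := run₁.cod_nodup (List.nodup_append.1 h₂).1
      simp only [List.nodup_append, List.mem_append] at h₂ ⊢
      grind)
    have := run₁.append run₂
    rw [comp_wr run₁.cod] at this
    exact this.norm hσ h₃
  · simp at h

/-- The equation between the meanings of two expressions as one between programs. -/
theorem eqv (hσ : E.Typed σ) (s t : Tm) (L : List ℕ) (P Q : List Instr) (O : List ℕ)
    (h : s.eval E = t.eval E)
    (hc : (s.prog σ L P O && t.prog σ L Q O) = true := by decide +kernel) :
    E.Eqv L P Q O := by
  rw [Bool.and_eq_true] at hc
  exact ⟨_, run hσ hc.1, h ▸ run hσ hc.2⟩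

/-- An equation between expressions follows from one between programs. -/
theorem eval_eq (hσ : E.Typed σ) (s t : Tm) {L O : List ℕ} {P Q : List Instr} (h : E.Eqv L P Q O)
    (hc : (s.prog σ L P O && t.prog σ L Q O) = true := by decide +kernel) : s.eval E = t.eval E := by
  rw [Bool.and_eq_true] at hc
  obtain ⟨f, h₁, h₂⟩ := h
  rw [(run hσ hc.1).unique h₁, (run hσ hc.2).unique h₂]

/-- The expressions `s` and `t`, with inputs of types `l`, compile to the same program. -/
def same (σ : Sig) (s t : Tm) (l : List ℕ) : Bool :=
  let L := l.mapIdx fun i t => 100 * t + i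
  match t.compile σ 10 L with
  | some (P, O', [], n) =>
    let r := freshen L n O'
    let r' := elimIds L (P ++ r.1).length (P ++ r.1) r.2
    s.prog σ L r'.1 r'.2 && t.prog σ L r'.1 r'.2
  | _ => false

theorem eq_of_same (hσ : E.Typed σ) (s t : Tm) (l : List ℕ)
    (h : same σ s t l = true := by decide +kernel) :
    s.eval E = t.eval E := by
  rw [same] at h
  split at h
  · rw [Bool.and_eq_true] at h
    exact (run hσ h.1).unique (run hσ h.2)
  · simp at h

end Tm

/-! ### Concrete environments -/

/-- The typing with the given arities of the operations. -/
def sig (l : List (List ℕ × List ℕ)) : Sig := fun k =>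
  if k < 10 then some ([k], [k]) else l[k - 10]?

/-- The environment with the given dimensions and operations; the wires of type `0` are single
wires. -/
def env (d : List ℕ) (o : List Mor) : Env := ⟨fun t => (1 :: d).getD t 0, fun k => o.getD k 1⟩

theorem typed_env {d : List ℕ} {o o' : List Mor} {l : List (List ℕ × List ℕ)}
    (h : List.Forall₂ (fun f ab => f.dom = (env d []).dims ab.1 ∧ f.cod = (env d []).dims ab.2)
      o l) : (env d (o ++ o')).Typed (sig l) := by
  intro k a b hk
  simp only [sig] at hk
  split_ifs at hk with h₁
  · simp only [Option.some.injEq, Prod.mk.injEq] at hk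
    obtain ⟨rfl, rfl⟩ := hk
    simp [Env.sym, h₁, Env.dims]
  · obtain ⟨h₂, h₃⟩ := List.forall₂_iff_get.1 h
    obtain ⟨h₄, h₅⟩ := List.getElem?_eq_some_iff.1 hk
    have := h₃ (k - 10) (h₂ ▸ h₄) h₄
    rw [List.get_eq_getElem, List.get_eq_getElem, h₅] at this
    simp only [Env.sym, if_neg h₁, env]
    rw [List.getD_append _ _ _ _ (h₂ ▸ h₄), List.getD_eq_getElem _ _ (h₂ ▸ h₄)]
    exact this

theorem dims_nil (E : Env) : E.dims [] = 0 := rfl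

theorem dims_cons (E : Env) (a : ℕ) (l : List ℕ) : E.dims (a :: l) = E.dim a + E.dims l := by
  simp [Env.dims]

theorem dim_env (d : List ℕ) (o : List Mor) (t : ℕ) : (env d o).dim t = (1 :: d).getD t 0 := rfl

theorem sym_env (d : List ℕ) (o : List Mor) (k : ℕ) :
    (env d o).sym k = if k < 10 then wr ((1 :: d).getD k 0) else o.getD (k - 10) 1 := rfl

open Diagram Mor Tm Env

/-! ### Bending bundles of wires -/

/-- The cap. -/
def capM : Mor := cap.mor
/-- The cup. -/
def cupM : Mor := cup.mor
/-- Parallel caps. -/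
def capsM (n : ℕ) : Mor := (caps n).mor

/-- Parallel cups. -/
def cups : (n : ℕ) → Diagram 0 (n + n)
  | 0 => wires 0
  | n + 1 =>
    ((cups n ⊠ cup).cast (Nat.add_zero 0) rfl ⨟
      (wires n ⊠ braid n 1 ⊠ wires 1).cast (by omega : n + (n + 1) + 1 = n + n + 2)
        (by omega : n + (1 + n) + 1 = n + 1 + (n + 1)))

/-- Parallel cups. -/
def cupsM (n : ℕ) : Mor := (cups n).mor

@[simp] theorem capM_dom : capM.dom = 2 := rfl
@[simp] theorem capM_cod : capM.cod = 0 := rfl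
@[simp] theorem cupM_dom : cupM.dom = 0 := rfl
@[simp] theorem cupM_cod : cupM.cod = 2 := rfl
@[simp] theorem capsM_dom (n : ℕ) : (capsM n).dom = n + n := rfl
@[simp] theorem capsM_cod (n : ℕ) : (capsM n).cod = 0 := rfl
@[simp] theorem cupsM_dom (n : ℕ) : (cupsM n).dom = 0 := rfl
@[simp] theorem cupsM_cod (n : ℕ) : (cupsM n).cod = n + n := rfl

theorem capsM_zero : capsM 0 = 1 := rfl
theorem cupsM_zero : cupsM 0 = 1 := rfl

theorem capsM_succ (n : ℕ) :
    capsM (n + 1) = (wr n * br 1 n * wr 1) ⟫ (capsM n * capM) := by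
  simp [capsM, caps, mor_comp, mor_cast, mor_tensor, mor_wires, mor_braid, capM]

theorem cupsM_succ (n : ℕ) :
    cupsM (n + 1) = (cupsM n * cupM) ⟫ (wr n * br n 1 * wr 1) := by
  simp [cupsM, cups, mor_comp, mor_cast, mor_tensor, mor_wires, mor_braid, cupM]

theorem capM_zigzag : (wr 1 * cupM) ⟫ (capM * wr 1) = wr 1 := by
  have := Rewrites.zigzag_left.mor_eq
  rwa [mor_comp] at this

theorem cupM_braid : cupM ⟫ br 1 1 = cupM := by
  have := Rewrites.cup_braid.mor_eq
  rwa [mor_comp] at this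

theorem braid_capM : br 1 1 ⟫ capM = capM := by
  have := Rewrites.braid_cap.mor_eq
  rwa [mor_comp] at this

theorem br_capsM (n : ℕ) : br n n ⟫ capsM n = capsM n := by
  induction n with
  | zero => rw [br_zero_left, wr_comp (by simp)]
  | succ n ih =>
    -- The pattern of the diagrammatic computations: `env` lists bundle sizes (types 1, 2, …; type 0
    -- is a single wire) and operations (symbols 10, 11, …). Known equations become equations
    -- between programs, each `step` replaces an instance of one of them, and `eval_eq` returns to
    -- morphisms. The intermediate programs are given explicitly and checked by evaluation.
    have hσ : (env [n] ([capsM n, capM] ++ [])).Typed (sig [([1, 1], []), ([0, 0], [])]) :=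
      typed_env (by simp [Env.dims, env])
    have h₁ := eqv hσ (swap [1] [1] ⊳ sym 10) (sym 10) [100, 101] [(10, [101, 100], [])]
      [(10, [100, 101], [])] [] (ih)
    have h₂ := eqv hσ (swap [0] [0] ⊳ sym 11) (sym 11) [0, 1] [(11, [1, 0], [])]
      [(11, [0, 1], [])] [] (braid_capM)
    rw [capsM_succ]
    have key := eval_eq hσ (swap [1, 0] [1, 0] ⊳ (ids [1] * swap [0] [1] * ids [0] ⊳ sym 10 * sym
      11)) (ids [1] * swap [0] [1] * ids [0] ⊳ sym 10 * sym 11) ((Eqv.refl (L := [100, 1, 102, 3])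
      (L' := []) (P := [(10, [102, 100], []), (11, [3, 1], [])]) hσ)
        |>.step hσ h₂ [] [(10, [102, 100], []), (11, [1, 3], [])]
        |>.step hσ h₁ [] [(10, [100, 102], []), (11, [1, 3], [])])
    simp only
      [Tm.eval, sym_env, dims_cons, dims_nil, dim_env, List.getD_cons_zero, List.getD_cons_succ, List.cons_append, List.nil_append, add_zero, Nat.reduceLT, if_false, Nat.reduceSub]
      at key
    exact key

theorem capsM_zigzag (n : ℕ) : (wr n * cupsM n) ⟫ (capsM n * wr n) = wr n := by
  induction n with
  | zero => rw [capsM_zero, cupsM_zero, mul_one, one_mul, wr_comp (by simp)]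
  | succ n ih =>
    have hσ : (env [n] ([capsM n, capM, cupsM n, cupM] ++ [])).Typed (sig [([1, 1], []),
      ([0, 0], []), ([], [1, 1]), ([], [0, 0])]) := typed_env (by simp [Env.dims, env])
    have h₁ := eqv hσ (ids [1] * sym 12 ⊳ sym 10 * ids [1]) (ids [1]) [100] [(12, [], [102, 101]),
      (10, [100, 102], [])] [(1, [100], [101])] [101] (ih)
    have h₂ := eqv hσ (ids [0] * sym 13 ⊳ sym 11 * ids [0]) (ids [0]) [0] [(13, [], [2, 1]),
      (11, [0, 2], [])] [(0, [0], [1])] [1] (capM_zigzag)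
    rw [capsM_succ, cupsM_succ]
    have key := eval_eq hσ (ids [1, 0] * (sym 12 * sym 13 ⊳ ids [1] * swap [1] [0] * ids [0]) ⊳
      (ids [1] * swap [0] [1] * ids [0] ⊳ sym 10 * sym 11) * ids [1, 0]) (ids [1, 0]) ((Eqv.refl
      (L := [100, 1]) (L' := [102, 3]) (P := [(12, [], [101, 102]), (13, [], [0, 3]),
      (10, [100, 101], []), (11, [1, 0], [])]) hσ)
        |>.step hσ h₂ [] [(12, [], [101, 102]), (10, [100, 101], []), (0, [1], [3])]
        |>.step hσ h₁ [] [(1, [100], [102]), (0, [1], [3])])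
    simp only
      [Tm.eval, sym_env, dims_cons, dims_nil, dim_env, List.getD_cons_zero, List.getD_cons_succ, List.cons_append, List.nil_append, add_zero, Nat.reduceLT, if_false, Nat.reduceSub]
      at key
    exact key

theorem cupsM_br (n : ℕ) : cupsM n ⟫ br n n = cupsM n := by
  induction n with
  | zero => rw [br_zero_left, comp_wr (by simp)]
  | succ n ih =>
    have hσ : (env [n] ([cupsM n, cupM] ++ [])).Typed (sig [([], [1, 1]), ([], [0, 0])]) :=
      typed_env (by simp [Env.dims, env])
    have h₁ := eqv hσ (sym 10 ⊳ swap [1] [1]) (sym 10) [] [(10, [], [101, 100])]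
      [(10, [], [100, 101])] [100, 101] (ih)
    have h₂ := eqv hσ (sym 11 ⊳ swap [0] [0]) (sym 11) [] [(11, [], [1, 0])] [(11, [], [0, 1])]
      [0, 1] (cupM_braid)
    rw [cupsM_succ]
    have key := eval_eq hσ (sym 10 * sym 11 ⊳ ids [1] * swap [1] [0] * ids [0] ⊳ swap [1, 0]
      [1, 0]) (sym 10 * sym 11 ⊳ ids [1] * swap [1] [0] * ids [0]) ((Eqv.refl (L := []) (L' :=
      [100, 1, 102, 3]) (P := [(10, [], [102, 100]), (11, [], [3, 1])]) hσ)
        |>.step hσ h₂ [] [(10, [], [102, 100]), (11, [], [1, 3])]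
        |>.step hσ h₁ [] [(10, [], [100, 102]), (11, [], [1, 3])])
    simp only
      [Tm.eval, sym_env, dims_cons, dims_nil, dim_env, List.getD_cons_zero, List.getD_cons_succ, List.cons_append, List.nil_append, add_zero, Nat.reduceLT, if_false, Nat.reduceSub]
      at key
    exact key

/-- The morphism obtained from a state by bending the first `n` of its legs. -/
def bendM (n m : ℕ) (s : Mor) : Mor := (wr n * s) ⟫ (capsM n * wr m)

@[simp] theorem bendM_cod (n m : ℕ) (s : Mor) : (bendM n m s).cod = m := by simp [bendM]

theorem bendM_dom {n m : ℕ} {s : Mor} (h : s.dom = 0) : (bendM n m s).dom = n := by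
  simp [bendM, h]

theorem mor_bend {n m : ℕ} (s : Diagram 0 (n + m)) : (bend n m s).mor = bendM n m s.mor := by
  simp [bend, mor_cast, mor_comp, mor_tensor, mor_wires, bendM, capsM]

theorem bendM_zero {m : ℕ} {s : Mor} (h : s.cod = m) : bendM 0 m s = s := by
  rw [bendM, wr_zero, capsM_zero, one_mul, one_mul, comp_wr h]

/-- Straightening the bent wires by the zigzag equation. With `bendM_cups` this makes bending a
bijection between states on n + m wires and morphisms n → m. Here the cups meet the caps in the
opposite order, hence the appeal to their symmetry. -/
theorem cupsM_bendM {n m : ℕ} {s : Mor} (h₁ : s.dom = 0) (h₂ : s.cod = n + m) :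
    cupsM n ⟫ (wr n * bendM n m s) = s := by
  have hσ : (env [n, m] ([capsM n, cupsM n, s] ++ [])).Typed (sig [([1, 1], []), ([], [1, 1]),
    ([], [1, 2])]) := typed_env (by simp [Env.dims, env, h₁, h₂])
  have h₁ := eqv hσ (ids [1] * sym 11 ⊳ sym 10 * ids [1]) (ids [1]) [100] [(11, [], [102, 101]),
    (10, [100, 102], [])] [(1, [100], [101])] [101] (capsM_zigzag n)
  have h₂ := eqv hσ (swap [1] [1] ⊳ sym 10) (sym 10) [100, 101] [(10, [101, 100], [])]
    [(10, [100, 101], [])] [] (br_capsM n)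
  have h₃ := eqv hσ (sym 11 ⊳ swap [1] [1]) (sym 11) [] [(11, [], [101, 100])]
    [(11, [], [100, 101])] [100, 101] (cupsM_br n)
  rw [bendM]
  have key := eval_eq hσ (sym 11 ⊳ ids [1] * (ids [1] * sym 12 ⊳ sym 10 * ids [2])) (sym 12)
    ((Eqv.refl (L := []) (L' := [100, 201]) (P := [(11, [], [100, 101]), (12, [], [102, 201]),
    (10, [101, 102], [])]) hσ)
      |>.step hσ h₃ [] [(12, [], [101, 201]), (11, [], [102, 100]), (10, [102, 101], [])]
      |>.step hσ h₂ [] [(12, [], [101, 201]), (11, [], [102, 100]), (10, [101, 102], [])]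
      |>.step hσ h₁ [] [(12, [], [100, 201])])
  simp only
    [Tm.eval, sym_env, dims_cons, dims_nil, dim_env, List.getD_cons_zero, List.getD_cons_succ, List.cons_append, List.nil_append, add_zero, Nat.reduceLT, if_false, Nat.reduceSub]
    at key
  exact key

theorem bendM_cups {n m : ℕ} {f : Mor} (h₁ : f.dom = n) (h₂ : f.cod = m) :
    bendM n m (cupsM n ⟫ (wr n * f)) = f := by
  have hσ : (env [n, m] ([capsM n, cupsM n, f] ++ [])).Typed (sig [([1, 1], []), ([], [1, 1]),
    ([1], [2])]) := typed_env (by simp [Env.dims, env, h₁, h₂])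
  have h₁ := eqv hσ (ids [1] * sym 11 ⊳ sym 10 * ids [1]) (ids [1]) [100] [(11, [], [102, 101]),
    (10, [100, 102], [])] [(1, [100], [101])] [101] (capsM_zigzag n)
  rw [bendM]
  have key := eval_eq hσ (ids [1] * (sym 11 ⊳ ids [1] * sym 12) ⊳ sym 10 * ids [2]) (sym 12)
    ((Eqv.refl (L := [100]) (L' := [201]) (P := [(11, [], [101, 102]), (12, [102], [201]),
    (10, [100, 101], [])]) hσ)
      |>.step hσ h₁ [] [(12, [100], [201])])
  simp only
    [Tm.eval, sym_env, dims_cons, dims_nil, dim_env, List.getD_cons_zero, List.getD_cons_succ, List.cons_append, List.nil_append, add_zero, Nat.reduceLT, if_false, Nat.reduceSub]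
    at key
  exact key

/-! ### Spiders -/

theorem bendM_comp {n m k : ℕ} {s f : Mor} (h₁ : s.dom = 0) (h₂ : s.cod = n + m) (h₃ : f.dom = m)
    (h₄ : f.cod = k) : bendM n m s ⟫ f = bendM n k (s ⟫ (wr n * f)) := by
  have hσ : (env [n, m, k] ([capsM n, s, f] ++ [])).Typed (sig [([1, 1], []), ([], [1, 2]),
    ([2], [3])]) := typed_env (by simp [Env.dims, env, h₁, h₂, h₃, h₄])
  exact eq_of_same hσ ((ids [1] * sym 11 ⊳ sym 10 * ids [2]) ⊳ sym 12)
    (ids [1] * (sym 11 ⊳ ids [1] * sym 12) ⊳ sym 10 * ids [3]) [1]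

theorem capsM_one : capsM 1 = capM := by
  rw [capsM_succ, capsM_zero, br_zero_right, wr_zero, one_mul, one_mul, wr_mul_wr,
    wr_comp (by simp)]

theorem cupsM_one : cupsM 1 = cupM := by
  rw [cupsM_succ, cupsM_zero, br_zero_left, wr_zero, one_mul, one_mul, wr_mul_wr,
    comp_wr (by simp)]

/-- A family of vertices that satisfies the spider rule, the wires in between carrying an
involution. -/
structure Spider (v : ℕ → Mor) (X : Mor) : Prop where
  dom (n : ℕ) : (v n).dom = 0
  cod (n : ℕ) : (v n).cod = n
  symm (i j : ℕ) : v (i + 2 + j) ⟫ (wr i * br 1 1 * wr j) = v (i + 2 + j)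
  bin : X = bendM 1 1 (v 2)
  inv : X ⟫ X = wr 1
  fuse (n m : ℕ) : bendM n 1 (v (n + 1)) ⟫ X ⟫ bendM 1 m (v (1 + m)) = bendM n m (v (n + m))

/-- The comultiplication of a family of vertices. -/
def spiderComul (v : ℕ → Mor) (X : Mor) (n : ℕ) : Mor := X ⟫ bendM 1 n (v (1 + n))

/-- The multiplication of a family of vertices. -/
def spiderMul (v : ℕ → Mor) (X : Mor) (n : ℕ) : Mor := bendM n 1 (v (n + 1)) ⟫ X

namespace Spider
variable {v : ℕ → Mor} {X : Mor}

theorem bin_dom (h : Spider v X) : X.dom = 1 := by rw [h.bin, bendM_dom (h.dom 2)]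

theorem bin_cod (h : Spider v X) : X.cod = 1 := by rw [h.bin, bendM_cod]

theorem comul_dom (h : Spider v X) (n : ℕ) : (spiderComul v X n).dom = 1 := by simp [spiderComul, h.bin_dom]

theorem comul_cod (_ : Spider v X) (n : ℕ) : (spiderComul v X n).cod = n := by simp [spiderComul]

/-- The spider rule with the n bent legs of both sides straightened by cups. -/
theorem comp_comul (h : Spider v X) (n m : ℕ) : v (n + 1) ⟫ (wr n * spiderComul v X m) = v (n + m) := by
  have := h.fuse n m
  rw [comp_assoc (by simp [h.bin_dom]) (by simp [h.bin_cod, bendM_dom, h.dom]), ← spiderComul,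
    bendM_comp (h.dom _) (h.cod _) (h.comul_dom m) (h.comul_cod m)] at this
  have h₂ := congrArg (fun f => cupsM n ⟫ (wr n * f)) this
  rwa [cupsM_bendM (by simp [h.dom]) (by simp [h.comul_cod]),
    cupsM_bendM (h.dom _) (h.cod _)] at h₂

/-- Fusion with a unary vertex. For the black family, whose unary vertex is |1⟩, this presents each
vertex as |1⟩ followed by a vector, the shape required of good states. -/
theorem eq_comul (h : Spider v X) (n : ℕ) : v n = v 1 ⟫ spiderComul v X n := by
  have := h.comp_comul 0 n
  rw [wr_zero, one_mul, zero_add, zero_add] at this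
  exact this.symm

theorem comul_one (h : Spider v X) : spiderComul v X 1 = wr 1 := by
  rw [spiderComul, ← h.bin, h.inv]

theorem comul_comp (h : Spider v X) (n m : ℕ) :
    spiderComul v X (n + 1) ⟫ (wr n * spiderComul v X m) = spiderComul v X (n + m) := by
  rw [spiderComul, comp_assoc (by simp [h.bin_cod, bendM_dom, h.dom]) (by simp [h.comul_dom]),
    bendM_comp (h.dom _) (h.cod _) (k := n + m) (by simp [h.comul_dom]) (by simp [h.comul_cod]), ← mul_assoc,
    wr_mul_wr, ← add_assoc, h.comp_comul, spiderComul, add_assoc]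

theorem comul_swap (h : Spider v X) (i j : ℕ) :
    spiderComul v X (i + 2 + j) ⟫ (wr i * br 1 1 * wr j) = spiderComul v X (i + 2 + j) := by
  rw [spiderComul, comp_assoc (by simp [h.bin_cod, bendM_dom, h.dom]) (by simp),
    bendM_comp (k := i + 2 + j) (h.dom _) (h.cod _) (by simp) (by simp), ← mul_assoc, ← mul_assoc,
    wr_mul_wr, ← add_assoc, ← add_assoc, h.symm]

theorem comul_two_swap (h : Spider v X) : spiderComul v X 2 ⟫ br 1 1 = spiderComul v X 2 := by
  have := h.comul_swap 0 0
  rwa [wr_zero, one_mul, mul_one] at this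

theorem comul_two_comp (h : Spider v X) (m : ℕ) :
    spiderComul v X 2 ⟫ (wr 1 * spiderComul v X m) = spiderComul v X (1 + m) :=
  h.comul_comp 1 m

/-- Fusing on the last leg gives the ternary comultiplication. Fusing on the first leg gives the
same up to a permutation of the legs, under which it is invariant. -/
theorem comul_assoc (h : Spider v X) :
    spiderComul v X 2 ⟫ (spiderComul v X 2 * wr 1) = spiderComul v X 2 ⟫ (wr 1 * spiderComul v X 2) := by
  have h₁ := h.comul_swap 0 1
  have h₂ := h.comul_swap 1 0
  rw [wr_zero, one_mul] at h₁
  rw [wr_zero, mul_one] at h₂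
  have h₃ := br_natural (wr 1) (spiderComul v X 2)
  rw [h.comul_dom, h.comul_cod, wr_dom, wr_cod, br_add_right 1 1 1] at h₃
  have h₄ := h.comul_two_comp 2
  rw [h₄]
  conv_lhs => lhs; rw [← h.comul_two_swap]
  rw [comp_assoc (by simp [h.comul_cod]) (by simp [h.comul_dom]), ← h₃,
    ← comp_assoc (by simp [h.comul_cod, h.comul_dom]) (by simp [h.comul_cod]), h₄,
    ← comp_assoc (by simp [h.comul_cod]) (by simp)]
  exact (congrArg (· ⟫ (wr 1 * br 1 1)) h₁).trans h₂

theorem comul_counit (h : Spider v X) : spiderComul v X 2 ⟫ (wr 1 * spiderComul v X 0) = wr 1 :=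
  (h.comul_two_comp 0).trans h.comul_one

theorem counit_comul (h : Spider v X) : spiderComul v X 2 ⟫ (spiderComul v X 0 * wr 1) = wr 1 := by
  have h₃ := br_natural (wr 1) (spiderComul v X 0)
  rw [h.comul_dom, h.comul_cod, wr_dom, wr_cod, br_zero_right, comp_wr (by simp [h.comul_cod])] at h₃
  conv_lhs => lhs; rw [← h.comul_two_swap]
  rw [comp_assoc (by simp [h.comul_cod]) (by simp [h.comul_dom]), ← h₃, h.comul_counit]

theorem comul_add (h : Spider v X) (n m : ℕ) :
    spiderComul v X 2 ⟫ (spiderComul v X n * spiderComul v X m) = spiderComul v X (n + m) := by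
  induction n with
  | zero =>
    have : spiderComul v X 0 * spiderComul v X m =
        (spiderComul v X 0 * wr 1) ⟫ (wr 0 * spiderComul v X m) :=
      (mul_wr_comp_wr_mul (by simp [h.comul_dom]) (by simp [h.comul_cod])).symm
    rw [this, ← comp_assoc (by simp [h.comul_cod, h.comul_dom]) (by simp [h.comul_cod, h.comul_dom]),
      h.counit_comul, wr_zero, one_mul, wr_comp (by simp [h.comul_dom]), zero_add]
  | succ n ih =>
    have e₁ : spiderComul v X (n + 1) * spiderComul v X m =
        (spiderComul v X 2 * wr 1) ⟫ (wr 1 * (spiderComul v X n * spiderComul v X m)) := by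
      rw [add_comm n 1, ← h.comul_two_comp, ← mul_assoc,
        ← comp_mul_comp (by simp [h.comul_dom, h.comul_cod]) (by simp [h.comul_dom]),
        wr_comp (by simp [h.comul_dom])]
    have e₂ : wr 1 * spiderComul v X (n + m) =
        (wr 1 * spiderComul v X 2) ⟫ (wr 1 * (spiderComul v X n * spiderComul v X m)) := by
      rw [← ih, wr_mul_comp _ (by simp [h.comul_dom, h.comul_cod])]
    have : n + 1 + m = 1 + (n + m) := by omega
    rw [e₁, this, ← h.comul_two_comp, e₂,
      ← comp_assoc (by simp [h.comul_cod, h.comul_dom]) (by simp [h.comul_cod, h.comul_dom]),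
      ← comp_assoc (by simp [h.comul_cod, h.comul_dom]) (by simp [h.comul_cod, h.comul_dom]),
      h.comul_assoc]

theorem rotate (h : Spider v X) (n : ℕ) : v (1 + n) ⟫ br 1 n = v (n + 1) := by
  have key : ∀ n k, v (1 + n + k) ⟫ (br 1 n * wr k) = v (1 + n + k) := by
    intro n
    induction n with
    | zero => intro k; rw [br_zero_right, wr_mul_wr, comp_wr (by simp [h.cod])]
    | succ n ih =>
      intro k
      have e₁ := ih (1 + k)
      have e₂ := h.symm n k
      have e₃ : 1 + (n + 1) + k = 1 + n + (1 + k) := by omega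
      have e₄ : 1 + (n + 1) + k = n + 2 + k := by omega
      rw [← e₃] at e₁
      rw [← e₄] at e₂
      rw [br_add_right, comp_mul_wr _ (by simp),
        ← comp_assoc (by simp [h.cod, add_assoc]) (by simp), mul_assoc, wr_mul_wr, e₁, e₂]
  have := key n 0
  rw [wr_zero, mul_one, add_zero] at this
  rw [this, add_comm]

theorem two_eq (h : Spider v X) : v 2 = cupM ⟫ (wr 1 * X) := by
  have := cupsM_bendM (n := 1) (m := 1) (h.dom 2) (h.cod 2)
  rw [← h.bin, cupsM_one] at this
  exact this.symm

/-- X is a bent symmetric binary vertex, hence equal to its own transpose. -/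
theorem bin_capM (h : Spider v X) : (X * wr 1) ⟫ capM = (wr 1 * X) ⟫ capM := by
  have h₀ : v 2 ⟫ br 1 1 = v 2 := by
    have := h.symm 0 0
    rwa [wr_zero, one_mul, mul_one] at this
  rw [h.two_eq] at h₀
  have h₁ := h.bin_dom
  have h₂ := h.bin_cod
  have hσ : (env [] ([capM, cupM, X] ++ [])).Typed (sig [([0, 0], []), ([], [0, 0]), ([0], [0])])
    := typed_env (by simp [Env.dims, env, h₁, h₂])
  have z₁ := eqv hσ (ids [0] * sym 11 ⊳ sym 10 * ids [0]) (ids [0]) [0] [(11, [], [2, 1]),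
    (10, [0, 2], [])] [(0, [0], [1])] [1] (capM_zigzag)
  have z₂ := eqv hσ (swap [0] [0] ⊳ sym 10) (sym 10) [0, 1] [(10, [1, 0], [])] [(10, [0, 1], [])]
    [] (braid_capM)
  have z₃ := eqv hσ (sym 11 ⊳ swap [0] [0]) (sym 11) [] [(11, [], [1, 0])] [(11, [], [0, 1])]
    [0, 1] (cupM_braid)
  have z₄ := eqv hσ (sym 11 ⊳ ids [0] * sym 12 ⊳ swap [0] [0]) (sym 11 ⊳ ids [0] * sym 12) []
    [(11, [], [1, 2]), (12, [2], [0])] [(11, [], [0, 2]), (12, [2], [1])] [0, 1] (h₀)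
  have key := eval_eq hσ (sym 12 * ids [0] ⊳ sym 10) (ids [0] * sym 12 ⊳ sym 10) ((Eqv.refl (L :=
    [0, 1]) (L' := []) (P := [(12, [0], [2]), (10, [2, 1], [])]) hσ)
      |>.unnorm hσ [(0, [0], [3]), (12, [3], [2]), (10, [2, 1], [])]
      |>.step hσ z₁.symm [] [(11, [], [2, 3]), (10, [0, 2], []), (12, [3], [4]), (10, [4, 1], [])]
      |>.step hσ z₄ [] [(11, [], [2, 3]), (12, [3], [4]), (10, [0, 4], []), (10, [2, 1], [])]
      |>.step hσ z₂ [(0, 1)] [(11, [], [2, 3]), (12, [3], [4]), (10, [0, 4], []),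
        (10, [1, 2], [])]
      |>.step hσ z₁ [] [(12, [1], [2]), (10, [0, 2], [])])
  simp only
    [Tm.eval, sym_env, dims_cons, dims_nil, dim_env, List.getD_cons_zero, List.getD_cons_succ, List.cons_append, List.nil_append, add_zero, Nat.reduceLT, if_false, Nat.reduceSub]
    at key
  exact key

/-- The multiplication is the transpose of the comultiplication: X slides around the cap, and the
remaining leg is moved to the other end by `rotate`. Laws of multiplications are thus transposes of
laws of comultiplications. -/
theorem mul_eq (h : Spider v X) (n : ℕ) : spiderMul v X n = bendM n 1 (cupM ⟫ (spiderComul v X n * wr 1)) := by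
  have h₁ := h.bin_dom
  have h₂ := h.bin_cod
  have h₃ := h.dom (1 + n)
  have h₄ := h.cod (1 + n)
  have hσ : (env [n] ([capM, cupM, X, v (1 + n), capsM n] ++ [])).Typed (sig [([0, 0], []),
    ([], [0, 0]), ([0], [0]), ([], [0, 1]), ([1, 1], [])]) := typed_env (by simp
    [Env.dims, env, h₁, h₂, h₃, h₄])
  have z₁ := eqv hσ (ids [0] * sym 11 ⊳ sym 10 * ids [0]) (ids [0]) [0] [(11, [], [2, 1]),
    (10, [0, 2], [])] [(0, [0], [1])] [1] (capM_zigzag)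
  have z₂ := eqv hσ (swap [0] [0] ⊳ sym 10) (sym 10) [0, 1] [(10, [1, 0], [])] [(10, [0, 1], [])]
    [] (braid_capM)
  have z₃ := eqv hσ (sym 11 ⊳ swap [0] [0]) (sym 11) [] [(11, [], [1, 0])] [(11, [], [0, 1])]
    [0, 1] (cupM_braid)
  have z₄ := eqv hσ (sym 12 * ids [0] ⊳ sym 10) (ids [0] * sym 12 ⊳ sym 10) [0, 1]
    [(12, [0], [2]), (10, [2, 1], [])] [(12, [1], [2]), (10, [0, 2], [])] [] (h.bin_capM)
  rw [spiderMul, spiderComul, ← h.rotate n, bendM, bendM, bendM, capsM_one]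
  have key := eval_eq hσ (ids [1] * (sym 13 ⊳ swap [0] [1]) ⊳ sym 14 * ids [0] ⊳ sym 12) (ids [1]
    * (sym 11 ⊳ (sym 12 ⊳ (ids [0] * sym 13 ⊳ sym 10 * ids [1])) * ids [0]) ⊳ sym 14 * ids [0])
    ((Eqv.refl (L := [100]) (L' := [1]) (P := [(13, [], [0, 101]), (14, [100, 101], []),
    (12, [0], [1])]) hσ)
      |>.unnorm hσ [(13, [], [0, 101]), (14, [100, 101], []), (12, [0], [2]), (0, [2], [1])]
      |>.step hσ z₁.symm [] [(13, [], [0, 101]), (14, [100, 101], []), (12, [0], [2]),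
        (11, [], [3, 1]), (10, [2, 3], [])]
      |>.step hσ z₂ [] [(13, [], [0, 101]), (14, [100, 101], []), (12, [0], [2]),
        (11, [], [3, 1]), (10, [3, 2], [])]
      |>.step hσ z₄.symm [] [(11, [], [0, 1]), (12, [0], [2]), (13, [], [3, 101]),
        (10, [2, 3], []), (14, [100, 101], [])])
  simp only
    [Tm.eval, sym_env, dims_cons, dims_nil, dim_env, List.getD_cons_zero, List.getD_cons_succ, List.cons_append, List.nil_append, add_zero, Nat.reduceLT, if_false, Nat.reduceSub]
    at key
  exact key

theorem mul_one (h : Spider v X) : spiderMul v X 1 = wr 1 := by rw [spiderMul, ← h.bin, h.inv]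

/-- Transpose of `comul_add` for n and 1. -/
theorem mul_succ (h : Spider v X) (n : ℕ) :
    spiderMul v X (n + 1) = (spiderMul v X n * wr 1) ⟫ spiderMul v X 2 := by
  have h₁ := h.comul_dom
  have h₂ := h.comul_cod
  have h₃ := h.comul_add n 1
  have h₄ := capsM_succ 1
  rw [capsM_one] at h₄
  rw [h.comul_one] at h₃
  have hσ : (env [n] ([capM, cupM, spiderComul v X 2, spiderComul v X n, capsM n] ++ [])).Typed
    (sig [([0, 0], []), ([], [0, 0]), ([0], [0, 0]), ([0], [1]), ([1, 1], [])]) := typed_env (by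
    simp [Env.dims, env, h₁, h₂])
  have z₁ := eqv hσ (ids [0] * sym 11 ⊳ sym 10 * ids [0]) (ids [0]) [0] [(11, [], [2, 1]),
    (10, [0, 2], [])] [(0, [0], [1])] [1] (capM_zigzag)
  have z₂ := eqv hσ (swap [0] [0] ⊳ sym 10) (sym 10) [0, 1] [(10, [1, 0], [])] [(10, [0, 1], [])]
    [] (braid_capM)
  have z₃ := eqv hσ (sym 11 ⊳ swap [0] [0]) (sym 11) [] [(11, [], [1, 0])] [(11, [], [0, 1])]
    [0, 1] (cupM_braid)
  rw [h.mul_eq, h.mul_eq, h.mul_eq, ← h₃, bendM, bendM, bendM, h₄, capsM_succ]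
  have key := eval_eq hσ (ids [1, 0] * (sym 11 ⊳ (sym 12 ⊳ sym 13 * ids [0]) * ids [0]) ⊳ (ids [1]
    * swap [0] [1] * ids [0] ⊳ sym 14 * sym 10) * ids [0]) ((ids [1] * (sym 11 ⊳ sym 13 * ids [0])
    ⊳ sym 14 * ids [0]) * ids [0] ⊳ (ids [0, 0] * (sym 11 ⊳ sym 12 * ids [0]) ⊳ (ids [0] * swap
    [0] [0] * ids [0] ⊳ sym 10 * sym 10) * ids [0])) ((Eqv.refl (L := [100, 1]) (L' := [2]) (P :=
    [(11, [], [0, 2]), (12, [0], [3, 4]), (13, [3], [101]), (14, [100, 101], []),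
    (10, [1, 4], [])]) hσ)
      |>.unnorm hσ [(11, [], [0, 2]), (12, [0], [3, 4]), (10, [1, 4], []), (0, [3], [5]),
        (13, [5], [101]), (14, [100, 101], [])]
      |>.step hσ z₁.symm [] [(11, [], [0, 2]), (12, [0], [3, 4]), (10, [1, 4], []),
        (11, [], [5, 6]), (10, [3, 5], []), (13, [6], [101]), (14, [100, 101], [])]
      |>.step hσ z₂ [(0, 5)] [(11, [], [0, 2]), (12, [0], [3, 4]), (10, [1, 4], []),
        (11, [], [5, 6]), (13, [6], [101]), (14, [100, 101], []), (10, [5, 3], [])]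
      |>.step hσ z₃ [(1, 5)] [(11, [], [0, 3]), (13, [0], [101]), (14, [100, 101], []),
        (11, [], [4, 2]), (12, [4], [5, 6]), (10, [3, 5], []), (10, [1, 6], [])])
  simp only
    [Tm.eval, sym_env, dims_cons, dims_nil, dim_env, List.getD_cons_zero, List.getD_cons_succ, List.cons_append, List.nil_append, add_zero, Nat.reduceLT, if_false, Nat.reduceSub]
    at key
  exact key

end Spider

/-! ### The generators as morphisms -/

/-- The black vertices. -/
def blackM (n : ℕ) : Mor := (black n).mor
/-- The white vertices. -/
def whiteM (n : ℕ) : Mor := (white n).mor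
/-- The negation. -/
def xM : Mor := blackBin.mor
/-- The sign changer. -/
def sM : Mor := whiteBin.mor
/-- The black multiplications. -/
def bmul (n : ℕ) : Mor := (blackMul n).mor
/-- The black comultiplications. -/
def bcom (n : ℕ) : Mor := (blackComul n).mor
/-- The white comultiplications. -/
def wcom (n : ℕ) : Mor := (whiteComul n).mor
/-- The white multiplications. -/
def wmul (n : ℕ) : Mor := (whiteV n 1 ⨟ whiteBin).mor
/-- The crossing. -/
def crossM : Mor := cross.mor

theorem mor_blackV (n m : ℕ) : (blackV n m).mor = bendM n m (blackM (n + m)) := mor_bend _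

theorem mor_whiteV (n m : ℕ) : (whiteV n m).mor = bendM n m (whiteM (n + m)) := mor_bend _

theorem Rule.mor_eq {a b : ℕ} {f g : Diagram a b} (h : Rule f g) : f.mor = g.mor :=
  (Rewrites.rule h).mor_eq

theorem spider_black : Spider blackM xM where
  dom _ := rfl
  cod _ := rfl
  symm i j := by have := (Rule.sym_black i j).mor_eq; rwa [mor_comp] at this
  bin := mor_blackV 1 1
  inv := by have := Rule.inv_black.mor_eq; rwa [mor_comp, mor_wires] at this
  fuse n m := by
    have := (Rule.sp_black n m).mor_eq
    rwa [mor_comp, mor_comp, mor_blackV, mor_blackV, mor_blackV] at this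

theorem spider_white : Spider whiteM sM where
  dom _ := rfl
  cod _ := rfl
  symm i j := by have := (Rule.sym_white i j).mor_eq; rwa [mor_comp] at this
  bin := mor_whiteV 1 1
  inv := by have := Rule.inv_white.mor_eq; rwa [mor_comp, mor_wires] at this
  fuse n m := by
    have := (Rule.sp_white n m).mor_eq
    rwa [mor_comp, mor_comp, mor_whiteV, mor_whiteV, mor_whiteV] at this

theorem bmul_eq (n : ℕ) : bmul n = spiderMul blackM xM n := by
  rw [bmul, blackMul, mor_comp, mor_blackV]; rfl

theorem bcom_eq (n : ℕ) : bcom n = spiderComul blackM xM n := by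
  rw [bcom, blackComul, mor_comp, mor_blackV]; rfl

theorem wmul_eq (n : ℕ) : wmul n = spiderMul whiteM sM n := by
  rw [wmul, mor_comp, mor_whiteV]; rfl

theorem wcom_eq (n : ℕ) : wcom n = spiderComul whiteM sM n := by
  rw [wcom, whiteComul, mor_comp, mor_whiteV]; rfl

@[simp] theorem blackM_dom (n : ℕ) : (blackM n).dom = 0 := rfl
@[simp] theorem blackM_cod (n : ℕ) : (blackM n).cod = n := rfl
@[simp] theorem whiteM_dom (n : ℕ) : (whiteM n).dom = 0 := rfl
@[simp] theorem whiteM_cod (n : ℕ) : (whiteM n).cod = n := rfl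
@[simp] theorem xM_dom : xM.dom = 1 := rfl
@[simp] theorem xM_cod : xM.cod = 1 := rfl
@[simp] theorem sM_dom : sM.dom = 1 := rfl
@[simp] theorem sM_cod : sM.cod = 1 := rfl
@[simp] theorem bmul_dom (n : ℕ) : (bmul n).dom = n := rfl
@[simp] theorem bmul_cod (n : ℕ) : (bmul n).cod = 1 := rfl
@[simp] theorem bcom_dom (n : ℕ) : (bcom n).dom = 1 := rfl
@[simp] theorem bcom_cod (n : ℕ) : (bcom n).cod = n := rfl
@[simp] theorem wmul_dom (n : ℕ) : (wmul n).dom = n := rfl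
@[simp] theorem wmul_cod (n : ℕ) : (wmul n).cod = 1 := rfl
@[simp] theorem wcom_dom (n : ℕ) : (wcom n).dom = 1 := rfl
@[simp] theorem wcom_cod (n : ℕ) : (wcom n).cod = n := rfl
@[simp] theorem crossM_dom : crossM.dom = 2 := rfl
@[simp] theorem crossM_cod : crossM.cod = 2 := rfl

/-! ### Bipartite wirings as morphisms. -/

/-- The juxtaposition of a finite family of morphisms. -/
def juxtM : {q : ℕ} → (Fin q → Mor) → Mor
  | 0, _ => 1
  | q + 1, f => juxtM (fun i : Fin q => f i.castSucc) * f (Fin.last q)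

/-- The morphism of `merge`. -/
def mergeM (K : ℕ → ℕ → Mor) : {n : ℕ} → (c d : Fin n → ℕ) → Mor
  | 0, _, _ => 1
  | n + 1, c, d =>
    (wr (∑ j : Fin n, c j.castSucc) * K (c (Fin.last n)) (∑ j : Fin n, d j.castSucc) *
        wr (d (Fin.last n))) ⟫
      (mergeM K (fun j => c j.castSucc) (fun j => d j.castSucc) *
        wr (c (Fin.last n) + d (Fin.last n)))

/-- The morphism of `wiring`. -/
def wiringM (K : ℕ → ℕ → Mor) {n : ℕ} : {q : ℕ} → (b : Fin q → Fin n → ℕ) → Mor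
  | 0, _ => 1
  | q + 1, b =>
    (wiringM K (fun i : Fin q => b i.castSucc) * wr (∑ j, b (Fin.last q) j)) ⟫
      mergeM K (fun j => ∑ i : Fin q, b i.castSucc j) (b (Fin.last q))

theorem mor_juxt {q : ℕ} {a b : Fin q → ℕ} (f : (i : Fin q) → Diagram (a i) (b i)) :
    (juxt f).mor = juxtM fun i => (f i).mor := by
  induction q with
  | zero => rw [juxt, mor_cast]; rfl
  | succ q ih => rw [juxt, mor_cast, mor_tensor, ih]; rfl

theorem mor_merge (K : (p q : ℕ) → Diagram (p + q) (q + p)) {n : ℕ} (c d : Fin n → ℕ) :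
    (merge K c d).mor = mergeM (fun p q => (K p q).mor) c d := by
  induction n with
  | zero => rw [merge, mor_cast]; rfl
  | succ n ih => rw [merge, mor_cast, mor_comp, mor_cast, mor_tensor, mor_tensor, mor_tensor, ih]; rfl

theorem mor_wiring (K : (p q : ℕ) → Diagram (p + q) (q + p)) {n q : ℕ} (b : Fin q → Fin n → ℕ) :
    (wiring K b).mor = wiringM (fun p q => (K p q).mor) b := by
  induction q with
  | zero => rw [wiring, mor_cast]; rfl
  | succ q ih => rw [wiring, mor_cast, mor_comp, mor_tensor, ih, mor_merge]; rfl

theorem mor_bipartite (K : (p q : ℕ) → Diagram (p + q) (q + p)) {q n : ℕ} (b : Fin q → Fin n → ℕ)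
    (f : Fin q → (k : ℕ) → Diagram 1 k) (g : (k : ℕ) → Diagram k 1) :
    (bipartite K b f g).mor = juxtM (fun i => (f i (∑ j, b i j)).mor) ⟫
      wiringM (fun p q => (K p q).mor) b ⟫ juxtM (fun j => (g (∑ i, b i j)).mor) := by
  rw [bipartite, mor_cast, mor_comp, mor_comp, mor_juxt, mor_juxt, mor_wiring]

/-- In the complete bipartite wiring on 2 + 2 vertices only the two middle wires change places;
every other bundle move involves an empty bundle. -/
theorem bipartite_two_two {K : ℕ → ℕ → Mor} {f g : ℕ → Mor} (h₁ : K 0 0 = wr 0) (h₂ : K 1 0 = wr 1)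
    (h₃ : K 0 1 = wr 1) (hd : (K 1 1).dom = 2) (hc : (K 1 1).cod = 2) :
    juxtM (fun _ : Fin 2 => f (∑ _j : Fin 2, 1)) ⟫
        wiringM K (fun (_ : Fin 2) (_ : Fin 2) => 1) ⟫ juxtM (fun _ : Fin 2 => g (∑ _i : Fin 2, 1)) =
      (f 2 * f 2) ⟫ (wr 1 * K 1 1 * wr 1) ⟫ (g 2 * g 2) := by
  have e : 4 = (wr 1 * K 1 1 * wr 1).dom := by simp [hd]
  have e' : (wr 1 * K 1 1 * wr 1).cod = 4 := by simp [hc]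
  have e₁ : ∀ n, wr n ⟫ wr n = wr n := fun n => wr_comp (by simp)
  have e₂ := wr_comp e
  have e₃ := comp_wr e'
  simp [juxtM, wiringM, mergeM, h₁, h₂, h₃, wr_mul_wr, wr_zero, e₁, e₂, e₃]

/-! ### Small instances of the rules as equations between morphisms. -/

theorem blackV_mul (n : ℕ) : (blackV n 1).mor = bmul n ⟫ xM := by
  rw [bmul_eq, spiderMul, comp_assoc (by simp) (by simp), spider_black.inv, comp_wr (by simp),
    mor_blackV]

theorem blackV_comul (n : ℕ) : (blackV 1 n).mor = xM ⟫ bcom n := by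
  have e : (bendM 1 n (blackM (1 + n))).dom = 1 := bendM_dom rfl
  rw [bcom_eq, spiderComul, ← comp_assoc (by simp) (by simp [e]), spider_black.inv,
    wr_comp e.symm, mor_blackV]

/-- The rule joins plain vertices by a plain wire. Passing to `bmul` and `bcom` puts two negations
on that wire, and these cancel. -/
theorem blackV_comp_blackV (n m : ℕ) :
    (blackV n 1).mor ⟫ (blackV 1 m).mor = bmul n ⟫ bcom m := by
  rw [blackV_mul, blackV_comul, comp_assoc (by simp) (by simp),
    ← comp_assoc (f := xM) (by simp) (by simp), spider_black.inv, wr_comp (by simp)]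

theorem ba_black_eq (n m : ℕ) : bmul n ⟫ bcom m =
    juxtM (fun _ : Fin n => bcom (∑ _j : Fin m, 1)) ⟫
      wiringM (fun p q => (crossBundle p q).mor) (fun (_ : Fin n) (_ : Fin m) => 1) ⟫
      juxtM (fun _ : Fin m => bmul (∑ _i : Fin n, 1)) := by
  have := (Rule.ba_black n m).mor_eq
  rwa [mor_comp, blackV_comp_blackV, mor_bipartite] at this

theorem ba_eq (n m : ℕ) : bmul n ⟫ wcom (m + 1) =
    juxtM (fun _ : Fin n => wcom (∑ _j : Fin (m + 1), 1)) ⟫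
      wiringM br (fun (_ : Fin n) (_ : Fin (m + 1)) => 1) ⟫
      juxtM (fun _ : Fin (m + 1) => bmul (∑ _i : Fin n, 1)) := by
  have := (Rule.ba n m).mor_eq
  rwa [mor_comp, mor_bipartite] at this

theorem crossBundle_one_one : (crossBundle 1 1).mor = crossM := by
  simp only [crossBundle, crossOne, mor_cast, mor_comp, mor_tensor, mor_wires, wr_mul_wr, wr_zero,
    one_mul, Nat.reduceAdd]
  rw [wr_comp (by rfl), comp_wr (by rfl)]; rfl

theorem bmul_two_bcom_two : bmul 2 ⟫ bcom 2 =
    (bcom 2 * bcom 2) ⟫ (wr 1 * crossM * wr 1) ⟫ (bmul 2 * bmul 2) := by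
  rw [ba_black_eq, bipartite_two_two, crossBundle_one_one]
  · simp [crossBundle, mor_cast, mor_wires]
  · simp only [crossBundle, crossOne, mor_cast, mor_comp, mor_tensor, mor_wires, wr_zero,
      one_mul]
    exact wr_comp (by rfl)
  · simp [crossBundle, mor_cast, mor_wires]
  · rfl
  · rfl

theorem bmul_two_wcom_two : bmul 2 ⟫ wcom 2 =
    (wcom 2 * wcom 2) ⟫ (wr 1 * br 1 1 * wr 1) ⟫ (bmul 2 * bmul 2) := by
  rw [ba_eq 2 1, bipartite_two_two (br_zero_right 0) (br_zero_right 1) (br_zero_left 1) rfl rfl]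

theorem bmul_zero_wcom_two : bmul 0 ⟫ wcom 2 = bmul 0 * bmul 0 := by
  rw [ba_eq 0 1]
  simp only [juxtM, wiringM, Finset.univ_eq_empty, Finset.sum_empty, one_mul]
  rw [← wr_zero, wr_comp (by simp), wr_comp (by simp)]

theorem bmul_zero_bcom_two : bmul 0 ⟫ bcom 2 = bmul 0 * bmul 0 := by
  rw [ba_black_eq 0 2]
  simp only [juxtM, wiringM, Finset.univ_eq_empty, Finset.sum_empty, one_mul]
  rw [← wr_zero, wr_comp (by simp), wr_comp (by simp)]

theorem bmul_zero_bcom_zero : bmul 0 ⟫ bcom 0 = 1 := by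
  rw [ba_black_eq 0 0]
  simp only [juxtM, wiringM, ← wr_zero]
  rw [wr_comp (by simp), wr_comp (by simp)]

theorem wcom_two_bmul_two : wcom 2 ⟫ bmul 2 = bcom 0 ⟫ bmul 0 := by
  have := (Rule.lp 0).mor_eq
  rwa [mor_comp, mor_comp] at this

theorem bcom_two_sM_bmul_two : bcom 2 ⟫ (wr 1 * sM) ⟫ bmul 2 = bcom 0 ⟫ bmul 0 := by
  have := (Rule.lp_black 0 1).mor_eq
  rw [mor_comp, mor_comp, mor_comp, mor_tensor, power, power, mor_tensor, mor_wires, mor_wires, wr_zero,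
    one_mul] at this
  exact this

theorem sM_bcom_two : sM ⟫ bcom 2 = bcom 2 ⟫ (sM * sM) := by
  have := (Rule.am_black 2).mor_eq
  rw [mor_comp, mor_comp, power, power, power, mor_tensor, mor_tensor, mor_wires, wr_zero,
    one_mul] at this
  exact this

theorem xM_wcom_two : xM ⟫ wcom 2 = wcom 2 ⟫ (xM * xM) := by
  have := (Rule.am_white 2).mor_eq
  rw [mor_comp, mor_comp, power, power, power, mor_tensor, mor_tensor, mor_wires, wr_zero,
    one_mul] at this
  exact this

theorem sM_bcom_zero : sM ⟫ bcom 0 = bcom 0 := by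
  have := (Rule.am_black 0).mor_eq
  rw [mor_comp, mor_comp, power, mor_wires] at this
  exact this.trans (comp_wr (by rfl))

theorem xM_wcom_zero : xM ⟫ wcom 0 = wcom 0 := by
  have := (Rule.am_white 0).mor_eq
  rw [mor_comp, mor_comp, power, mor_wires] at this
  exact this.trans (comp_wr (by rfl))

theorem sM_wcom_succ (n : ℕ) : sM ⟫ wcom (n + 1) = wcom (n + 1) ⟫ (wr n * sM) := by
  have := (Rule.ph n).mor_eq
  rw [mor_comp, mor_comp, mor_tensor, mor_wires] at this
  rw [wcom, whiteComul, mor_comp, comp_assoc (f := whiteBin.mor) (by rfl) (by simp)]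
  exact congrArg (sM ⟫ ·) this

theorem wcom_two_eq : (whiteV 2 1).mor = wmul 2 ⟫ sM := by
  rw [wmul, mor_comp, comp_assoc (by rfl) (by rfl)]
  exact (comp_wr (by rfl)).symm.trans (congrArg ((whiteV 2 1).mor ⟫ ·) spider_white.inv.symm)

theorem elim_eq : (wr 1 * (xM ⟫ bcom 2) * wr 1) ⟫ ((wmul 2 ⟫ sM) * (wmul 2 ⟫ sM)) ⟫ crossM =
    (wr 1 * (xM ⟫ bcom 2) * wr 1) ⟫ ((wmul 2 ⟫ sM) * (wmul 2 ⟫ sM)) ⟫ br 1 1 := by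
  have := Rule.elim.mor_eq
  rw [mor_comp, mor_comp, mor_comp, mor_comp, mor_tensor, mor_tensor, mor_tensor, wcom_two_eq,
    blackV_comul] at this
  exact this

/-! ### The core signature -/

/-- The morphisms that occur in the derivations. -/
def coreOps : List Mor :=
  -- The positions fix the symbols: 10 cap, 11 cup, 12 X, 13 S, 14 μ, 15 its unit η, 16 δ, 17 its
  -- counit ε, 18 c, 19 its counit e, 20 the white multiplication w, 21 the crossing, 22 the state
  -- |1⟩, 23 the unit z of w. Additional operations start at 24.
  [capM, cupM, xM, sM, bmul 2, bmul 0, bcom 2, bcom 0, wcom 2, wcom 0, wmul 2, crossM, blackM 1,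
    wmul 0]

/-- The arities of `coreOps`. -/
def coreSig : List (List ℕ × List ℕ) :=
  [([0, 0], []), ([], [0, 0]), ([0], [0]), ([0], [0]), ([0, 0], [0]), ([], [0]), ([0], [0, 0]),
    ([0], []), ([0], [0, 0]), ([0], []), ([0, 0], [0]), ([0, 0], [0, 0]), ([], [0]), ([], [0])]

theorem typed_coreOps {d : List ℕ} {o : List Mor} :
    (env d (coreOps ++ o)).Typed (sig coreSig) :=
  typed_env (by simp [coreOps, coreSig, dims_cons, dims_nil, dim_env])

theorem typed_core {d : List ℕ} {o : List Mor} {l : List (List ℕ × List ℕ)}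
    (h : List.Forall₂ (fun f ab => f.dom = (env d []).dims ab.1 ∧ f.cod = (env d []).dims ab.2)
      o l) : (env d (coreOps ++ o)).Typed (sig (coreSig ++ l)) := by
  rw [← List.append_nil (coreOps ++ o)]
  refine typed_env (List.rel_append ?_ h)
  simp [coreOps, coreSig, dims_cons, dims_nil, dim_env]

/-! ### Laws of the black and white structures in low arity. -/

theorem spiderMul_two_eq {v : ℕ → Mor} {X : Mor} (h : Spider v X) : spiderMul v X 2 =
    (wr 2 * (cupM ⟫ (spiderComul v X 2 * wr 1))) ⟫
      (((wr 1 * br 1 1 * wr 1) ⟫ (capM * capM)) * wr 1) := by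
  rw [h.mul_eq, bendM, capsM_succ, capsM_one]

theorem spiderMul_zero_eq {v : ℕ → Mor} {X : Mor} (h : Spider v X) :
    spiderMul v X 0 = cupM ⟫ (spiderComul v X 0 * wr 1) := by
  rw [h.mul_eq, bendM_zero (by simp [h.comul_cod])]

theorem blackM_xM : blackM 1 ⟫ xM = bmul 0 := by
  rw [bmul_eq, spiderMul, bendM_zero (by simp)]

theorem cupM_sM_wcom : cupM ⟫ (wr 1 * (sM ⟫ wcom 2)) = whiteM 3 := by
  rw [wr_mul_comp _ (by simp), ← comp_assoc (by simp) (by simp), ← spider_white.two_eq, wcom_eq]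
  exact spider_white.comp_comul 1 2

theorem whiteM_sM : wmul 0 ⟫ sM = whiteM 1 := by
  rw [wmul_eq, spiderMul, bendM_zero (by simp), comp_assoc (by simp) (by simp), spider_white.inv,
    comp_wr (by simp)]

theorem bcom_assoc : bcom 2 ⟫ (bcom 2 * wr 1) = bcom 2 ⟫ (wr 1 * bcom 2) := by
  simpa only [bcom_eq] using spider_black.comul_assoc

theorem bcom_comm : bcom 2 ⟫ br 1 1 = bcom 2 := by
  simpa only [bcom_eq] using spider_black.comul_two_swap

theorem bcom_counit : bcom 2 ⟫ (wr 1 * bcom 0) = wr 1 := by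
  simpa only [bcom_eq] using spider_black.comul_counit

theorem wcom_assoc : wcom 2 ⟫ (wcom 2 * wr 1) = wcom 2 ⟫ (wr 1 * wcom 2) := by
  simpa only [wcom_eq] using spider_white.comul_assoc

theorem wcom_comm : wcom 2 ⟫ br 1 1 = wcom 2 := by
  simpa only [wcom_eq] using spider_white.comul_two_swap

theorem wcom_counit : wcom 2 ⟫ (wr 1 * wcom 0) = wr 1 := by
  simpa only [wcom_eq] using spider_white.comul_counit

theorem bmul_two_eq : bmul 2 = (wr 2 * (cupM ⟫ (bcom 2 * wr 1))) ⟫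
    (((wr 1 * br 1 1 * wr 1) ⟫ (capM * capM)) * wr 1) := by
  simpa only [bcom_eq, bmul_eq] using spiderMul_two_eq spider_black

theorem wmul_two_eq : wmul 2 = (wr 2 * (cupM ⟫ (wcom 2 * wr 1))) ⟫
    (((wr 1 * br 1 1 * wr 1) ⟫ (capM * capM)) * wr 1) := by
  simpa only [wcom_eq, wmul_eq] using spiderMul_two_eq spider_white

theorem bmul_zero_eq : bmul 0 = cupM ⟫ (bcom 0 * wr 1) := by
  simpa only [bcom_eq, bmul_eq] using spiderMul_zero_eq spider_black

theorem wmul_zero_eq : wmul 0 = cupM ⟫ (wcom 0 * wr 1) := by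
  simpa only [wcom_eq, wmul_eq] using spiderMul_zero_eq spider_white

theorem cupM_sM_wcom_swap : cupM ⟫ (wr 1 * (sM ⟫ wcom 2)) ⟫ (br 1 1 * wr 1) =
    cupM ⟫ (wr 1 * (sM ⟫ wcom 2)) := by
  have := spider_white.symm 0 1
  rw [cupM_sM_wcom]
  rwa [wr_zero, one_mul] at this

theorem cupM_sM_wcom_cap : cupM ⟫ (wr 1 * (sM ⟫ wcom 2)) ⟫ (wr 1 * capM) = wmul 0 ⟫ sM := by
  have := Rule.tr_white.mor_eq
  rw [mor_comp, mor_tensor] at this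
  rw [cupM_sM_wcom, whiteM_sM]
  exact this

/-! ### The rules as equations between programs -/

/-- Each law is stated over an arbitrary extension of the core operations and of the bundle sizes,
so that it applies unchanged when vectors or multiplications of bundles are present. -/
theorem zigzag (d : List ℕ) (o : List Mor) : (env d (coreOps ++ o)).Eqv [0] [(11, [], [2, 1]),
  (10, [0, 2], [])] [(0, [0], [1])] [1] :=
  eqv typed_coreOps (ids [0] * sym 11 ⊳ sym 10 * ids [0]) (ids [0]) _ _ _ _ (capM_zigzag)

theorem cap_comm (d : List ℕ) (o : List Mor) : (env d (coreOps ++ o)).Eqv [0, 1]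
  [(10, [1, 0], [])] [(10, [0, 1], [])] [] :=
  eqv typed_coreOps (swap [0] [0] ⊳ sym 10) (sym 10) _ _ _ _ (braid_capM)

theorem cup_comm (d : List ℕ) (o : List Mor) : (env d (coreOps ++ o)).Eqv [] [(11, [], [1, 0])]
  [(11, [], [0, 1])] [0, 1] :=
  eqv typed_coreOps (sym 11 ⊳ swap [0] [0]) (sym 11) _ _ _ _ (cupM_braid)

theorem x_x (d : List ℕ) (o : List Mor) : (env d (coreOps ++ o)).Eqv [0] [(12, [0], [2]),
  (12, [2], [1])] [(0, [0], [1])] [1] :=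
  eqv typed_coreOps (sym 12 ⊳ sym 12) (ids [0]) _ _ _ _ (spider_black.inv)

theorem s_s (d : List ℕ) (o : List Mor) : (env d (coreOps ++ o)).Eqv [0] [(13, [0], [2]),
  (13, [2], [1])] [(0, [0], [1])] [1] :=
  eqv typed_coreOps (sym 13 ⊳ sym 13) (ids [0]) _ _ _ _ (spider_white.inv)

theorem s_cap (d : List ℕ) (o : List Mor) : (env d (coreOps ++ o)).Eqv [0, 1] [(13, [0], [2]),
  (10, [2, 1], [])] [(13, [1], [2]), (10, [0, 2], [])] [] :=
  eqv typed_coreOps (sym 13 * ids [0] ⊳ sym 10) (ids [0] * sym 13 ⊳ sym 10) _ _ _ _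
    (spider_white.bin_capM)

theorem delta_assoc (d : List ℕ) (o : List Mor) : (env d (coreOps ++ o)).Eqv [0]
  [(16, [0], [4, 3]), (16, [4], [1, 2])] [(16, [0], [1, 4]), (16, [4], [2, 3])] [1, 2, 3] :=
  eqv typed_coreOps (sym 16 ⊳ sym 16 * ids [0]) (sym 16 ⊳ ids [0] * sym 16) _ _ _ _ (bcom_assoc)

theorem delta_comm (d : List ℕ) (o : List Mor) : (env d (coreOps ++ o)).Eqv [0]
  [(16, [0], [2, 1])] [(16, [0], [1, 2])] [1, 2] :=
  eqv typed_coreOps (sym 16 ⊳ swap [0] [0]) (sym 16) _ _ _ _ (bcom_comm)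

theorem delta_eps (d : List ℕ) (o : List Mor) : (env d (coreOps ++ o)).Eqv [0] [(16, [0], [1, 2]),
  (17, [2], [])] [(0, [0], [1])] [1] :=
  eqv typed_coreOps (sym 16 ⊳ ids [0] * sym 17) (ids [0]) _ _ _ _ (bcom_counit)

theorem c_assoc (d : List ℕ) (o : List Mor) : (env d (coreOps ++ o)).Eqv [0] [(18, [0], [4, 3]),
  (18, [4], [1, 2])] [(18, [0], [1, 4]), (18, [4], [2, 3])] [1, 2, 3] :=
  eqv typed_coreOps (sym 18 ⊳ sym 18 * ids [0]) (sym 18 ⊳ ids [0] * sym 18) _ _ _ _ (wcom_assoc)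

theorem c_comm (d : List ℕ) (o : List Mor) : (env d (coreOps ++ o)).Eqv [0] [(18, [0], [2, 1])]
  [(18, [0], [1, 2])] [1, 2] :=
  eqv typed_coreOps (sym 18 ⊳ swap [0] [0]) (sym 18) _ _ _ _ (wcom_comm)

theorem c_e (d : List ℕ) (o : List Mor) : (env d (coreOps ++ o)).Eqv [0] [(18, [0], [1, 2]),
  (19, [2], [])] [(0, [0], [1])] [1] :=
  eqv typed_coreOps (sym 18 ⊳ ids [0] * sym 19) (ids [0]) _ _ _ _ (wcom_counit)

theorem mu_def (d : List ℕ) (o : List Mor) : (env d (coreOps ++ o)).Eqv [0, 1] [(14, [0, 1], [2])]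
  [(11, [], [3, 2]), (16, [3], [4, 5]), (10, [0, 4], []), (10, [1, 5], [])] [2] :=
  eqv typed_coreOps (sym 14) (ids [0, 0] * (sym 11 ⊳ sym 16 * ids [0]) ⊳ (ids [0] * swap [0] [0] *
    ids [0] ⊳ sym 10 * sym 10) * ids [0]) _ _ _ _ (bmul_two_eq)

theorem w_def (d : List ℕ) (o : List Mor) : (env d (coreOps ++ o)).Eqv [0, 1] [(20, [0, 1], [2])]
  [(11, [], [3, 2]), (18, [3], [4, 5]), (10, [0, 4], []), (10, [1, 5], [])] [2] :=
  eqv typed_coreOps (sym 20) (ids [0, 0] * (sym 11 ⊳ sym 18 * ids [0]) ⊳ (ids [0] * swap [0] [0] *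
    ids [0] ⊳ sym 10 * sym 10) * ids [0]) _ _ _ _ (wmul_two_eq)

theorem eta_def (d : List ℕ) (o : List Mor) : (env d (coreOps ++ o)).Eqv [] [(15, [], [0])]
  [(11, [], [1, 0]), (17, [1], [])] [0] :=
  eqv typed_coreOps (sym 15) (sym 11 ⊳ sym 17 * ids [0]) _ _ _ _ (bmul_zero_eq)

theorem z_def (d : List ℕ) (o : List Mor) : (env d (coreOps ++ o)).Eqv [] [(23, [], [0])]
  [(11, [], [1, 0]), (19, [1], [])] [0] :=
  eqv typed_coreOps (sym 23) (sym 11 ⊳ sym 19 * ids [0]) _ _ _ _ (wmul_zero_eq)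

theorem one_x (d : List ℕ) (o : List Mor) : (env d (coreOps ++ o)).Eqv [] [(22, [], [1]),
  (12, [1], [0])] [(15, [], [0])] [0] :=
  eqv typed_coreOps (sym 22 ⊳ sym 12) (sym 15) _ _ _ _ (blackM_xM)

theorem s_c (d : List ℕ) (o : List Mor) : (env d (coreOps ++ o)).Eqv [0] [(13, [0], [3]),
  (18, [3], [1, 2])] [(18, [0], [1, 3]), (13, [3], [2])] [1, 2] :=
  eqv typed_coreOps (sym 13 ⊳ sym 18) (sym 18 ⊳ ids [0] * sym 13) _ _ _ _ (sM_wcom_succ 1)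

theorem s_delta (d : List ℕ) (o : List Mor) : (env d (coreOps ++ o)).Eqv [0] [(13, [0], [3]),
  (16, [3], [1, 2])] [(16, [0], [3, 4]), (13, [3], [1]), (13, [4], [2])] [1, 2] :=
  eqv typed_coreOps (sym 13 ⊳ sym 16) (sym 16 ⊳ sym 13 * sym 13) _ _ _ _ (sM_bcom_two)

theorem s_eps (d : List ℕ) (o : List Mor) : (env d (coreOps ++ o)).Eqv [0] [(13, [0], [1]),
  (17, [1], [])] [(17, [0], [])] [] :=
  eqv typed_coreOps (sym 13 ⊳ sym 17) (sym 17) _ _ _ _ (sM_bcom_zero)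

theorem x_c (d : List ℕ) (o : List Mor) : (env d (coreOps ++ o)).Eqv [0] [(12, [0], [3]),
  (18, [3], [1, 2])] [(18, [0], [3, 4]), (12, [3], [1]), (12, [4], [2])] [1, 2] :=
  eqv typed_coreOps (sym 12 ⊳ sym 18) (sym 18 ⊳ sym 12 * sym 12) _ _ _ _ (xM_wcom_two)

theorem x_e (d : List ℕ) (o : List Mor) : (env d (coreOps ++ o)).Eqv [0] [(12, [0], [1]),
  (19, [1], [])] [(19, [0], [])] [] :=
  eqv typed_coreOps (sym 12 ⊳ sym 19) (sym 19) _ _ _ _ (xM_wcom_zero)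

theorem mu_delta (d : List ℕ) (o : List Mor) : (env d (coreOps ++ o)).Eqv [0, 1]
  [(14, [0, 1], [4]), (16, [4], [2, 3])] [(16, [0], [4, 5]), (16, [1], [6, 7]),
  (21, [5, 6], [8, 9]), (14, [4, 8], [2]), (14, [9, 7], [3])] [2, 3] :=
  eqv typed_coreOps (sym 14 ⊳ sym 16) (sym 16 * sym 16 ⊳ ids [0] * sym 21 * ids [0] ⊳ sym 14 * sym
    14) _ _ _ _ (bmul_two_bcom_two)

theorem mu_c (d : List ℕ) (o : List Mor) : (env d (coreOps ++ o)).Eqv [0, 1] [(14, [0, 1], [4]),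
  (18, [4], [2, 3])] [(18, [0], [4, 5]), (18, [1], [6, 7]), (14, [4, 6], [2]), (14, [5, 7], [3])]
  [2, 3] :=
  eqv typed_coreOps (sym 14 ⊳ sym 18) (sym 18 * sym 18 ⊳ ids [0] * swap [0] [0] * ids [0] ⊳ sym 14
    * sym 14) _ _ _ _ (bmul_two_wcom_two)

theorem eta_c (d : List ℕ) (o : List Mor) : (env d (coreOps ++ o)).Eqv [] [(15, [], [2]),
  (18, [2], [0, 1])] [(15, [], [0]), (15, [], [1])] [0, 1] :=
  eqv typed_coreOps (sym 15 ⊳ sym 18) (sym 15 * sym 15) _ _ _ _ (bmul_zero_wcom_two)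

theorem eta_delta (d : List ℕ) (o : List Mor) : (env d (coreOps ++ o)).Eqv [] [(15, [], [2]),
  (16, [2], [0, 1])] [(15, [], [0]), (15, [], [1])] [0, 1] :=
  eqv typed_coreOps (sym 15 ⊳ sym 16) (sym 15 * sym 15) _ _ _ _ (bmul_zero_bcom_two)

theorem eta_eps (d : List ℕ) (o : List Mor) : (env d (coreOps ++ o)).Eqv [] [(15, [], [0]),
  (17, [0], [])] [] [] :=
  eqv typed_coreOps (sym 15 ⊳ sym 17) (ids []) _ _ _ _ (bmul_zero_bcom_zero)

theorem c_mu (d : List ℕ) (o : List Mor) : (env d (coreOps ++ o)).Eqv [0] [(18, [0], [2, 3]),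
  (14, [2, 3], [1])] [(17, [0], []), (15, [], [1])] [1] :=
  eqv typed_coreOps (sym 18 ⊳ sym 14) (sym 17 ⊳ sym 15) _ _ _ _ (wcom_two_bmul_two)

theorem delta_s_mu (d : List ℕ) (o : List Mor) : (env d (coreOps ++ o)).Eqv [0]
  [(16, [0], [2, 3]), (13, [3], [4]), (14, [2, 4], [1])] [(17, [0], []), (15, [], [1])] [1] :=
  eqv typed_coreOps (sym 16 ⊳ ids [0] * sym 13 ⊳ sym 14) (sym 17 ⊳ sym 15) _ _ _ _
    (bcom_two_sM_bmul_two)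

theorem elim_x (d : List ℕ) (o : List Mor) : (env d (coreOps ++ o)).Eqv [0, 1, 2] [(12, [1], [5]),
  (16, [5], [6, 7]), (20, [0, 6], [8]), (13, [8], [9]), (20, [7, 2], [10]), (13, [10], [11]),
  (21, [9, 11], [3, 4])] [(12, [1], [5]), (16, [5], [6, 7]), (20, [0, 6], [8]), (13, [8], [4]),
  (20, [7, 2], [9]), (13, [9], [3])] [3, 4] :=
  eqv typed_coreOps (ids [0] * (sym 12 ⊳ sym 16) * ids [0] ⊳ (sym 20 ⊳ sym 13) * (sym 20 ⊳ sym 13)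
    ⊳ sym 21) (ids [0] * (sym 12 ⊳ sym 16) * ids [0] ⊳ (sym 20 ⊳ sym 13) * (sym 20 ⊳ sym 13) ⊳
    swap [0] [0]) _ _ _ _ (elim_eq)

theorem cup_s_c (d : List ℕ) (o : List Mor) : (env d (coreOps ++ o)).Eqv [] [(11, [], [1, 3]),
  (13, [3], [4]), (18, [4], [0, 2])] [(11, [], [0, 3]), (13, [3], [4]), (18, [4], [1, 2])]
  [0, 1, 2] :=
  eqv typed_coreOps (sym 11 ⊳ ids [0] * (sym 13 ⊳ sym 18) ⊳ swap [0] [0] * ids [0]) (sym 11 ⊳ ids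
    [0] * (sym 13 ⊳ sym 18)) _ _ _ _ (cupM_sM_wcom_swap)

theorem cup_s_c_cap (d : List ℕ) (o : List Mor) : (env d (coreOps ++ o)).Eqv [] [(11, [], [0, 1]),
  (13, [1], [2]), (18, [2], [3, 4]), (10, [3, 4], [])] [(23, [], [1]), (13, [1], [0])] [0] :=
  eqv typed_coreOps (sym 11 ⊳ ids [0] * (sym 13 ⊳ sym 18) ⊳ ids [0] * sym 10) (sym 23 ⊳ sym 13) _
    _ _ _ (cupM_sM_wcom_cap)

/-! ### Transposition -/

theorem zigzag_right (d : List ℕ) (o : List Mor) : (env d (coreOps ++ o)).Eqv [0]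
  [(11, [], [1, 2]), (10, [2, 0], [])] [(0, [0], [1])] [1] :=
  (Eqv.refl typed_coreOps)
      |>.step typed_coreOps (cup_comm d o) [] [(11, [], [2, 1]), (10, [2, 0], [])]
      |>.step typed_coreOps (cap_comm d o) [] [(11, [], [2, 1]), (10, [0, 2], [])]
      |>.step typed_coreOps (zigzag d o) [] [(0, [0], [1])]

/-- By definition μ is δ with all legs bent; capping its output straightens one of them. -/
theorem mu_cap (d : List ℕ) (o : List Mor) : (env d (coreOps ++ o)).Eqv [0, 1, 2]
  [(14, [0, 1], [3]), (10, [3, 2], [])] [(16, [2], [3, 4]), (10, [0, 3], []), (10, [1, 4], [])] []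
  :=
  (Eqv.refl typed_coreOps)
      |>.step typed_coreOps (mu_def d o) [] [(11, [], [3, 4]), (16, [3], [5, 6]),
        (10, [0, 5], []), (10, [1, 6], []), (10, [4, 2], [])]
      |>.step typed_coreOps (zigzag_right d o) [] [(16, [2], [3, 4]), (10, [0, 3], []),
        (10, [1, 4], [])]

theorem w_cap (d : List ℕ) (o : List Mor) : (env d (coreOps ++ o)).Eqv [0, 1, 2]
  [(20, [0, 1], [3]), (10, [3, 2], [])] [(18, [2], [3, 4]), (10, [0, 3], []), (10, [1, 4], [])] []
  :=
  (Eqv.refl typed_coreOps)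
      |>.step typed_coreOps (w_def d o) [] [(11, [], [3, 4]), (18, [3], [5, 6]), (10, [0, 5], []),
        (10, [1, 6], []), (10, [4, 2], [])]
      |>.step typed_coreOps (zigzag_right d o) [] [(18, [2], [3, 4]), (10, [0, 3], []),
        (10, [1, 4], [])]

theorem eta_cap (d : List ℕ) (o : List Mor) : (env d (coreOps ++ o)).Eqv [0] [(15, [], [1]),
  (10, [1, 0], [])] [(17, [0], [])] [] :=
  (Eqv.refl typed_coreOps)
      |>.step typed_coreOps (eta_def d o) [] [(11, [], [1, 2]), (17, [1], []), (10, [2, 0], [])]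
      |>.step typed_coreOps (zigzag_right d o) [] [(17, [0], [])]

theorem z_cap (d : List ℕ) (o : List Mor) : (env d (coreOps ++ o)).Eqv [0] [(23, [], [1]),
  (10, [1, 0], [])] [(19, [0], [])] [] :=
  (Eqv.refl typed_coreOps)
      |>.step typed_coreOps (z_def d o) [] [(11, [], [1, 2]), (19, [1], []), (10, [2, 0], [])]
      |>.step typed_coreOps (zigzag_right d o) [] [(19, [0], [])]

theorem delta_cap (d : List ℕ) (o : List Mor) : (env d (coreOps ++ o)).Eqv [0, 1, 2]
  [(16, [0], [3, 4]), (10, [3, 1], []), (10, [4, 2], [])] [(14, [1, 2], [3]), (10, [0, 3], [])] []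
  :=
  (Eqv.refl typed_coreOps)
      |>.step typed_coreOps (cap_comm d o) [(0, 2)] [(16, [0], [3, 4]), (10, [3, 1], []),
        (10, [2, 4], [])]
      |>.step typed_coreOps (cap_comm d o) [] [(16, [0], [3, 4]), (10, [2, 4], []),
        (10, [1, 3], [])]
      |>.step typed_coreOps (mu_cap d o).symm [] [(14, [1, 2], [3]), (10, [3, 0], [])]
      |>.step typed_coreOps (cap_comm d o) [] [(14, [1, 2], [3]), (10, [0, 3], [])]

theorem mu_comm (d : List ℕ) (o : List Mor) : (env d (coreOps ++ o)).Eqv [0, 1]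
  [(14, [1, 0], [2])] [(14, [0, 1], [2])] [2] :=
  (Eqv.refl typed_coreOps)
      |>.step typed_coreOps (mu_def d o) [] [(11, [], [3, 2]), (16, [3], [4, 5]),
        (10, [1, 4], []), (10, [0, 5], [])]
      |>.step typed_coreOps (delta_comm d o) [] [(11, [], [3, 2]), (16, [3], [4, 5]),
        (10, [1, 5], []), (10, [0, 4], [])]
      |>.step typed_coreOps (mu_def d o).symm [] [(14, [0, 1], [2])]

theorem w_comm (d : List ℕ) (o : List Mor) : (env d (coreOps ++ o)).Eqv [0, 1] [(20, [1, 0], [2])]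
  [(20, [0, 1], [2])] [2] :=
  (Eqv.refl typed_coreOps)
      |>.step typed_coreOps (w_def d o) [] [(11, [], [3, 2]), (18, [3], [4, 5]), (10, [1, 4], []),
        (10, [0, 5], [])]
      |>.step typed_coreOps (c_comm d o) [] [(11, [], [3, 2]), (18, [3], [4, 5]),
        (10, [1, 5], []), (10, [0, 4], [])]
      |>.step typed_coreOps (w_def d o).symm [] [(20, [0, 1], [2])]

theorem eps_delta (d : List ℕ) (o : List Mor) : (env d (coreOps ++ o)).Eqv [0] [(16, [0], [2, 1]),
  (17, [2], [])] [(0, [0], [1])] [1] :=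
  (Eqv.refl typed_coreOps)
      |>.step typed_coreOps (delta_comm d o) [] [(16, [0], [1, 2]), (17, [2], [])]
      |>.step typed_coreOps (delta_eps d o) [] [(0, [0], [1])]

theorem e_c (d : List ℕ) (o : List Mor) : (env d (coreOps ++ o)).Eqv [0] [(18, [0], [2, 1]),
  (19, [2], [])] [(0, [0], [1])] [1] :=
  (Eqv.refl typed_coreOps)
      |>.step typed_coreOps (c_comm d o) [] [(18, [0], [1, 2]), (19, [2], [])]
      |>.step typed_coreOps (c_e d o) [] [(0, [0], [1])]

theorem mu_eta (d : List ℕ) (o : List Mor) : (env d (coreOps ++ o)).Eqv [0] [(15, [], [2]),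
  (14, [0, 2], [1])] [(0, [0], [1])] [1] :=
  (Eqv.refl typed_coreOps)
      |>.step typed_coreOps (mu_def d o) [] [(15, [], [2]), (11, [], [3, 1]), (16, [3], [4, 5]),
        (10, [0, 4], []), (10, [2, 5], [])]
      |>.step typed_coreOps (eta_cap d o) [] [(11, [], [2, 1]), (16, [2], [3, 4]),
        (10, [0, 3], []), (17, [4], [])]
      |>.step typed_coreOps (delta_eps d o) [] [(11, [], [2, 1]), (10, [0, 2], [])]
      |>.step typed_coreOps (zigzag d o) [] [(0, [0], [1])]

theorem eta_mu (d : List ℕ) (o : List Mor) : (env d (coreOps ++ o)).Eqv [0] [(15, [], [2]),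
  (14, [2, 0], [1])] [(0, [0], [1])] [1] :=
  (Eqv.refl typed_coreOps)
      |>.step typed_coreOps (mu_comm d o) [] [(15, [], [2]), (14, [0, 2], [1])]
      |>.step typed_coreOps (mu_eta d o) [] [(0, [0], [1])]

theorem mu_assoc (d : List ℕ) (o : List Mor) : (env d (coreOps ++ o)).Eqv [0, 1, 2]
  [(14, [0, 1], [4]), (14, [4, 2], [3])] [(14, [1, 2], [4]), (14, [0, 4], [3])] [3] :=
  (Eqv.refl typed_coreOps)
      |>.unnorm typed_coreOps [(14, [0, 1], [4]), (14, [4, 2], [5]), (0, [5], [3])]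
      |>.step typed_coreOps (zigzag d o).symm [] [(14, [0, 1], [4]), (14, [4, 2], [5]),
        (11, [], [6, 3]), (10, [5, 6], [])]
      |>.step typed_coreOps (mu_cap d o) [(0, 4)] [(14, [0, 1], [4]), (11, [], [5, 3]),
        (16, [5], [6, 7]), (10, [4, 6], []), (10, [2, 7], [])]
      |>.step typed_coreOps (mu_cap d o) [] [(11, [], [4, 3]), (16, [4], [5, 6]),
        (10, [2, 6], []), (16, [5], [7, 8]), (10, [0, 7], []), (10, [1, 8], [])]
      |>.step typed_coreOps (delta_assoc d o) [] [(11, [], [4, 3]), (16, [4], [5, 6]),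
        (16, [6], [7, 8]), (10, [2, 8], []), (10, [0, 5], []), (10, [1, 7], [])]
      |>.step typed_coreOps (mu_cap d o).symm [(0, 1)] [(11, [], [4, 3]), (16, [4], [5, 6]),
        (10, [0, 5], []), (14, [1, 2], [7]), (10, [7, 6], [])]
      |>.step typed_coreOps (mu_cap d o).symm [] [(11, [], [4, 3]), (14, [1, 2], [5]),
        (14, [0, 5], [6]), (10, [6, 4], [])]
      |>.step typed_coreOps (zigzag d o) [] [(14, [1, 2], [4]), (14, [0, 4], [3])]

theorem s_c_left (d : List ℕ) (o : List Mor) : (env d (coreOps ++ o)).Eqv [0] [(13, [0], [3]),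
  (18, [3], [1, 2])] [(18, [0], [3, 2]), (13, [3], [1])] [1, 2] :=
  (Eqv.refl typed_coreOps)
      |>.step typed_coreOps (c_comm d o) [] [(13, [0], [3]), (18, [3], [2, 1])]
      |>.step typed_coreOps (s_c d o) [] [(18, [0], [2, 3]), (13, [3], [1])]
      |>.step typed_coreOps (c_comm d o) [] [(18, [0], [3, 2]), (13, [3], [1])]

/-- The symmetry of the ternary white vertex involves an S between cup and c. A pair of S is
inserted: one supplies this S, the other waits on an outer leg by the phase rule, and afterwards
they cancel. -/
theorem cup_c_swap (d : List ℕ) (o : List Mor) : (env d (coreOps ++ o)).Eqv [] [(11, [], [1, 3]),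
  (18, [3], [0, 2])] [(11, [], [0, 3]), (18, [3], [1, 2])] [0, 1, 2] :=
  (Eqv.refl typed_coreOps)
      |>.unnorm typed_coreOps [(11, [], [1, 3]), (0, [3], [4]), (18, [4], [0, 2])]
      |>.step typed_coreOps (s_s d o).symm [] [(11, [], [1, 3]), (13, [3], [4]), (13, [4], [5]),
        (18, [5], [0, 2])]
      |>.step typed_coreOps (s_c d o) [(0, 4)] [(11, [], [1, 3]), (13, [3], [4]),
        (18, [4], [0, 5]), (13, [5], [2])]
      |>.step typed_coreOps (cup_s_c d o) [] [(11, [], [0, 3]), (13, [3], [4]), (18, [4], [1, 5]),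
        (13, [5], [2])]
      |>.step typed_coreOps (s_c d o) [] [(11, [], [0, 3]), (18, [3], [1, 4]), (13, [4], [5]),
        (13, [5], [2])]
      |>.step typed_coreOps (s_s d o) [] [(11, [], [0, 3]), (18, [3], [1, 2])]

theorem cup_c (d : List ℕ) (o : List Mor) : (env d (coreOps ++ o)).Eqv [] [(11, [], [0, 3]),
  (18, [3], [1, 2])] [(11, [], [3, 2]), (18, [3], [0, 1])] [0, 1, 2] :=
  (Eqv.refl typed_coreOps)
      |>.step typed_coreOps (c_comm d o) [] [(11, [], [0, 3]), (18, [3], [2, 1])]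
      |>.step typed_coreOps (cup_c_swap d o) [] [(11, [], [2, 3]), (18, [3], [0, 1])]
      |>.step typed_coreOps (cup_comm d o) [] [(11, [], [3, 2]), (18, [3], [0, 1])]

theorem c_cap_right (d : List ℕ) (o : List Mor) : (env d (coreOps ++ o)).Eqv [0, 1]
  [(18, [1], [3, 2]), (10, [0, 3], [])] [(20, [0, 1], [2])] [2] :=
  (Eqv.refl typed_coreOps)
      |>.unnorm typed_coreOps [(0, [1], [4]), (18, [4], [3, 2]), (10, [0, 3], [])]
      |>.step typed_coreOps (zigzag d o).symm [] [(11, [], [3, 4]), (10, [1, 3], []),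
        (18, [4], [5, 2]), (10, [0, 5], [])]
      |>.step typed_coreOps (cup_c d o) [] [(11, [], [3, 2]), (18, [3], [4, 5]), (10, [1, 4], []),
        (10, [0, 5], [])]
      |>.step typed_coreOps (c_comm d o) [] [(11, [], [3, 2]), (18, [3], [4, 5]),
        (10, [1, 5], []), (10, [0, 4], [])]
      |>.step typed_coreOps (w_def d o).symm [] [(20, [0, 1], [2])]

theorem c_cap_left (d : List ℕ) (o : List Mor) : (env d (coreOps ++ o)).Eqv [0, 1]
  [(18, [0], [2, 3]), (10, [3, 1], [])] [(20, [0, 1], [2])] [2] :=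
  (Eqv.refl typed_coreOps)
      |>.step typed_coreOps (c_comm d o) [] [(18, [0], [3, 2]), (10, [3, 1], [])]
      |>.step typed_coreOps (cap_comm d o) [] [(18, [0], [3, 2]), (10, [1, 3], [])]
      |>.step typed_coreOps (c_cap_right d o) [] [(20, [1, 0], [2])]
      |>.step typed_coreOps (w_comm d o) [] [(20, [0, 1], [2])]

/-- Since all legs of a white vertex are interchangeable, w is c with one leg bent (`c_cap_left`),
and the Frobenius law becomes coassociativity. -/
theorem frobenius (d : List ℕ) (o : List Mor) : (env d (coreOps ++ o)).Eqv [0, 1]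
  [(18, [0], [2, 4]), (20, [4, 1], [3])] [(20, [0, 1], [4]), (18, [4], [2, 3])] [2, 3] :=
  (Eqv.refl typed_coreOps)
      |>.step typed_coreOps (c_cap_left d o).symm [] [(18, [0], [2, 4]), (18, [4], [3, 5]),
        (10, [5, 1], [])]
      |>.step typed_coreOps (c_assoc d o).symm [] [(18, [0], [4, 5]), (18, [4], [2, 3]),
        (10, [5, 1], [])]
      |>.step typed_coreOps (c_cap_left d o) [] [(20, [0, 1], [4]), (18, [4], [2, 3])]

/-- The white trace rule with its free leg bent into an input; the S in the rule is supplied by a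
pair that cancels at the end. -/
theorem c_loop (d : List ℕ) (o : List Mor) : (env d (coreOps ++ o)).Eqv [0] [(18, [0], [1, 2]),
  (10, [1, 2], [])] [(19, [0], [])] [] :=
  (Eqv.refl typed_coreOps)
      |>.unnorm typed_coreOps [(0, [0], [3]), (18, [3], [1, 2]), (10, [1, 2], [])]
      |>.step typed_coreOps (s_s d o).symm [] [(13, [0], [1]), (13, [1], [2]), (18, [2], [3, 4]),
        (10, [3, 4], [])]
      |>.unnorm typed_coreOps [(13, [0], [1]), (0, [1], [5]), (13, [5], [2]), (18, [2], [3, 4]),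
        (10, [3, 4], [])]
      |>.step typed_coreOps (zigzag d o).symm [] [(13, [0], [1]), (11, [], [2, 3]),
        (10, [1, 2], []), (13, [3], [4]), (18, [4], [5, 6]), (10, [5, 6], [])]
      |>.step typed_coreOps (cap_comm d o) [] [(13, [0], [1]), (11, [], [2, 3]), (13, [3], [4]),
        (18, [4], [5, 6]), (10, [5, 6], []), (10, [2, 1], [])]
      |>.step typed_coreOps (s_cap d o).symm [] [(11, [], [1, 2]), (13, [2], [3]),
        (18, [3], [4, 5]), (10, [4, 5], []), (13, [1], [6]), (10, [6, 0], [])]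
      |>.step typed_coreOps (cup_s_c_cap d o) [] [(23, [], [1]), (13, [1], [2]), (13, [2], [3]),
        (10, [3, 0], [])]
      |>.step typed_coreOps (s_s d o) [] [(23, [], [1]), (10, [1, 0], [])]
      |>.step typed_coreOps (z_cap d o) [] [(19, [0], [])]

/-! ### Consequences of the bialgebra rules -/

/-- The trivial scalar η followed by ε is inserted; the two units then fuse into c after η, and the
counit laws finish. -/
theorem eta_e (d : List ℕ) (o : List Mor) : (env d (coreOps ++ o)).Eqv [] [(15, [], [0]),
  (19, [0], [])] [] [] :=
  (Eqv.refl typed_coreOps)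
      |>.step typed_coreOps (eta_eps d o).symm [] [(15, [], [0]), (19, [0], []), (15, [], [1]),
        (17, [1], [])]
      |>.step typed_coreOps (eta_c d o).symm [] [(15, [], [0]), (18, [0], [1, 2]), (19, [1], []),
        (17, [2], [])]
      |>.step typed_coreOps (e_c d o) [] [(15, [], [0]), (17, [0], [])]
      |>.step typed_coreOps (eta_eps d o) [] []
theorem cup_w (d : List ℕ) (o : List Mor) : (env d (coreOps ++ o)).Eqv [0] [(11, [], [3, 2]),
  (20, [0, 3], [1])] [(18, [0], [1, 2])] [1, 2] :=
  (Eqv.refl typed_coreOps)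
      |>.step typed_coreOps (c_cap_left d o).symm [] [(11, [], [3, 2]), (18, [0], [1, 4]),
        (10, [4, 3], [])]
      |>.step typed_coreOps (zigzag d o) [] [(18, [0], [1, 2])]

/-- Bialgebra II (`mu_c`) with one leg of each white vertex bent; bending turns one of the two
multiplications into δ. -/
theorem w_mu (d : List ℕ) (o : List Mor) : (env d (coreOps ++ o)).Eqv [0, 1, 2]
  [(14, [1, 2], [4]), (20, [0, 4], [3])] [(16, [0], [4, 5]), (20, [4, 1], [6]), (20, [5, 2], [7]),
  (14, [6, 7], [3])] [3] :=
  (Eqv.refl typed_coreOps)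
      |>.step typed_coreOps (c_cap_right d o).symm [] [(14, [1, 2], [4]), (18, [4], [5, 3]),
        (10, [0, 5], [])]
      |>.step typed_coreOps (mu_c d o) [] [(18, [1], [4, 5]), (18, [2], [6, 7]),
        (14, [4, 6], [8]), (14, [5, 7], [3]), (10, [0, 8], [])]
      |>.step typed_coreOps (cap_comm d o) [] [(18, [1], [4, 5]), (18, [2], [6, 7]),
        (14, [4, 6], [8]), (14, [5, 7], [3]), (10, [8, 0], [])]
      |>.step typed_coreOps (mu_cap d o) [] [(18, [1], [4, 5]), (18, [2], [6, 7]),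
        (14, [5, 7], [3]), (16, [0], [8, 9]), (10, [4, 8], []), (10, [6, 9], [])]
      |>.step typed_coreOps (cap_comm d o) [] [(18, [1], [4, 5]), (18, [2], [6, 7]),
        (14, [5, 7], [3]), (16, [0], [8, 9]), (10, [6, 9], []), (10, [8, 4], [])]
      |>.step typed_coreOps (c_cap_right d o) [] [(18, [2], [4, 5]), (16, [0], [6, 7]),
        (10, [4, 7], []), (20, [6, 1], [8]), (14, [8, 5], [3])]
      |>.step typed_coreOps (cap_comm d o) [] [(18, [2], [4, 5]), (16, [0], [6, 7]),
        (20, [6, 1], [8]), (14, [8, 5], [3]), (10, [7, 4], [])]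
      |>.step typed_coreOps (c_cap_right d o) [] [(16, [0], [4, 5]), (20, [4, 1], [6]),
        (20, [5, 2], [7]), (14, [6, 7], [3])]

/-- A rotation of `w_mu`. This is the basic distributive law: under convolution, tensoring with a
single wire commutes with sums. -/
theorem c_delta (d : List ℕ) (o : List Mor) : (env d (coreOps ++ o)).Eqv [0] [(18, [0], [1, 4]),
  (16, [4], [2, 3])] [(16, [0], [4, 5]), (18, [4], [6, 2]), (18, [5], [7, 3]), (14, [6, 7], [1])]
  [1, 2, 3] :=
  (Eqv.refl typed_coreOps)
      |>.unnorm typed_coreOps [(18, [0], [1, 4]), (16, [4], [5, 3]), (0, [5], [2])]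
      |>.step typed_coreOps (zigzag d o).symm [] [(18, [0], [1, 4]), (16, [4], [5, 3]),
        (11, [], [6, 2]), (10, [5, 6], [])]
      |>.unnorm typed_coreOps [(18, [0], [1, 4]), (16, [4], [5, 7]), (11, [], [6, 2]),
        (10, [5, 6], []), (0, [7], [3])]
      |>.step typed_coreOps (zigzag d o).symm [] [(18, [0], [1, 4]), (16, [4], [5, 6]),
        (11, [], [7, 2]), (10, [5, 7], []), (11, [], [8, 3]), (10, [6, 8], [])]
      |>.step typed_coreOps (delta_cap d o) [] [(18, [0], [1, 4]), (11, [], [5, 2]),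
        (11, [], [6, 3]), (14, [5, 6], [7]), (10, [4, 7], [])]
      |>.step typed_coreOps (c_cap_left d o) [] [(11, [], [4, 2]), (11, [], [5, 3]),
        (14, [4, 5], [6]), (20, [0, 6], [1])]
      |>.step typed_coreOps (w_mu d o) [] [(11, [], [4, 2]), (11, [], [5, 3]), (16, [0], [6, 7]),
        (20, [6, 4], [8]), (20, [7, 5], [9]), (14, [8, 9], [1])]
      |>.step typed_coreOps (cup_w d o) [(0, 7)] [(11, [], [4, 2]), (16, [0], [5, 6]),
        (20, [5, 4], [7]), (18, [6], [8, 3]), (14, [7, 8], [1])]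
      |>.step typed_coreOps (cup_w d o) [] [(16, [0], [4, 5]), (18, [4], [6, 2]),
        (18, [5], [7, 3]), (14, [6, 7], [1])]

theorem w_eta (d : List ℕ) (o : List Mor) : (env d (coreOps ++ o)).Eqv [0] [(15, [], [2]),
  (20, [0, 2], [1])] [(17, [0], []), (15, [], [1])] [1] :=
  (Eqv.refl typed_coreOps)
      |>.step typed_coreOps (c_cap_right d o).symm [] [(15, [], [2]), (18, [2], [3, 1]),
        (10, [0, 3], [])]
      |>.step typed_coreOps (eta_c d o) [] [(15, [], [2]), (15, [], [1]), (10, [0, 2], [])]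
      |>.step typed_coreOps (cap_comm d o) [] [(15, [], [2]), (15, [], [1]), (10, [2, 0], [])]
      |>.step typed_coreOps (eta_cap d o) [] [(17, [0], []), (15, [], [1])]

theorem c_eps (d : List ℕ) (o : List Mor) : (env d (coreOps ++ o)).Eqv [0] [(18, [0], [1, 2]),
  (17, [2], [])] [(17, [0], []), (15, [], [1])] [1] :=
  (Eqv.refl typed_coreOps)
      |>.step typed_coreOps (eta_cap d o).symm [] [(18, [0], [1, 2]), (15, [], [3]),
        (10, [3, 2], [])]
      |>.step typed_coreOps (cap_comm d o) [] [(18, [0], [1, 2]), (15, [], [3]), (10, [2, 3], [])]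
      |>.step typed_coreOps (c_cap_left d o) [] [(15, [], [2]), (20, [0, 2], [1])]
      |>.step typed_coreOps (w_eta d o) [] [(17, [0], []), (15, [], [1])]

theorem eps_c (d : List ℕ) (o : List Mor) : (env d (coreOps ++ o)).Eqv [0] [(18, [0], [2, 1]),
  (17, [2], [])] [(17, [0], []), (15, [], [1])] [1] :=
  (Eqv.refl typed_coreOps)
      |>.step typed_coreOps (c_comm d o) [] [(18, [0], [1, 2]), (17, [2], [])]
      |>.step typed_coreOps (c_eps d o) [] [(17, [0], []), (15, [], [1])]

/-- Transpose of Loop II. -/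
theorem delta_w (d : List ℕ) (o : List Mor) : (env d (coreOps ++ o)).Eqv [0] [(16, [0], [2, 3]),
  (20, [2, 3], [1])] [(17, [0], []), (15, [], [1])] [1] :=
  (Eqv.refl typed_coreOps)
      |>.unnorm typed_coreOps [(16, [0], [2, 3]), (20, [2, 3], [4]), (0, [4], [1])]
      |>.step typed_coreOps (zigzag d o).symm [] [(16, [0], [2, 3]), (20, [2, 3], [4]),
        (11, [], [5, 1]), (10, [4, 5], [])]
      |>.step typed_coreOps (w_cap d o) [] [(16, [0], [2, 3]), (11, [], [4, 1]),
        (18, [4], [5, 6]), (10, [2, 5], []), (10, [3, 6], [])]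
      |>.step typed_coreOps (delta_cap d o) [] [(11, [], [2, 1]), (18, [2], [3, 4]),
        (14, [3, 4], [5]), (10, [0, 5], [])]
      |>.step typed_coreOps (c_mu d o) [] [(11, [], [2, 1]), (17, [2], []), (15, [], [3]),
        (10, [0, 3], [])]
      |>.step typed_coreOps (cap_comm d o) [] [(11, [], [2, 1]), (17, [2], []), (15, [], [3]),
        (10, [3, 0], [])]
      |>.step typed_coreOps (eta_def d o).symm [] [(15, [], [2]), (10, [2, 0], []), (15, [], [1])]
      |>.step typed_coreOps (eta_cap d o) [] [(17, [0], []), (15, [], [1])]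

/-- At most one of the two branches of δ carries |1⟩, so copies of both cannot agree under the cap
unless the input is |0⟩. Formally, the Frobenius law merges the joined white vertices, and `delta_w`
applies. -/
theorem cut (d : List ℕ) (o : List Mor) : (env d (coreOps ++ o)).Eqv [0] [(16, [0], [3, 4]),
  (18, [3], [1, 5]), (18, [4], [6, 2]), (10, [5, 6], [])] [(17, [0], []), (15, [], [1]),
  (15, [], [2])] [1, 2] :=
  (Eqv.refl typed_coreOps)
      |>.step typed_coreOps (c_cap_right d o) [(0, 5)] [(16, [0], [3, 4]), (18, [3], [1, 5]),
        (20, [5, 4], [2])]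
      |>.step typed_coreOps (frobenius d o) [] [(16, [0], [3, 4]), (20, [3, 4], [5]),
        (18, [5], [1, 2])]
      |>.step typed_coreOps (delta_w d o) [] [(17, [0], []), (15, [], [3]), (18, [3], [1, 2])]
      |>.step typed_coreOps (eta_c d o) [] [(17, [0], []), (15, [], [1]), (15, [], [2])]

/-! ### Elimination of the crossing -/

theorem delta_s_mu_left (d : List ℕ) (o : List Mor) : (env d (coreOps ++ o)).Eqv [0]
  [(16, [0], [2, 3]), (13, [2], [4]), (14, [4, 3], [1])] [(17, [0], []), (15, [], [1])] [1] :=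
  (Eqv.refl typed_coreOps)
      |>.step typed_coreOps (mu_comm d o) [] [(16, [0], [2, 3]), (13, [2], [4]),
        (14, [3, 4], [1])]
      |>.step typed_coreOps (delta_comm d o) [] [(16, [0], [2, 3]), (13, [3], [4]),
        (14, [2, 4], [1])]
      |>.step typed_coreOps (delta_s_mu d o) [] [(17, [0], []), (15, [], [1])]

/-- Solving Bialgebra I for the crossing, as in a Hopf algebra. Expanding μ followed by δ in the
middle produces the crossing with one extra wire on each side. By coassociativity and associativity
each extra wire is convolved with an S, and Loop I reduces this to ε and η, which are absorbed. -/
theorem cross_eq (d : List ℕ) (o : List Mor) : (env d (coreOps ++ o)).Eqv [0, 1]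
  [(16, [0], [4, 5]), (16, [1], [6, 7]), (14, [5, 6], [8]), (16, [8], [9, 10]), (13, [4], [11]),
  (13, [7], [12]), (14, [11, 9], [2]), (14, [10, 12], [3])] [(21, [0, 1], [2, 3])] [2, 3] :=
  (Eqv.refl typed_coreOps)
      |>.step typed_coreOps (mu_delta d o) [] [(16, [0], [4, 5]), (16, [1], [6, 7]),
        (13, [4], [8]), (13, [7], [9]), (16, [5], [10, 11]), (16, [6], [12, 13]),
        (21, [11, 12], [14, 15]), (14, [10, 14], [16]), (14, [15, 13], [17]), (14, [8, 16], [2]),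
        (14, [17, 9], [3])]
      |>.step typed_coreOps (delta_assoc d o) [(0, 1)] [(16, [0], [4, 5]), (13, [4], [6]),
        (16, [5], [7, 8]), (16, [1], [9, 10]), (16, [10], [11, 12]), (13, [12], [13]),
        (21, [8, 9], [14, 15]), (14, [7, 14], [16]), (14, [15, 11], [17]), (14, [6, 16], [2]),
        (14, [17, 13], [3])]
      |>.step typed_coreOps (delta_assoc d o).symm [] [(16, [1], [4, 5]), (16, [5], [6, 7]),
        (13, [7], [8]), (16, [0], [9, 10]), (16, [9], [11, 12]), (13, [11], [13]),
        (21, [10, 4], [14, 15]), (14, [12, 14], [16]), (14, [15, 6], [17]), (14, [13, 16], [2]),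
        (14, [17, 8], [3])]
      |>.step typed_coreOps (mu_assoc d o).symm [] [(16, [1], [4, 5]), (16, [5], [6, 7]),
        (13, [7], [8]), (16, [0], [9, 10]), (16, [9], [11, 12]), (13, [11], [13]),
        (21, [10, 4], [14, 15]), (14, [15, 6], [16]), (14, [16, 8], [3]), (14, [13, 12], [17]),
        (14, [17, 14], [2])]
      |>.step typed_coreOps (mu_assoc d o) [] [(16, [1], [4, 5]), (16, [5], [6, 7]),
        (13, [7], [8]), (16, [0], [9, 10]), (16, [9], [11, 12]), (13, [11], [13]),
        (21, [10, 4], [14, 15]), (14, [13, 12], [16]), (14, [16, 14], [2]), (14, [6, 8], [17]),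
        (14, [15, 17], [3])]
      |>.step typed_coreOps (delta_s_mu d o) [(0, 5)] [(16, [1], [4, 5]), (16, [0], [6, 7]),
        (16, [6], [8, 9]), (13, [8], [10]), (21, [7, 4], [11, 12]), (14, [10, 9], [13]),
        (14, [13, 11], [2]), (17, [5], []), (15, [], [14]), (14, [12, 14], [3])]
      |>.step typed_coreOps (delta_s_mu_left d o) [(0, 6)] [(16, [1], [4, 5]), (16, [0], [6, 7]),
        (21, [7, 4], [8, 9]), (17, [5], []), (15, [], [10]), (14, [9, 10], [3]), (17, [6], []),
        (15, [], [11]), (14, [11, 8], [2])]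
      |>.step typed_coreOps (eps_delta d o) [(0, 0)] [(16, [1], [4, 5]), (17, [5], []),
        (15, [], [6]), (15, [], [7]), (21, [0, 4], [8, 9]), (14, [9, 6], [3]), (14, [7, 8], [2])]
      |>.step typed_coreOps (delta_eps d o) [] [(15, [], [4]), (15, [], [5]),
        (21, [0, 1], [6, 7]), (14, [7, 4], [3]), (14, [5, 6], [2])]
      |>.step typed_coreOps (eta_mu d o) [(0, 6)] [(15, [], [4]), (21, [0, 1], [2, 5]),
        (14, [5, 4], [3])]
      |>.step typed_coreOps (mu_eta d o) [] [(21, [0, 1], [2, 3])]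

theorem s_w (d : List ℕ) (o : List Mor) : (env d (coreOps ++ o)).Eqv [0, 1] [(13, [0], [3]),
  (20, [3, 1], [2])] [(20, [0, 1], [3]), (13, [3], [2])] [2] :=
  (Eqv.refl typed_coreOps)
      |>.step typed_coreOps (c_cap_left d o).symm [] [(13, [0], [3]), (18, [3], [2, 4]),
        (10, [4, 1], [])]
      |>.step typed_coreOps (s_c_left d o) [] [(18, [0], [3, 4]), (13, [3], [2]),
        (10, [4, 1], [])]
      |>.step typed_coreOps (c_cap_left d o) [] [(20, [0, 1], [3]), (13, [3], [2])]

/-- The elimination rule without negations and signs: pairs XX and SS are inserted on the inputs,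
one of each pair completes the pattern of the rule (S moves through w), and the leftovers cancel. -/
theorem elim_w (d : List ℕ) (o : List Mor) : (env d (coreOps ++ o)).Eqv [0, 1, 2]
  [(16, [1], [5, 6]), (20, [0, 5], [7]), (20, [6, 2], [8]), (21, [7, 8], [3, 4])]
  [(16, [1], [5, 6]), (20, [0, 5], [4]), (20, [6, 2], [3])] [3, 4] :=
  (Eqv.refl typed_coreOps)
      |>.unnorm typed_coreOps [(0, [1], [9]), (16, [9], [5, 6]), (20, [0, 5], [7]),
        (20, [6, 2], [8]), (21, [7, 8], [3, 4])]
      |>.step typed_coreOps (x_x d o).symm [] [(12, [1], [5]), (12, [5], [6]), (16, [6], [7, 8]),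
        (20, [0, 7], [9]), (20, [8, 2], [10]), (21, [9, 10], [3, 4])]
      |>.unnorm typed_coreOps [(12, [1], [5]), (12, [5], [6]), (16, [6], [7, 8]),
        (20, [8, 2], [10]), (0, [0], [11]), (20, [11, 7], [9]), (21, [9, 10], [3, 4])]
      |>.step typed_coreOps (s_s d o).symm [] [(12, [1], [5]), (12, [5], [6]), (16, [6], [7, 8]),
        (20, [8, 2], [9]), (13, [0], [10]), (13, [10], [11]), (20, [11, 7], [12]),
        (21, [12, 9], [3, 4])]
      |>.unnorm typed_coreOps [(12, [1], [5]), (12, [5], [6]), (16, [6], [7, 8]), (13, [0], [10]),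
        (13, [10], [11]), (20, [11, 7], [12]), (0, [2], [13]), (20, [8, 13], [9]),
        (21, [12, 9], [3, 4])]
      |>.step typed_coreOps (s_s d o).symm [] [(12, [1], [5]), (12, [5], [6]), (16, [6], [7, 8]),
        (13, [0], [9]), (13, [9], [10]), (20, [10, 7], [11]), (13, [2], [12]), (13, [12], [13]),
        (20, [8, 13], [14]), (21, [11, 14], [3, 4])]
      |>.step typed_coreOps (w_comm d o) [(0, 13)] [(12, [1], [5]), (12, [5], [6]),
        (16, [6], [7, 8]), (13, [0], [9]), (13, [9], [10]), (20, [10, 7], [11]), (13, [2], [12]),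
        (13, [12], [13]), (20, [13, 8], [14]), (21, [11, 14], [3, 4])]
      |>.step typed_coreOps (s_w d o) [(0, 12)] [(12, [1], [5]), (12, [5], [6]),
        (16, [6], [7, 8]), (13, [0], [9]), (13, [9], [10]), (20, [10, 7], [11]), (13, [2], [12]),
        (20, [12, 8], [13]), (13, [13], [14]), (21, [11, 14], [3, 4])]
      |>.step typed_coreOps (w_comm d o) [(0, 8)] [(12, [1], [5]), (12, [5], [6]),
        (16, [6], [7, 8]), (13, [0], [9]), (13, [9], [10]), (20, [10, 7], [11]), (13, [2], [12]),
        (20, [8, 12], [13]), (13, [13], [14]), (21, [11, 14], [3, 4])]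
      |>.step typed_coreOps (s_w d o) [(0, 9)] [(12, [1], [5]), (12, [5], [6]), (16, [6], [7, 8]),
        (13, [0], [9]), (13, [2], [10]), (20, [8, 10], [11]), (13, [11], [12]),
        (20, [9, 7], [13]), (13, [13], [14]), (21, [14, 12], [3, 4])]
      |>.step typed_coreOps (elim_x d o) [(0, 9)] [(12, [1], [5]), (13, [0], [6]), (13, [2], [7]),
        (12, [5], [8]), (16, [8], [9, 10]), (20, [6, 9], [11]), (13, [11], [4]),
        (20, [10, 7], [12]), (13, [12], [3])]
      |>.step typed_coreOps (x_x d o) [] [(13, [0], [5]), (13, [2], [6]), (16, [1], [7, 8]),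
        (20, [5, 7], [9]), (13, [9], [4]), (20, [8, 6], [10]), (13, [10], [3])]
      |>.step typed_coreOps (s_w d o) [] [(13, [2], [5]), (16, [1], [6, 7]), (20, [7, 5], [8]),
        (13, [8], [3]), (20, [0, 6], [9]), (13, [9], [10]), (13, [10], [4])]
      |>.step typed_coreOps (s_s d o) [(0, 9)] [(13, [2], [5]), (16, [1], [6, 7]),
        (20, [7, 5], [8]), (13, [8], [3]), (20, [0, 6], [4])]
      |>.step typed_coreOps (w_comm d o) [] [(13, [2], [5]), (16, [1], [6, 7]), (20, [0, 6], [4]),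
        (20, [5, 7], [8]), (13, [8], [3])]
      |>.step typed_coreOps (s_w d o).symm [(0, 5)] [(13, [2], [5]), (16, [1], [6, 7]),
        (20, [0, 6], [4]), (13, [5], [8]), (20, [8, 7], [3])]
      |>.step typed_coreOps (w_comm d o) [(0, 7)] [(13, [2], [5]), (16, [1], [6, 7]),
        (20, [0, 6], [4]), (13, [5], [8]), (20, [7, 8], [3])]
      |>.step typed_coreOps (s_s d o) [] [(16, [1], [5, 6]), (20, [0, 5], [4]), (20, [6, 2], [3])]

/-- The outer inputs of `elim_w` bent into outputs, which turns w into c by `cup_w`. -/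
theorem elim (d : List ℕ) (o : List Mor) : (env d (coreOps ++ o)).Eqv [0] [(16, [0], [5, 6]),
  (18, [5], [1, 7]), (18, [6], [8, 4]), (21, [7, 8], [2, 3])] [(16, [0], [5, 6]),
  (18, [5], [1, 3]), (18, [6], [2, 4])] [1, 2, 3, 4] :=
  (Eqv.refl typed_coreOps)
      |>.step typed_coreOps (cup_w d o).symm [(0, 6)] [(16, [0], [5, 6]), (18, [5], [1, 7]),
        (11, [], [8, 4]), (20, [6, 8], [9]), (21, [7, 9], [2, 3])]
      |>.step typed_coreOps (c_comm d o) [] [(16, [0], [5, 6]), (11, [], [7, 4]),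
        (20, [6, 7], [8]), (18, [5], [9, 1]), (21, [9, 8], [2, 3])]
      |>.step typed_coreOps (cup_w d o).symm [] [(16, [0], [5, 6]), (11, [], [7, 4]),
        (20, [6, 7], [8]), (11, [], [9, 1]), (20, [5, 9], [10]), (21, [10, 8], [2, 3])]
      |>.step typed_coreOps (cup_comm d o) [(1, 9)] [(16, [0], [5, 6]), (11, [], [7, 4]),
        (20, [6, 7], [8]), (11, [], [1, 9]), (20, [5, 9], [10]), (21, [10, 8], [2, 3])]
      |>.step typed_coreOps (w_comm d o) [(0, 9)] [(16, [0], [5, 6]), (11, [], [7, 4]),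
        (20, [6, 7], [8]), (11, [], [1, 9]), (20, [9, 5], [10]), (21, [10, 8], [2, 3])]
      |>.step typed_coreOps (elim_w d o) [] [(11, [], [5, 4]), (11, [], [1, 6]),
        (16, [0], [7, 8]), (20, [6, 7], [3]), (20, [8, 5], [2])]
      |>.step typed_coreOps (w_comm d o) [] [(11, [], [5, 4]), (11, [], [1, 6]),
        (16, [0], [7, 8]), (20, [8, 5], [2]), (20, [7, 6], [3])]
      |>.step typed_coreOps (cup_comm d o) [(1, 1)] [(11, [], [5, 4]), (16, [0], [6, 7]),
        (20, [7, 5], [2]), (11, [], [8, 1]), (20, [6, 8], [3])]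
      |>.step typed_coreOps (cup_w d o) [(0, 6)] [(11, [], [5, 4]), (16, [0], [6, 7]),
        (20, [7, 5], [2]), (18, [6], [3, 1])]
      |>.step typed_coreOps (c_comm d o) [] [(11, [], [5, 4]), (16, [0], [6, 7]),
        (20, [7, 5], [2]), (18, [6], [1, 3])]
      |>.step typed_coreOps (cup_w d o) [] [(16, [0], [5, 6]), (18, [5], [1, 3]),
        (18, [6], [2, 4])]

/-! ### Compatibility of tensor products with sums -/

theorem c_delta_left (d : List ℕ) (o : List Mor) : (env d (coreOps ++ o)).Eqv [0]
  [(18, [0], [4, 3]), (16, [4], [1, 2])] [(16, [0], [4, 5]), (18, [4], [1, 6]), (18, [5], [2, 7]),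
  (14, [6, 7], [3])] [1, 2, 3] :=
  (Eqv.refl typed_coreOps)
      |>.step typed_coreOps (c_comm d o) [] [(18, [0], [3, 4]), (16, [4], [1, 2])]
      |>.step typed_coreOps (c_delta d o) [] [(16, [0], [4, 5]), (18, [4], [6, 1]),
        (18, [5], [7, 2]), (14, [6, 7], [3])]
      |>.step typed_coreOps (c_comm d o) [(0, 5)] [(16, [0], [4, 5]), (18, [4], [6, 1]),
        (18, [5], [2, 7]), (14, [6, 7], [3])]
      |>.step typed_coreOps (c_comm d o) [] [(16, [0], [4, 5]), (18, [4], [1, 6]),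
        (18, [5], [2, 7]), (14, [6, 7], [3])]

/-- Distributing c over the second δ by `c_delta` leaves a μ followed by a δ on the first side, and
Bialgebra I creates a crossing there. Distributing over the remaining δ exhibits the two crossing
wires as legs of white vertices above a common δ, so `elim` replaces the crossing by a braiding, and
the δ are reassembled. This is the only place that uses the elimination rule. -/
theorem c_delta_delta (d : List ℕ) (o : List Mor) : (env d (coreOps ++ o)).Eqv [0]
  [(18, [0], [5, 6]), (16, [5], [1, 2]), (16, [6], [3, 4])] [(16, [0], [5, 6]), (18, [5], [7, 3]),
  (18, [6], [8, 4]), (16, [7], [9, 10]), (16, [8], [11, 12]), (14, [9, 11], [1]),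
  (14, [10, 12], [2])] [1, 2, 3, 4] :=
  (Eqv.refl typed_coreOps)
      |>.step typed_coreOps (c_delta d o) [] [(16, [0], [5, 6]), (18, [5], [7, 3]),
        (18, [6], [8, 4]), (14, [7, 8], [9]), (16, [9], [1, 2])]
      |>.step typed_coreOps (mu_delta d o) [] [(16, [0], [5, 6]), (18, [5], [7, 3]),
        (18, [6], [8, 4]), (16, [7], [9, 10]), (16, [8], [11, 12]), (21, [10, 11], [13, 14]),
        (14, [9, 13], [1]), (14, [14, 12], [2])]
      |>.step typed_coreOps (c_delta_left d o) [(0, 6)] [(16, [0], [5, 6]), (18, [5], [7, 3]),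
        (16, [7], [8, 9]), (16, [6], [10, 11]), (18, [10], [12, 13]), (18, [11], [14, 15]),
        (14, [13, 15], [4]), (21, [9, 12], [16, 17]), (14, [8, 16], [1]), (14, [17, 14], [2])]
      |>.step typed_coreOps (c_delta_left d o) [] [(16, [0], [5, 6]), (16, [6], [7, 8]),
        (18, [7], [9, 10]), (18, [8], [11, 12]), (14, [10, 12], [4]), (16, [5], [13, 14]),
        (18, [13], [15, 16]), (18, [14], [17, 18]), (14, [16, 18], [3]), (21, [17, 9], [19, 20]),
        (14, [15, 19], [1]), (14, [20, 11], [2])]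
      |>.step typed_coreOps (delta_assoc d o) [] [(16, [0], [5, 6]), (16, [6], [7, 8]),
        (16, [8], [9, 10]), (18, [9], [11, 12]), (18, [10], [13, 14]), (14, [12, 14], [4]),
        (18, [5], [15, 16]), (18, [7], [17, 18]), (14, [16, 18], [3]), (21, [17, 11], [19, 20]),
        (14, [15, 19], [1]), (14, [20, 13], [2])]
      |>.step typed_coreOps (delta_assoc d o).symm [(0, 6)] [(16, [0], [5, 6]), (18, [5], [7, 8]),
        (16, [6], [9, 10]), (16, [9], [11, 12]), (18, [12], [13, 14]), (18, [10], [15, 16]),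
        (14, [14, 16], [4]), (18, [11], [17, 18]), (14, [8, 18], [3]), (21, [17, 13], [19, 20]),
        (14, [7, 19], [1]), (14, [20, 15], [2])]
      |>.step typed_coreOps (c_comm d o) [(0, 11)] [(16, [0], [5, 6]), (18, [5], [7, 8]),
        (16, [6], [9, 10]), (16, [9], [11, 12]), (18, [12], [13, 14]), (18, [10], [15, 16]),
        (14, [14, 16], [4]), (18, [11], [17, 18]), (14, [8, 17], [3]), (21, [18, 13], [19, 20]),
        (14, [7, 19], [1]), (14, [20, 15], [2])]
      |>.step typed_coreOps (elim d o) [(0, 9)] [(16, [0], [5, 6]), (18, [5], [7, 8]),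
        (16, [6], [9, 10]), (18, [10], [11, 12]), (16, [9], [13, 14]), (18, [13], [15, 16]),
        (18, [14], [17, 18]), (14, [18, 12], [4]), (14, [8, 15], [3]), (14, [7, 17], [1]),
        (14, [16, 11], [2])]
      |>.step typed_coreOps (c_comm d o) [(0, 13)] [(16, [0], [5, 6]), (18, [5], [7, 8]),
        (16, [6], [9, 10]), (18, [10], [11, 12]), (16, [9], [13, 14]), (18, [14], [15, 16]),
        (14, [16, 12], [4]), (14, [7, 15], [1]), (18, [13], [17, 18]), (14, [8, 18], [3]),
        (14, [17, 11], [2])]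
      |>.step typed_coreOps (delta_assoc d o) [(0, 6)] [(16, [0], [5, 6]), (18, [5], [7, 8]),
        (16, [6], [9, 10]), (16, [10], [11, 12]), (18, [12], [13, 14]), (18, [11], [15, 16]),
        (14, [16, 14], [4]), (14, [7, 15], [1]), (18, [9], [17, 18]), (14, [8, 18], [3]),
        (14, [17, 13], [2])]
      |>.step typed_coreOps (delta_assoc d o).symm [] [(16, [0], [5, 6]), (16, [5], [7, 8]),
        (18, [7], [9, 10]), (16, [6], [11, 12]), (18, [12], [13, 14]), (18, [11], [15, 16]),
        (14, [16, 14], [4]), (14, [9, 15], [1]), (18, [8], [17, 18]), (14, [10, 18], [3]),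
        (14, [17, 13], [2])]
      |>.step typed_coreOps (c_delta_left d o).symm [(0, 6)] [(16, [0], [5, 6]),
        (16, [5], [7, 8]), (18, [7], [9, 10]), (18, [8], [11, 12]), (14, [10, 12], [3]),
        (18, [6], [13, 4]), (16, [13], [14, 15]), (14, [9, 14], [1]), (14, [11, 15], [2])]
      |>.step typed_coreOps (c_delta_left d o).symm [(0, 5)] [(16, [0], [5, 6]),
        (18, [5], [7, 3]), (18, [6], [8, 4]), (16, [7], [9, 10]), (16, [8], [11, 12]),
        (14, [9, 11], [1]), (14, [10, 12], [2])]

/-! ### Bundles of black vertices -/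

/-- The black multiplication on bundles of `n` wires. -/
def muB : ℕ → Mor
  | 0 => 1
  | n + 1 => (wr n * br 1 n * wr 1) ⟫ (muB n * bmul 2)

/-- The unit of `muB`. -/
def etaB : ℕ → Mor
  | 0 => 1
  | n + 1 => etaB n * bmul 0

@[simp] theorem muB_dom (n : ℕ) : (muB n).dom = n + n := by
  cases n with
  | zero => rfl
  | succ n => simp [muB]; omega

@[simp] theorem muB_cod (n : ℕ) : (muB n).cod = n := by
  induction n with
  | zero => rfl
  | succ n ih => simp [muB, ih]

@[simp] theorem etaB_dom (n : ℕ) : (etaB n).dom = 0 := by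
  induction n with
  | zero => rfl
  | succ n ih => simp [etaB, ih]

@[simp] theorem etaB_cod (n : ℕ) : (etaB n).cod = n := by
  induction n with
  | zero => rfl
  | succ n ih => simp [etaB, ih]

theorem muB_assoc (n : ℕ) : (muB n * wr n) ⟫ muB n = (wr n * muB n) ⟫ muB n := by
  induction n with
  | zero => simp [muB, wr_zero]
  | succ n ih =>
    have hσ : (env [n] (coreOps ++ [muB n])).Typed (sig (coreSig ++ [([1, 1], [1])])) :=
      typed_core (by simp [dims_cons, dims_nil, dim_env])
    have h := eqv hσ (sym 24 * ids [1] ⊳ sym 24) (ids [1] * sym 24 ⊳ sym 24) [100, 101, 102]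
      [(24, [100, 101], [104]), (24, [104, 102], [103])] [(24, [101, 102], [104]),
      (24, [100, 104], [103])] [103] (ih)
    rw [muB]
    have key := eval_eq hσ ((ids [1] * swap [0] [1] * ids [0] ⊳ sym 24 * sym 14) * ids [1, 0] ⊳
      (ids [1] * swap [0] [1] * ids [0] ⊳ sym 24 * sym 14)) (ids [1, 0] * (ids [1] * swap [0] [1]
      * ids [0] ⊳ sym 24 * sym 14) ⊳ (ids [1] * swap [0] [1] * ids [0] ⊳ sym 24 * sym 14))
      ((Eqv.refl (L := [100, 1, 102, 3, 104, 5]) (L' := [106, 7]) (P := [(24, [100, 102], [101]),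
      (14, [1, 3], [0]), (24, [101, 104], [106]), (14, [0, 5], [7])]) hσ)
        |>.step hσ (mu_assoc [n] [muB n]) [] [(24, [100, 102], [101]), (24, [101, 104], [106]),
          (14, [3, 5], [0]), (14, [1, 0], [7])]
        |>.step hσ h [] [(24, [102, 104], [101]), (14, [3, 5], [0]), (24, [100, 101], [106]),
          (14, [1, 0], [7])])
    simp only
      [Tm.eval, sym_env, coreOps,  dims_cons, dims_nil, dim_env, List.getD_cons_zero, List.getD_cons_succ, List.cons_append, List.nil_append, add_zero, Nat.reduceLT, if_false, Nat.reduceSub]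
      at key
    exact key

theorem muB_comm (n : ℕ) : br n n ⟫ muB n = muB n := by
  induction n with
  | zero => exact (congrArg (· ⟫ muB 0) (br_zero_right 0)).trans (wr_comp rfl)
  | succ n ih =>
    have hσ : (env [n] (coreOps ++ [muB n])).Typed (sig (coreSig ++ [([1, 1], [1])])) :=
      typed_core (by simp [dims_cons, dims_nil, dim_env])
    have h := eqv hσ (swap [1] [1] ⊳ sym 24) (sym 24) [100, 101] [(24, [101, 100], [102])]
      [(24, [100, 101], [102])] [102] (ih)
    rw [muB]
    have key := eval_eq hσ (swap [1, 0] [1, 0] ⊳ (ids [1] * swap [0] [1] * ids [0] ⊳ sym 24 * sym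
      14)) (ids [1] * swap [0] [1] * ids [0] ⊳ sym 24 * sym 14) ((Eqv.refl (L := [100, 1, 102, 3])
      (L' := [104, 5]) (P := [(24, [102, 100], [104]), (14, [3, 1], [5])]) hσ)
        |>.step hσ (mu_comm [n] [muB n]) [] [(24, [102, 100], [104]), (14, [1, 3], [5])]
        |>.step hσ h [] [(24, [100, 102], [104]), (14, [1, 3], [5])])
    simp only
      [Tm.eval, sym_env, coreOps,  dims_cons, dims_nil, dim_env, List.getD_cons_zero, List.getD_cons_succ, List.cons_append, List.nil_append, add_zero, Nat.reduceLT, if_false, Nat.reduceSub]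
      at key
    exact key

theorem muB_unit (n : ℕ) : (wr n * etaB n) ⟫ muB n = wr n := by
  induction n with
  | zero => rw [muB, etaB, wr_zero, one_mul]; exact wr_comp (f := 1) (n := 0) rfl
  | succ n ih =>
    have hσ : (env [n] (coreOps ++ [muB n, etaB n])).Typed (sig (coreSig ++ [([1, 1], [1]),
      ([], [1])])) := typed_core (by simp [dims_cons, dims_nil, dim_env])
    have h := eqv hσ (ids [1] * sym 25 ⊳ sym 24) (ids [1]) [100] [(25, [], [102]),
      (24, [100, 102], [101])] [(1, [100], [101])] [101] (ih)
    rw [muB, etaB]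
    have key := eval_eq hσ (ids [1, 0] * (sym 25 * sym 15) ⊳ (ids [1] * swap [0] [1] * ids [0] ⊳
      sym 24 * sym 14)) (ids [1, 0]) ((Eqv.refl (L := [100, 1]) (L' := [102, 3]) (P :=
      [(25, [], [101]), (15, [], [0]), (24, [100, 101], [102]), (14, [1, 0], [3])]) hσ)
        |>.step hσ (mu_eta [n] [muB n, etaB n]) [] [(25, [], [101]), (24, [100, 101], [102]),
          (0, [1], [3])]
        |>.step hσ h [] [(1, [100], [102]), (0, [1], [3])])
    simp only
      [Tm.eval, sym_env, coreOps,  dims_cons, dims_nil, dim_env, List.getD_cons_zero, List.getD_cons_succ, List.cons_append, List.nil_append, add_zero, Nat.reduceLT, if_false, Nat.reduceSub]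
      at key
    exact key

theorem muB_add (m n : ℕ) : muB (m + n) = (wr m * br n m * wr n) ⟫ (muB m * muB n) := by
  induction n with
  | zero => simp [muB, wr_zero, br_zero_left, wr_mul_wr, wr_comp]
  | succ n ih =>
    have hσ : (env [m, n] (coreOps ++ [muB m, muB n])).Typed (sig (coreSig ++ [([1, 1], [1]),
      ([2, 2], [2])])) := typed_core (by simp [dims_cons, dims_nil, dim_env])
    rw [← add_assoc, muB, ih, muB]
    have key := eq_of_same hσ (ids [1, 2] * swap [0] [1, 2] * ids [0] ⊳ (ids [1] * swap [2] [1] *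
      ids [2] ⊳ sym 24 * sym 25) * sym 14) (ids [1] * swap [2, 0] [1] * ids [2, 0] ⊳ sym 24 * (ids
      [2] * swap [0] [2] * ids [0] ⊳ sym 25 * sym 14)) [1, 2, 0, 1, 2, 0]
    simp only
      [Tm.eval, sym_env, coreOps,  dims_cons, dims_nil, dim_env, List.getD_cons_zero, List.getD_cons_succ, List.cons_append, List.nil_append, add_zero, Nat.reduceLT, if_false, Nat.reduceSub]
      at key
    exact key

/-! ### Convolution -/

/-- Morphisms with one input and `n` outputs. -/
def Vec (n : ℕ) : Type := {f : Mor // f.dom = 1 ∧ f.cod = n}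

namespace Vec
variable {n m : ℕ}

theorem dom (x : Vec n) : x.1.dom = 1 := x.2.1
theorem cod (x : Vec n) : x.1.cod = n := x.2.2

/-- Since δ|1⟩ = |10⟩ + |01⟩ and |0…0⟩ is the unit of `muB`, the convolution of x and y sends |1⟩ to
x|1⟩ + y|1⟩ when x and y send |0⟩ to |0…0⟩. No such condition is built into `Vec`; where it matters
it appears as `Unital`. -/
instance : Add (Vec n) :=
  ⟨fun x y => ⟨bcom 2 ⟫ (x.1 * y.1) ⟫ muB n, by simp⟩⟩

instance : Zero (Vec n) := ⟨⟨bcom 0 ⟫ etaB n, by simp⟩⟩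

theorem add_val (x y : Vec n) : (x + y).1 = bcom 2 ⟫ (x.1 * y.1) ⟫ muB n := rfl
theorem zero_val : (0 : Vec n).1 = bcom 0 ⟫ etaB n := rfl

protected theorem add_assoc' (x y z : Vec n) : x + y + z = x + (y + z) := by
  apply Subtype.ext
  have hσ : (env [n] (coreOps ++ [muB n, x.1, y.1, z.1])).Typed (sig (coreSig ++ [([1, 1], [1]),
    ([0], [1]), ([0], [1]), ([0], [1])])) := typed_core (by simp
    [dims_cons, dims_nil, dim_env, x.dom, y.dom, z.dom, x.cod, y.cod, z.cod])
  have h := eqv hσ (sym 24 * ids [1] ⊳ sym 24) (ids [1] * sym 24 ⊳ sym 24) [100, 101, 102]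
    [(24, [100, 101], [104]), (24, [104, 102], [103])] [(24, [101, 102], [104]),
    (24, [100, 104], [103])] [103] (muB_assoc n)
  rw [add_val, add_val, add_val, add_val]
  have key := eval_eq hσ (sym 16 ⊳ (sym 16 ⊳ sym 25 * sym 26 ⊳ sym 24) * sym 27 ⊳ sym 24) (sym 16
    ⊳ sym 25 * (sym 16 ⊳ sym 26 * sym 27 ⊳ sym 24) ⊳ sym 24) ((Eqv.refl (L := [0]) (L' := [101])
    (P := [(16, [0], [1, 2]), (16, [1], [3, 4]), (25, [3], [100]), (26, [4], [102]),
    (24, [100, 102], [103]), (27, [2], [104]), (24, [103, 104], [101])]) hσ)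
      |>.step hσ (delta_assoc [n] [muB n, x.1, y.1, z.1]) [] [(16, [0], [1, 2]),
        (16, [2], [3, 4]), (25, [1], [100]), (26, [3], [102]), (24, [100, 102], [103]),
        (27, [4], [104]), (24, [103, 104], [101])]
      |>.step hσ h [] [(16, [0], [1, 2]), (25, [1], [100]), (16, [2], [3, 4]), (26, [3], [102]),
        (27, [4], [103]), (24, [102, 103], [104]), (24, [100, 104], [101])])
  simp only
    [Tm.eval, sym_env, coreOps,  dims_cons, dims_nil, dim_env, List.getD_cons_zero, List.getD_cons_succ, List.cons_append, List.nil_append, add_zero, Nat.reduceLT, if_false, Nat.reduceSub]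
    at key
  exact key

protected theorem add_comm' (x y : Vec n) : x + y = y + x := by
  apply Subtype.ext
  have hσ : (env [n] (coreOps ++ [muB n, x.1, y.1])).Typed (sig (coreSig ++ [([1, 1], [1]),
    ([0], [1]), ([0], [1])])) := typed_core (by simp
    [dims_cons, dims_nil, dim_env, x.dom, y.dom, x.cod, y.cod])
  have h := eqv hσ (swap [1] [1] ⊳ sym 24) (sym 24) [100, 101] [(24, [101, 100], [102])]
    [(24, [100, 101], [102])] [102] (muB_comm n)
  rw [add_val, add_val]
  have key := eval_eq hσ (sym 16 ⊳ sym 25 * sym 26 ⊳ sym 24) (sym 16 ⊳ sym 26 * sym 25 ⊳ sym 24)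
    ((Eqv.refl (L := [0]) (L' := [101]) (P := [(16, [0], [1, 2]), (25, [1], [100]),
    (26, [2], [102]), (24, [100, 102], [101])]) hσ)
      |>.step hσ (delta_comm [n] [muB n, x.1, y.1]) [] [(16, [0], [1, 2]), (25, [2], [100]),
        (26, [1], [102]), (24, [100, 102], [101])]
      |>.step hσ h [] [(16, [0], [1, 2]), (26, [1], [100]), (25, [2], [102]),
        (24, [100, 102], [101])])
  simp only
    [Tm.eval, sym_env, coreOps,  dims_cons, dims_nil, dim_env, List.getD_cons_zero, List.getD_cons_succ, List.cons_append, List.nil_append, add_zero, Nat.reduceLT, if_false, Nat.reduceSub]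
    at key
  exact key

protected theorem add_zero' (x : Vec n) : x + 0 = x := by
  apply Subtype.ext
  have hσ : (env [n] (coreOps ++ [muB n, etaB n, x.1])).Typed (sig (coreSig ++ [([1, 1], [1]),
    ([], [1]), ([0], [1])])) := typed_core (by simp [dims_cons, dims_nil, dim_env, x.dom, x.cod])
  have h := eqv hσ (ids [1] * sym 25 ⊳ sym 24) (ids [1]) [100] [(25, [], [102]),
    (24, [100, 102], [101])] [(1, [100], [101])] [101] (muB_unit n)
  rw [add_val, zero_val]
  have key := eval_eq hσ (sym 16 ⊳ sym 26 * (sym 17 ⊳ sym 25) ⊳ sym 24) (sym 26) ((Eqv.refl (L :=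
    [0]) (L' := [101]) (P := [(16, [0], [1, 2]), (26, [1], [100]), (17, [2], []), (25, [], [102]),
    (24, [100, 102], [101])]) hσ)
      |>.step hσ (delta_eps [n] [muB n, etaB n, x.1]) [] [(25, [], [100]), (26, [0], [102]),
        (24, [102, 100], [101])]
      |>.step hσ h [] [(26, [0], [101])])
  simp only
    [Tm.eval, sym_env, coreOps,  dims_cons, dims_nil, dim_env, List.getD_cons_zero, List.getD_cons_succ, List.cons_append, List.nil_append, add_zero, Nat.reduceLT, if_false, Nat.reduceSub]
    at key
  exact key

instance : AddCommMonoid (Vec n) where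
  add_assoc := Vec.add_assoc'
  add_comm := Vec.add_comm'
  add_zero := Vec.add_zero'
  zero_add x := by rw [Vec.add_comm', Vec.add_zero']
  nsmul := nsmulRec

/-- The tensor product of two vectors. -/
def star (x : Vec n) (y : Vec m) : Vec (n + m) := ⟨wcom 2 ⟫ (x.1 * y.1), by simp [x.cod, y.cod]⟩

/-- The basis vector of the dual space. -/
def e : Vec 0 := ⟨wcom 0, by simp⟩

/-- The identity. -/
def one : Vec 1 := ⟨wr 1, by simp⟩

/-- The tensor product with a zero. -/
def zeroR (x : Vec n) : Vec (n + 1) := ⟨x.1 * bmul 0, by simp [x.dom, x.cod]⟩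

/-- The tensor product with a one. -/
def oneR (x : Vec n) : Vec (n + 1) := star x one

theorem star_val (x : Vec n) (y : Vec m) : (star x y).1 = wcom 2 ⟫ (x.1 * y.1) := rfl
theorem zeroR_val (x : Vec n) : (zeroR x).1 = x.1 * bmul 0 := rfl
theorem oneR_val (x : Vec n) : (oneR x).1 = wcom 2 ⟫ (x.1 * wr 1) := rfl

theorem zeroR_add (x y : Vec n) : zeroR (x + y) = zeroR x + zeroR y := by
  apply Subtype.ext
  have hσ : (env [n] (coreOps ++ [muB n, x.1, y.1])).Typed (sig (coreSig ++ [([1, 1], [1]),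
    ([0], [1]), ([0], [1])])) := typed_core (by simp
    [dims_cons, dims_nil, dim_env, x.dom, y.dom, x.cod, y.cod])
  rw [add_val, zeroR_val, zeroR_val, zeroR_val, add_val, muB]
  have key := eval_eq hσ ((sym 16 ⊳ sym 25 * sym 26 ⊳ sym 24) * sym 15) (sym 16 ⊳ sym 25 * sym 15
    * (sym 26 * sym 15) ⊳ (ids [1] * swap [0] [1] * ids [0] ⊳ sym 24 * sym 14)) ((Eqv.refl (L :=
    [0]) (L' := [101, 2]) (P := [(16, [0], [1, 3]), (25, [1], [100]), (26, [3], [102]),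
    (24, [100, 102], [101]), (15, [], [2])]) hσ)
      |>.unnorm hσ [(16, [0], [1, 3]), (25, [1], [100]), (26, [3], [102]),
        (24, [100, 102], [101]), (15, [], [4]), (0, [4], [2])]
      |>.step hσ (mu_eta [n] [muB n, x.1, y.1]).symm [] [(16, [0], [1, 3]), (25, [1], [100]),
        (15, [], [4]), (26, [3], [102]), (15, [], [5]), (24, [100, 102], [101]),
        (14, [4, 5], [2])])
  simp only
    [Tm.eval, sym_env, coreOps,  dims_cons, dims_nil, dim_env, List.getD_cons_zero, List.getD_cons_succ, List.cons_append, List.nil_append, add_zero, Nat.reduceLT, if_false, Nat.reduceSub]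
    at key
  exact key

theorem zeroR_zero : zeroR (0 : Vec n) = 0 := by
  apply Subtype.ext
  have hσ : (env [n] (coreOps ++ [etaB n])).Typed (sig (coreSig ++ [([], [1])])) := typed_core (by
    simp [dims_cons, dims_nil, dim_env])
  rw [zeroR_val, zero_val, zero_val, etaB]
  have key := eq_of_same hσ ((sym 17 ⊳ sym 24) * sym 15) (sym 17 ⊳ sym 24 * sym 15) [0]
  simp only
    [Tm.eval, sym_env, coreOps,  dims_cons, dims_nil, dim_env, List.getD_cons_zero, List.getD_cons_succ, List.cons_append, List.nil_append, add_zero, Nat.reduceLT, if_false, Nat.reduceSub]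
    at key
  exact key

/-- This is `c_delta_left`: the wire that carries the appended bit is split by c and recombined by
μ. -/
theorem oneR_add (x y : Vec n) : oneR (x + y) = oneR x + oneR y := by
  apply Subtype.ext
  have hσ : (env [n] (coreOps ++ [muB n, x.1, y.1])).Typed (sig (coreSig ++ [([1, 1], [1]),
    ([0], [1]), ([0], [1])])) := typed_core (by simp
    [dims_cons, dims_nil, dim_env, x.dom, y.dom, x.cod, y.cod])
  rw [add_val, oneR_val, oneR_val, oneR_val, add_val, muB]
  have key := eval_eq hσ (sym 18 ⊳ (sym 16 ⊳ sym 25 * sym 26 ⊳ sym 24) * ids [0]) (sym 16 ⊳ (sym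
    18 ⊳ sym 25 * ids [0]) * (sym 18 ⊳ sym 26 * ids [0]) ⊳ (ids [1] * swap [0] [1] * ids [0] ⊳ sym
    24 * sym 14)) ((Eqv.refl (L := [0]) (L' := [101, 2]) (P := [(18, [0], [1, 2]),
    (16, [1], [3, 4]), (25, [3], [100]), (26, [4], [102]), (24, [100, 102], [101])]) hσ)
      |>.step hσ (c_delta_left [n] [muB n, x.1, y.1]) [] [(16, [0], [1, 3]), (18, [1], [4, 5]),
        (25, [4], [100]), (18, [3], [6, 7]), (26, [6], [102]), (24, [100, 102], [101]),
        (14, [5, 7], [2])])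
  simp only
    [Tm.eval, sym_env, coreOps,  dims_cons, dims_nil, dim_env, List.getD_cons_zero, List.getD_cons_succ, List.cons_append, List.nil_append, add_zero, Nat.reduceLT, if_false, Nat.reduceSub]
    at key
  exact key

theorem oneR_zero : oneR (0 : Vec n) = 0 := by
  apply Subtype.ext
  have hσ : (env [n] (coreOps ++ [etaB n])).Typed (sig (coreSig ++ [([], [1])])) := typed_core (by
    simp [dims_cons, dims_nil, dim_env])
  rw [oneR_val, zero_val, zero_val, etaB]
  have key := eval_eq hσ (sym 18 ⊳ (sym 17 ⊳ sym 24) * ids [0]) (sym 17 ⊳ sym 24 * sym 15)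
    ((Eqv.refl (L := [0]) (L' := [101, 2]) (P := [(18, [0], [1, 2]), (17, [1], []),
    (24, [], [101])]) hσ)
      |>.step hσ (eps_c [n] [etaB n]) [] [(17, [0], []), (24, [], [101]), (15, [], [2])])
  simp only
    [Tm.eval, sym_env, coreOps,  dims_cons, dims_nil, dim_env, List.getD_cons_zero, List.getD_cons_succ, List.cons_append, List.nil_append, add_zero, Nat.reduceLT, if_false, Nat.reduceSub]
    at key
  exact key

theorem star_e (x : Vec n) : star x e = x := by
  apply Subtype.ext
  have hσ : (env [n] (coreOps ++ [x.1])).Typed (sig (coreSig ++ [([0], [1])])) := typed_core (by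
    simp [dims_cons, dims_nil, dim_env, x.dom, x.cod])
  rw [star_val, e]
  have key := eval_eq hσ (sym 18 ⊳ sym 24 * sym 19) (sym 24) ((Eqv.refl (L := [0]) (L' := [101])
    (P := [(18, [0], [1, 2]), (24, [1], [101]), (19, [2], [])]) hσ)
      |>.step hσ (c_e [n] [x.1]) [] [(24, [0], [101])])
  simp only
    [Tm.eval, sym_env, coreOps,  dims_cons, dims_nil, dim_env, List.getD_cons_zero, List.getD_cons_succ, List.cons_append, List.nil_append, add_zero, Nat.reduceLT, if_false, Nat.reduceSub]
    at key
  exact key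

theorem star_zeroR (x : Vec n) (y : Vec m) : star x (zeroR y) = zeroR (star x y) := by
  apply Subtype.ext
  have hσ : (env [n, m] (coreOps ++ [x.1, y.1])).Typed (sig (coreSig ++ [([0], [1]), ([0], [2])]))
    := typed_core (by simp [dims_cons, dims_nil, dim_env, x.dom, x.cod, y.dom, y.cod])
  rw [star_val, zeroR_val, zeroR_val, star_val]
  have key := eq_of_same hσ (sym 18 ⊳ sym 24 * (sym 25 * sym 15)) ((sym 18 ⊳ sym 24 * sym 25) *
    sym 15) [0]
  simp only
    [Tm.eval, sym_env, coreOps,  dims_cons, dims_nil, dim_env, List.getD_cons_zero, List.getD_cons_succ, List.cons_append, List.nil_append, add_zero, Nat.reduceLT, if_false, Nat.reduceSub]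
    at key
  exact key

theorem star_oneR (x : Vec n) (y : Vec m) : star x (oneR y) = oneR (star x y) := by
  apply Subtype.ext
  have hσ : (env [n, m] (coreOps ++ [x.1, y.1])).Typed (sig (coreSig ++ [([0], [1]), ([0], [2])]))
    := typed_core (by simp [dims_cons, dims_nil, dim_env, x.dom, x.cod, y.dom, y.cod])
  rw [star_val, oneR_val, oneR_val, star_val]
  have key := eval_eq hσ (sym 18 ⊳ sym 24 * (sym 18 ⊳ sym 25 * ids [0])) (sym 18 ⊳ (sym 18 ⊳ sym
    24 * sym 25) * ids [0]) ((Eqv.refl (L := [0]) (L' := [101, 202, 3]) (P := [(18, [0], [1, 2]),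
    (24, [1], [101]), (18, [2], [4, 3]), (25, [4], [202])]) hσ)
      |>.step hσ (c_assoc [n, m] [x.1, y.1]).symm [] [(18, [0], [1, 3]), (18, [1], [2, 4]),
        (24, [2], [101]), (25, [4], [202])])
  simp only
    [Tm.eval, sym_env, coreOps,  dims_cons, dims_nil, dim_env, List.getD_cons_zero, List.getD_cons_succ, List.cons_append, List.nil_append, add_zero, Nat.reduceLT, if_false, Nat.reduceSub]
    at key
  exact key

end Vec

/-! ### The sign changer on the cup and on the black unit. -/

theorem cup_s (d : List ℕ) (o : List Mor) : (env d (coreOps ++ o)).Eqv [] [(11, [], [0, 2]),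
  (13, [2], [1])] [(11, [], [2, 1]), (13, [2], [0])] [0, 1] :=
  (Eqv.refl typed_coreOps)
      |>.unnorm typed_coreOps [(11, [], [0, 2]), (13, [2], [3]), (0, [3], [1])]
      |>.step typed_coreOps (zigzag d o).symm [] [(11, [], [0, 2]), (13, [2], [3]),
        (11, [], [4, 1]), (10, [3, 4], [])]
      |>.step typed_coreOps (s_cap d o) [] [(11, [], [0, 2]), (11, [], [3, 1]), (13, [3], [4]),
        (10, [2, 4], [])]
      |>.step typed_coreOps (zigzag_right d o) [] [(11, [], [2, 1]), (13, [2], [0])]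

theorem eta_s (d : List ℕ) (o : List Mor) : (env d (coreOps ++ o)).Eqv [] [(15, [], [1]),
  (13, [1], [0])] [(15, [], [0])] [0] :=
  (Eqv.refl typed_coreOps)
      |>.step typed_coreOps (eta_def d o) [] [(11, [], [1, 2]), (17, [1], []), (13, [2], [0])]
      |>.step typed_coreOps (cup_s d o) [] [(11, [], [1, 0]), (13, [1], [2]), (17, [2], [])]
      |>.step typed_coreOps (s_eps d o) [] [(11, [], [1, 0]), (17, [1], [])]
      |>.step typed_coreOps (eta_def d o).symm [] [(15, [], [0])]

theorem muB_one : muB 1 = bmul 2 := by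
  simp only [muB, wr_zero, br_zero_right, wr_mul_wr, one_mul]
  exact wr_comp (by simp)

namespace Vec
variable {n m : ℕ}

/-! ### Change of sign -/

/-- The image under the sign changer of the input. -/
def neg (x : Vec n) : Vec n := ⟨sM ⟫ x.1, by simp [x.cod]⟩

theorem neg_val (x : Vec n) : (neg x).1 = sM ⟫ x.1 := rfl

theorem neg_add (x y : Vec n) : neg (x + y) = neg x + neg y := by
  apply Subtype.ext
  have hσ : (env [n] (coreOps ++ [muB n, x.1, y.1])).Typed (sig (coreSig ++ [([1, 1], [1]),
    ([0], [1]), ([0], [1])])) := typed_core (by simp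
    [dims_cons, dims_nil, dim_env, x.dom, y.dom, x.cod, y.cod])
  rw [neg_val, add_val, add_val, neg_val, neg_val]
  have key := eval_eq hσ (sym 13 ⊳ (sym 16 ⊳ sym 25 * sym 26 ⊳ sym 24)) (sym 16 ⊳ (sym 13 ⊳ sym
    25) * (sym 13 ⊳ sym 26) ⊳ sym 24) ((Eqv.refl (L := [0]) (L' := [101]) (P := [(13, [0], [1]),
    (16, [1], [2, 3]), (25, [2], [100]), (26, [3], [102]), (24, [100, 102], [101])]) hσ)
      |>.step hσ (s_delta [n] [muB n, x.1, y.1]) [] [(16, [0], [1, 2]), (13, [1], [3]),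
        (25, [3], [100]), (13, [2], [4]), (26, [4], [102]), (24, [100, 102], [101])])
  simp only
    [Tm.eval, sym_env, coreOps,  dims_cons, dims_nil, dim_env, List.getD_cons_zero, List.getD_cons_succ, List.cons_append, List.nil_append, add_zero, Nat.reduceLT, if_false, Nat.reduceSub]
    at key
  exact key

theorem neg_zero : neg (0 : Vec n) = 0 := by
  apply Subtype.ext
  have hσ : (env [n] (coreOps ++ [etaB n])).Typed (sig (coreSig ++ [([], [1])])) := typed_core (by
    simp [dims_cons, dims_nil, dim_env])
  rw [neg_val, zero_val]
  have key := eval_eq hσ (sym 13 ⊳ (sym 17 ⊳ sym 24)) (sym 17 ⊳ sym 24) ((Eqv.refl (L := [0]) (L'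
    := [101]) (P := [(13, [0], [1]), (17, [1], []), (24, [], [101])]) hσ)
      |>.step hσ (s_eps [n] [etaB n]) [] [(17, [0], []), (24, [], [101])])
  simp only
    [Tm.eval, sym_env, coreOps,  dims_cons, dims_nil, dim_env, List.getD_cons_zero, List.getD_cons_succ, List.cons_append, List.nil_append, add_zero, Nat.reduceLT, if_false, Nat.reduceSub]
    at key
  exact key

theorem neg_zeroR (x : Vec n) : neg (zeroR x) = zeroR (neg x) := by
  apply Subtype.ext
  have hσ : (env [n] (coreOps ++ [x.1])).Typed (sig (coreSig ++ [([0], [1])])) := typed_core (by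
    simp [dims_cons, dims_nil, dim_env, x.dom, x.cod])
  rw [neg_val, zeroR_val, zeroR_val, neg_val]
  have key := eq_of_same hσ (sym 13 ⊳ sym 24 * sym 15) ((sym 13 ⊳ sym 24) * sym 15) [0]
  simp only
    [Tm.eval, sym_env, coreOps,  dims_cons, dims_nil, dim_env, List.getD_cons_zero, List.getD_cons_succ, List.cons_append, List.nil_append, add_zero, Nat.reduceLT, if_false, Nat.reduceSub]
    at key
  exact key

theorem neg_oneR (x : Vec n) : neg (oneR x) = oneR (neg x) := by
  apply Subtype.ext
  have hσ : (env [n] (coreOps ++ [x.1])).Typed (sig (coreSig ++ [([0], [1])])) := typed_core (by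
    simp [dims_cons, dims_nil, dim_env, x.dom, x.cod])
  rw [neg_val, oneR_val, oneR_val, neg_val]
  have key := eval_eq hσ (sym 13 ⊳ (sym 18 ⊳ sym 24 * ids [0])) (sym 18 ⊳ (sym 13 ⊳ sym 24) * ids
    [0]) ((Eqv.refl (L := [0]) (L' := [101, 2]) (P := [(13, [0], [1]), (18, [1], [3, 2]),
    (24, [3], [101])]) hσ)
      |>.step hσ (s_c_left [n] [x.1]) [] [(18, [0], [1, 2]), (13, [1], [3]), (24, [3], [101])])
  simp only
    [Tm.eval, sym_env, coreOps,  dims_cons, dims_nil, dim_env, List.getD_cons_zero, List.getD_cons_succ, List.cons_append, List.nil_append, add_zero, Nat.reduceLT, if_false, Nat.reduceSub]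
    at key
  exact key

theorem star_neg (x : Vec n) (y : Vec m) : star x (neg y) = neg (star x y) := by
  apply Subtype.ext
  have hσ : (env [n, m] (coreOps ++ [x.1, y.1])).Typed (sig (coreSig ++ [([0], [1]), ([0], [2])]))
    := typed_core (by simp [dims_cons, dims_nil, dim_env, x.dom, x.cod, y.dom, y.cod])
  rw [star_val, neg_val, neg_val, star_val]
  have key := eval_eq hσ (sym 18 ⊳ sym 24 * (sym 13 ⊳ sym 25)) (sym 13 ⊳ (sym 18 ⊳ sym 24 * sym
    25)) ((Eqv.refl (L := [0]) (L' := [101, 202]) (P := [(18, [0], [1, 2]), (24, [1], [101]),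
    (13, [2], [3]), (25, [3], [202])]) hσ)
      |>.step hσ (s_c [n, m] [x.1, y.1]).symm [] [(13, [0], [1]), (18, [1], [2, 3]),
        (24, [2], [101]), (25, [3], [202])])
  simp only
    [Tm.eval, sym_env, coreOps,  dims_cons, dims_nil, dim_env, List.getD_cons_zero, List.getD_cons_succ, List.cons_append, List.nil_append, add_zero, Nat.reduceLT, if_false, Nat.reduceSub]
    at key
  exact key

/-- The counit laws and `c_delta_left` merge the two counits above δ into one counit above μ. What
is left below it is δ with an S on one leg followed by μ, which Loop I reduces to ε and η. -/
theorem e_add_neg_e : e + neg e = 0 := by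
  apply Subtype.ext
  have hσ : (env [] (coreOps ++ [])).Typed (sig (coreSig ++ [])) := typed_core (by simp
    [dims_cons, dims_nil, dim_env])
  rw [add_val, zero_val, neg_val, e, muB, etaB, ← wr_zero]
  have key := eval_eq hσ (sym 16 ⊳ sym 19 * (sym 13 ⊳ sym 19) ⊳ ids []) (sym 17 ⊳ ids [])
    ((Eqv.refl (L := [0]) (L' := []) (P := [(16, [0], [1, 2]), (19, [1], []), (13, [2], [3]),
    (19, [3], [])]) hσ)
      |>.unnorm hσ [(0, [0], [4]), (16, [4], [1, 2]), (19, [1], []), (13, [2], [3]),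
        (19, [3], [])]
      |>.step hσ (c_e [] []).symm [] [(18, [0], [1, 2]), (19, [2], []), (16, [1], [3, 4]),
        (19, [3], []), (13, [4], [5]), (19, [5], [])]
      |>.step hσ (c_delta_left [] []) [] [(16, [0], [1, 2]), (18, [1], [3, 4]), (18, [2], [5, 6]),
        (14, [4, 6], [7]), (19, [7], []), (19, [3], []), (13, [5], [8]), (19, [8], [])]
      |>.step hσ (e_c [] []) [] [(16, [0], [1, 2]), (18, [2], [3, 4]), (13, [3], [5]),
        (19, [5], []), (14, [1, 4], [6]), (19, [6], [])]
      |>.step hσ (s_c_left [] []).symm [] [(16, [0], [1, 2]), (13, [2], [3]), (18, [3], [4, 5]),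
        (19, [4], []), (14, [1, 5], [6]), (19, [6], [])]
      |>.step hσ (e_c [] []) [] [(16, [0], [1, 2]), (13, [2], [3]), (14, [1, 3], [4]),
        (19, [4], [])]
      |>.step hσ (delta_s_mu [] []) [] [(17, [0], []), (15, [], [1]), (19, [1], [])]
      |>.step hσ (eta_e [] []) [] [(17, [0], [])])
  simp only
    [Tm.eval, sym_env, coreOps,  dims_cons, dims_nil, dim_env, List.getD_cons_zero, List.getD_cons_succ, List.cons_append, List.nil_append, add_zero, Nat.reduceLT, if_false, Nat.reduceSub]
    at key
  exact key

/-! ### Integers -/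

/-- The scalar multiples of `e`. -/
def iota : ℤ →+ Vec 0 :=
  -- Convolution is only known to be a monoid, but e is a unit in it with inverse `neg e`, so its
  -- integer multiples exist.
  (AddUnits.coeHom _).comp (zmultiplesHom (AddUnits (Vec 0))
    ⟨e, neg e, e_add_neg_e, (add_comm _ _).trans e_add_neg_e⟩)

theorem iota_one : iota 1 = e := by simp [iota]

theorem iota_neg_one : iota (-1) = neg e := by simp [iota]

theorem iota_induction {p : Vec 0 → Prop} (he : p e) (hneg : ∀ x, p x → p (neg x))
    (hadd : ∀ x y, p x → p y → p (x + y)) (z : ℤ) : p (iota z) := by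
  induction z using Int.induction_on with
  | zero => rw [map_zero, ← e_add_neg_e]; exact hadd _ _ he (hneg _ he)
  | succ i ih => rw [map_add, iota_one]; exact hadd _ _ ih he
  | pred i ih => rw [sub_eq_add_neg, map_add, iota_neg_one]; exact hadd _ _ ih (hneg _ he)

/-- The change of sign as a homomorphism. -/
def negHom (n : ℕ) : Vec n →+ Vec n := ⟨⟨neg, neg_zero⟩, neg_add⟩

theorem neg_iota (z : ℤ) : neg (iota z) = iota (-z) := by
  have : (negHom 0).comp iota = iota.comp (negAddMonoidHom) :=
    AddMonoidHom.ext_int (by simp [iota_one, iota_neg_one, negHom])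
  exact DFunLike.congr_fun this z

/-! ### Linearity -/

/-- The tensor product with `x` is additive. -/
def Linear (x : Vec n) : Prop := ∀ (m : ℕ) (y z : Vec m), star (y + z) x = star y x + star z x

theorem Linear.e : Linear e := fun m y z => by rw [star_e, star_e, star_e]

theorem Linear.zeroR {x : Vec n} (h : Linear x) : Linear (zeroR x) := fun m y z => by
  rw [star_zeroR, star_zeroR, star_zeroR, h m, zeroR_add]

theorem Linear.oneR {x : Vec n} (h : Linear x) : Linear (oneR x) := fun m y z => by
  rw [star_oneR, star_oneR, star_oneR, h m, oneR_add]

theorem Linear.neg {x : Vec n} (h : Linear x) : Linear (neg x) := fun m y z => by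
  rw [star_neg, star_neg, star_neg, h m, neg_add]

/-- The comultiplication as a vector. -/
def del : Vec (1 + 1) := ⟨bcom 2, by simp⟩

/-- The identity with a zero on the right. -/
def inl : Vec (1 + 1) := ⟨wr 1 * bmul 0, by simp⟩

/-- The identity with a zero on the left. -/
def inr : Vec (1 + 1) := ⟨bmul 0 * wr 1, by simp⟩

theorem inl_add_inr : inl + inr = del := by
  apply Subtype.ext
  have hσ : (env [] (coreOps ++ [])).Typed (sig (coreSig ++ [])) := typed_core (by simp
    [dims_cons, dims_nil, dim_env])
  rw [add_val, inl, inr, del, muB_add, muB_one]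
  have key := eval_eq hσ (sym 16 ⊳ ids [0] * sym 15 * (sym 15 * ids [0]) ⊳ (ids [0] * swap [0] [0]
    * ids [0] ⊳ sym 14 * sym 14)) (sym 16) ((Eqv.refl (L := [0]) (L' := [1, 2]) (P :=
    [(16, [0], [3, 4]), (15, [], [5]), (15, [], [6]), (14, [3, 6], [1]), (14, [5, 4], [2])]) hσ)
      |>.step hσ (eta_mu [] []) [] [(16, [0], [3, 2]), (15, [], [4]), (14, [3, 4], [1])]
      |>.step hσ (mu_eta [] []) [] [(16, [0], [1, 2])])
  simp only
    [Tm.eval, sym_env, coreOps,  dims_cons, dims_nil, dim_env, List.getD_cons_zero, List.getD_cons_succ, List.cons_append, List.nil_append, add_zero, Nat.reduceLT, if_false, Nat.reduceSub]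
    at key
  exact key

/-- The left factor is a wire beside a constant |0⟩, so the plain distributive law `c_delta`
suffices. -/
theorem star_inl_add (x y : Vec n) : star inl (x + y) = star inl x + star inl y := by
  apply Subtype.ext
  have hσ : (env [n] (coreOps ++ [muB n, x.1, y.1])).Typed (sig (coreSig ++ [([1, 1], [1]),
    ([0], [1]), ([0], [1])])) := typed_core (by simp
    [dims_cons, dims_nil, dim_env, x.dom, y.dom, x.cod, y.cod])
  rw [add_val, star_val, star_val, star_val, inl, add_val, muB_add (1 + 1), muB_add 1 1, muB_one]
  have key := eval_eq hσ (sym 16 ⊳ (sym 18 ⊳ ids [0] * sym 15 * sym 25) * (sym 18 ⊳ ids [0] * sym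
    15 * sym 26) ⊳ (ids [0, 0] * swap [1] [0, 0] * ids [1] ⊳ (ids [0] * swap [0] [0] * ids [0] ⊳
    sym 14 * sym 14) * sym 24)) (sym 18 ⊳ ids [0] * sym 15 * (sym 16 ⊳ sym 25 * sym 26 ⊳ sym 24))
    ((Eqv.refl (L := [0]) (L' := [1, 2, 103]) (P := [(16, [0], [3, 4]), (18, [3], [5, 6]),
    (15, [], [7]), (25, [6], [100]), (18, [4], [8, 9]), (15, [], [10]), (26, [9], [101]),
    (14, [5, 8], [1]), (14, [7, 10], [2]), (24, [100, 101], [103])]) hσ)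
      |>.step hσ (c_delta [n] [muB n, x.1, y.1]).symm [] [(15, [], [3]), (15, [], [4]),
        (14, [3, 4], [2]), (18, [0], [1, 5]), (16, [5], [6, 7]), (25, [6], [100]),
        (26, [7], [101]), (24, [100, 101], [103])]
      |>.step hσ (mu_eta [n] [muB n, x.1, y.1]) [(0, 3)] [(18, [0], [1, 3]), (15, [], [2]),
        (16, [3], [4, 5]), (25, [4], [100]), (26, [5], [101]), (24, [100, 101], [103])])
  simp only
    [Tm.eval, sym_env, coreOps,  dims_cons, dims_nil, dim_env, List.getD_cons_zero, List.getD_cons_succ, List.cons_append, List.nil_append, add_zero, Nat.reduceLT, if_false, Nat.reduceSub]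
    at key
  exact Eq.symm key

theorem star_inr_add (x y : Vec n) : star inr (x + y) = star inr x + star inr y := by
  apply Subtype.ext
  have hσ : (env [n] (coreOps ++ [muB n, x.1, y.1])).Typed (sig (coreSig ++ [([1, 1], [1]),
    ([0], [1]), ([0], [1])])) := typed_core (by simp
    [dims_cons, dims_nil, dim_env, x.dom, y.dom, x.cod, y.cod])
  rw [add_val, star_val, star_val, star_val, inr, add_val, muB_add (1 + 1), muB_add 1 1, muB_one]
  have key := eval_eq hσ (sym 16 ⊳ (sym 18 ⊳ sym 15 * ids [0] * sym 25) * (sym 18 ⊳ sym 15 * ids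
    [0] * sym 26) ⊳ (ids [0, 0] * swap [1] [0, 0] * ids [1] ⊳ (ids [0] * swap [0] [0] * ids [0] ⊳
    sym 14 * sym 14) * sym 24)) (sym 18 ⊳ sym 15 * ids [0] * (sym 16 ⊳ sym 25 * sym 26 ⊳ sym 24))
    ((Eqv.refl (L := [0]) (L' := [1, 2, 103]) (P := [(16, [0], [3, 4]), (18, [3], [5, 6]),
    (15, [], [7]), (25, [6], [100]), (18, [4], [8, 9]), (15, [], [10]), (26, [9], [101]),
    (14, [7, 10], [1]), (14, [5, 8], [2]), (24, [100, 101], [103])]) hσ)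
      |>.step hσ (c_delta [n] [muB n, x.1, y.1]).symm [] [(15, [], [3]), (15, [], [4]),
        (14, [3, 4], [1]), (18, [0], [2, 5]), (16, [5], [6, 7]), (25, [6], [100]),
        (26, [7], [101]), (24, [100, 101], [103])]
      |>.step hσ (mu_eta [n] [muB n, x.1, y.1]) [(0, 3)] [(18, [0], [2, 3]), (15, [], [1]),
        (16, [3], [4, 5]), (25, [4], [100]), (26, [5], [101]), (24, [100, 101], [103])])
  simp only
    [Tm.eval, sym_env, coreOps,  dims_cons, dims_nil, dim_env, List.getD_cons_zero, List.getD_cons_succ, List.cons_append, List.nil_append, add_zero, Nat.reduceLT, if_false, Nat.reduceSub]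
    at key
  exact Eq.symm key

/-- Here both factors contain a δ, so the statement is `c_delta_delta` and rests on the elimination
rule. -/
theorem star_del_add (x y : Vec n) : star del (x + y) = star del x + star del y := by
  apply Subtype.ext
  have hσ : (env [n] (coreOps ++ [muB n, x.1, y.1])).Typed (sig (coreSig ++ [([1, 1], [1]),
    ([0], [1]), ([0], [1])])) := typed_core (by simp
    [dims_cons, dims_nil, dim_env, x.dom, y.dom, x.cod, y.cod])
  rw [add_val, star_val, star_val, star_val, del, add_val, muB_add (1 + 1), muB_add 1 1, muB_one]
  have key := eval_eq hσ (sym 18 ⊳ sym 16 * (sym 16 ⊳ sym 25 * sym 26 ⊳ sym 24)) (sym 16 ⊳ (sym 18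
    ⊳ sym 16 * sym 25) * (sym 18 ⊳ sym 16 * sym 26) ⊳ (ids [0, 0] * swap [1] [0, 0] * ids [1] ⊳
    (ids [0] * swap [0] [0] * ids [0] ⊳ sym 14 * sym 14) * sym 24)) ((Eqv.refl (L := [0]) (L' :=
    [1, 2, 103]) (P := [(18, [0], [3, 4]), (16, [3], [1, 2]), (16, [4], [5, 6]), (25, [5], [100]),
    (26, [6], [101]), (24, [100, 101], [103])]) hσ)
      |>.step hσ (c_delta_delta [n] [muB n, x.1, y.1]) [] [(16, [0], [3, 4]), (18, [3], [5, 6]),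
        (16, [5], [7, 8]), (25, [6], [100]), (18, [4], [9, 10]), (16, [9], [11, 12]),
        (26, [10], [101]), (14, [7, 11], [1]), (14, [8, 12], [2]), (24, [100, 101], [103])])
  simp only
    [Tm.eval, sym_env, coreOps,  dims_cons, dims_nil, dim_env, List.getD_cons_zero, List.getD_cons_succ, List.cons_append, List.nil_append, add_zero, Nat.reduceLT, if_false, Nat.reduceSub]
    at key
  exact key

/-- The pair `inl`, `inr`, with sum `del`, is the universal pair of summands: y + z is `del`
followed by y beside z and then `muB`. Postcomposing the hypothesis accordingly gives the general
case. -/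
theorem linear_of_star_del {x : Vec n} (h : star del x = star inl x + star inr x) :
    Linear x := by
  intro m y z
  apply Subtype.ext
  replace h := congrArg Subtype.val h
  rw [add_val, star_val, star_val, star_val, inl, inr, del, muB_add (1 + 1), muB_add 1 1,
    muB_one] at h
  have hσ : (env [m, n] (coreOps ++ [muB m, muB n, x.1, y.1, z.1])).Typed (sig (coreSig ++
    [([1, 1], [1]), ([2, 2], [2]), ([0], [2]), ([0], [1]), ([0], [1])])) := typed_core (by simp
    [dims_cons, dims_nil, dim_env, x.dom, y.dom, z.dom, x.cod, y.cod, z.cod])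
  have hd := eqv hσ (sym 18 ⊳ sym 16 * sym 26) (sym 16 ⊳ (sym 18 ⊳ ids [0] * sym 15 * sym 26) *
    (sym 18 ⊳ sym 15 * ids [0] * sym 26) ⊳ (ids [0, 0] * swap [2] [0, 0] * ids [2] ⊳ (ids [0] *
    swap [0] [0] * ids [0] ⊳ sym 14 * sym 14) * sym 25)) [0] [(18, [0], [3, 4]),
    (16, [3], [1, 2]), (26, [4], [203])] [(16, [0], [3, 4]), (18, [3], [5, 6]), (15, [], [7]),
    (26, [6], [200]), (18, [4], [8, 9]), (15, [], [10]), (26, [9], [201]), (14, [5, 10], [1]),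
    (14, [7, 8], [2]), (25, [200, 201], [203])] [1, 2, 203] (h)
  rw [add_val, star_val, star_val, star_val, add_val, muB_add m n]
  have key := eval_eq hσ (sym 18 ⊳ (sym 16 ⊳ sym 27 * sym 28 ⊳ sym 24) * sym 26) (sym 16 ⊳ (sym 18
    ⊳ sym 27 * sym 26) * (sym 18 ⊳ sym 28 * sym 26) ⊳ (ids [1] * swap [2] [1] * ids [2] ⊳ sym 24 *
    sym 25)) ((Eqv.refl (L := [0]) (L' := [101, 202]) (P := [(18, [0], [1, 2]), (16, [1], [3, 4]),
    (27, [3], [100]), (28, [4], [102]), (24, [100, 102], [101]), (26, [2], [202])]) hσ)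
      |>.step hσ hd [] [(16, [0], [1, 2]), (18, [1], [3, 4]), (15, [], [5]), (26, [4], [200]),
        (18, [2], [6, 7]), (15, [], [8]), (26, [7], [201]), (14, [3, 8], [9]), (14, [5, 6], [10]),
        (25, [200, 201], [202]), (27, [9], [100]), (28, [10], [102]), (24, [100, 102], [101])]
      |>.step hσ (eta_mu [m, n] [muB m, muB n, x.1, y.1, z.1]) [] [(16, [0], [1, 2]),
        (18, [1], [3, 4]), (26, [4], [200]), (18, [2], [5, 6]), (15, [], [7]), (26, [6], [201]),
        (14, [3, 7], [8]), (25, [200, 201], [202]), (27, [8], [100]), (28, [5], [102]),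
        (24, [100, 102], [101])]
      |>.step hσ (mu_eta [m, n] [muB m, muB n, x.1, y.1, z.1]) [] [(16, [0], [1, 2]),
        (18, [1], [3, 4]), (27, [3], [100]), (26, [4], [200]), (18, [2], [5, 6]),
        (28, [5], [102]), (26, [6], [201]), (24, [100, 102], [101]), (25, [200, 201], [202])])
  simp only
    [Tm.eval, sym_env, coreOps,  dims_cons, dims_nil, dim_env, List.getD_cons_zero, List.getD_cons_succ, List.cons_append, List.nil_append, add_zero, Nat.reduceLT, if_false, Nat.reduceSub]
    at key
  exact key

/-- Only the universal pair has to be checked. There both factors can be expanded, in either order,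
and the four terms are regrouped by commutativity. -/
theorem Linear.add {x y : Vec n} (hx : Linear x) (hy : Linear y) : Linear (x + y) := by
  apply linear_of_star_del
  rw [star_del_add, star_inl_add, star_inr_add, ← inl_add_inr, hx, hy]
  exact add_add_add_comm _ _ _ _

/-- Additivity in the right factor is additivity in the left one with the legs of c exchanged. -/
theorem Linear.star_add {x : Vec n} (h : Linear x) (y z : Vec m) :
    star x (y + z) = star x y + star x z := by
  apply Subtype.ext
  replace h := congrArg Subtype.val (h m y z)
  rw [add_val, star_val, star_val, star_val, add_val, muB_add m n] at h
  have hσ : (env [m, n] (coreOps ++ [muB m, muB n, x.1, y.1, z.1])).Typed (sig (coreSig ++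
    [([1, 1], [1]), ([2, 2], [2]), ([0], [2]), ([0], [1]), ([0], [1])])) := typed_core (by simp
    [dims_cons, dims_nil, dim_env, x.dom, y.dom, z.dom, x.cod, y.cod, z.cod])
  have hd := eqv hσ (sym 18 ⊳ (sym 16 ⊳ sym 27 * sym 28 ⊳ sym 24) * sym 26) (sym 16 ⊳ (sym 18 ⊳
    sym 27 * sym 26) * (sym 18 ⊳ sym 28 * sym 26) ⊳ (ids [1] * swap [2] [1] * ids [2] ⊳ sym 24 *
    sym 25)) [0] [(18, [0], [1, 2]), (16, [1], [3, 4]), (27, [3], [100]), (28, [4], [102]),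
    (24, [100, 102], [101]), (26, [2], [202])] [(16, [0], [1, 2]), (18, [1], [3, 4]),
    (27, [3], [100]), (26, [4], [200]), (18, [2], [5, 6]), (28, [5], [102]), (26, [6], [201]),
    (24, [100, 102], [101]), (25, [200, 201], [202])] [101, 202] (h)
  rw [add_val, star_val, star_val, star_val, add_val, muB_add n m]
  have key := eval_eq hσ (sym 18 ⊳ sym 26 * (sym 16 ⊳ sym 27 * sym 28 ⊳ sym 24)) (sym 16 ⊳ (sym 18
    ⊳ sym 26 * sym 27) * (sym 18 ⊳ sym 26 * sym 28) ⊳ (ids [2] * swap [1] [2] * ids [1] ⊳ sym 25 *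
    sym 24)) ((Eqv.refl (L := [0]) (L' := [201, 102]) (P := [(18, [0], [1, 2]), (26, [1], [201]),
    (16, [2], [3, 4]), (27, [3], [100]), (28, [4], [101]), (24, [100, 101], [102])]) hσ)
      |>.step hσ (c_comm [m, n] [muB m, muB n, x.1, y.1, z.1]) [] [(18, [0], [1, 2]),
        (26, [2], [201]), (16, [1], [3, 4]), (27, [3], [100]), (28, [4], [101]),
        (24, [100, 101], [102])]
      |>.step hσ hd [] [(16, [0], [1, 2]), (18, [1], [3, 4]), (27, [3], [100]), (26, [4], [200]),
        (18, [2], [5, 6]), (28, [5], [101]), (26, [6], [202]), (24, [100, 101], [102]),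
        (25, [200, 202], [201])]
      |>.step hσ (c_comm [m, n] [muB m, muB n, x.1, y.1, z.1]) [(0, 2)] [(16, [0], [1, 2]),
        (18, [1], [3, 4]), (27, [3], [100]), (26, [4], [200]), (18, [2], [5, 6]),
        (28, [6], [101]), (26, [5], [202]), (24, [100, 101], [102]), (25, [200, 202], [201])]
      |>.step hσ (c_comm [m, n] [muB m, muB n, x.1, y.1, z.1]) [] [(16, [0], [1, 2]),
        (18, [1], [3, 4]), (26, [3], [200]), (27, [4], [100]), (18, [2], [5, 6]),
        (26, [5], [202]), (28, [6], [101]), (25, [200, 202], [201]), (24, [100, 101], [102])])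
  simp only
    [Tm.eval, sym_env, coreOps,  dims_cons, dims_nil, dim_env, List.getD_cons_zero, List.getD_cons_succ, List.cons_append, List.nil_append, add_zero, Nat.reduceLT, if_false, Nat.reduceSub]
    at key
  exact key

/-! ### Preservation of units -/

/-- The vector preserves units. -/
def Unital (x : Vec n) : Prop := bmul 0 ⟫ x.1 = etaB n

theorem Unital.e : Unital e := by
  rw [Unital, etaB, Vec.e]
  have hσ : (env [] (coreOps ++ [])).Typed (sig (coreSig ++ [])) := typed_core (by simp
    [dims_cons, dims_nil, dim_env])
  rw [← wr_zero]
  have key := eval_eq hσ (sym 15 ⊳ sym 19) (ids []) ((Eqv.refl (L := []) (L' := []) (P :=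
    [(15, [], [0]), (19, [0], [])]) hσ)
      |>.step hσ (eta_e [] []) [] [])
  simp only
    [Tm.eval, sym_env, coreOps,  dims_cons, dims_nil, dim_env, List.getD_cons_zero, List.getD_cons_succ, List.cons_append, List.nil_append, add_zero, Nat.reduceLT, if_false, Nat.reduceSub]
    at key
  exact key

theorem Unital.neg {x : Vec n} (h : Unital x) : Unital (neg x) := by
  have hσ : (env [n] (coreOps ++ [etaB n, x.1])).Typed (sig (coreSig ++ [([], [1]), ([0], [1])]))
    := typed_core (by simp [dims_cons, dims_nil, dim_env, x.dom, x.cod])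
  have hd := eqv hσ (sym 15 ⊳ sym 25) (sym 24) [] [(15, [], [0]), (25, [0], [100])]
    [(24, [], [100])] [100] (h)
  rw [Unital, neg_val]
  have key := eval_eq hσ (sym 15 ⊳ (sym 13 ⊳ sym 25)) (sym 24) ((Eqv.refl (L := []) (L' := [100])
    (P := [(15, [], [0]), (13, [0], [1]), (25, [1], [100])]) hσ)
      |>.step hσ (eta_s [n] [etaB n, x.1]) [] [(15, [], [0]), (25, [0], [100])]
      |>.step hσ hd [] [(24, [], [100])])
  simp only
    [Tm.eval, sym_env, coreOps,  dims_cons, dims_nil, dim_env, List.getD_cons_zero, List.getD_cons_succ, List.cons_append, List.nil_append, add_zero, Nat.reduceLT, if_false, Nat.reduceSub]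
    at key
  exact key

theorem Unital.zeroR {x : Vec n} (h : Unital x) : Unital (zeroR x) := by
  have hσ : (env [n] (coreOps ++ [etaB n, x.1])).Typed (sig (coreSig ++ [([], [1]), ([0], [1])]))
    := typed_core (by simp [dims_cons, dims_nil, dim_env, x.dom, x.cod])
  have hd := eqv hσ (sym 15 ⊳ sym 25) (sym 24) [] [(15, [], [0]), (25, [0], [100])]
    [(24, [], [100])] [100] (h)
  rw [Unital, zeroR_val, etaB]
  have key := eval_eq hσ (sym 15 ⊳ sym 25 * sym 15) (sym 24 * sym 15) ((Eqv.refl (L := []) (L' :=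
    [100, 1]) (P := [(15, [], [0]), (25, [0], [100]), (15, [], [1])]) hσ)
      |>.step hσ hd [] [(24, [], [100]), (15, [], [1])])
  simp only
    [Tm.eval, sym_env, coreOps,  dims_cons, dims_nil, dim_env, List.getD_cons_zero, List.getD_cons_succ, List.cons_append, List.nil_append, add_zero, Nat.reduceLT, if_false, Nat.reduceSub]
    at key
  exact key

theorem Unital.oneR {x : Vec n} (h : Unital x) : Unital (oneR x) := by
  have hσ : (env [n] (coreOps ++ [etaB n, x.1])).Typed (sig (coreSig ++ [([], [1]), ([0], [1])]))
    := typed_core (by simp [dims_cons, dims_nil, dim_env, x.dom, x.cod])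
  have hd := eqv hσ (sym 15 ⊳ sym 25) (sym 24) [] [(15, [], [0]), (25, [0], [100])]
    [(24, [], [100])] [100] (h)
  rw [Unital, oneR_val, etaB]
  have key := eval_eq hσ (sym 15 ⊳ (sym 18 ⊳ sym 25 * ids [0])) (sym 24 * sym 15) ((Eqv.refl (L :=
    []) (L' := [100, 1]) (P := [(15, [], [0]), (18, [0], [2, 1]), (25, [2], [100])]) hσ)
      |>.step hσ (eta_c [n] [etaB n, x.1]) [] [(15, [], [0]), (15, [], [1]), (25, [0], [100])]
      |>.step hσ hd [] [(24, [], [100]), (15, [], [1])])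
  simp only
    [Tm.eval, sym_env, coreOps,  dims_cons, dims_nil, dim_env, List.getD_cons_zero, List.getD_cons_succ, List.cons_append, List.nil_append, add_zero, Nat.reduceLT, if_false, Nat.reduceSub]
    at key
  exact key

theorem Unital.add {x y : Vec n} (hx : Unital x) (hy : Unital y) : Unital (x + y) := by
  have hσ : (env [n] (coreOps ++ [muB n, etaB n, x.1, y.1])).Typed (sig (coreSig ++
    [([1, 1], [1]), ([], [1]), ([0], [1]), ([0], [1])])) := typed_core (by simp
    [dims_cons, dims_nil, dim_env, x.dom, x.cod, y.dom, y.cod])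
  have h := eqv hσ (ids [1] * sym 25 ⊳ sym 24) (ids [1]) [100] [(25, [], [102]),
    (24, [100, 102], [101])] [(1, [100], [101])] [101] (muB_unit n)
  have h1 := eqv hσ (sym 15 ⊳ sym 26) (sym 25) [] [(15, [], [0]), (26, [0], [100])]
    [(25, [], [100])] [100] (hx)
  have h2 := eqv hσ (sym 15 ⊳ sym 27) (sym 25) [] [(15, [], [0]), (27, [0], [100])]
    [(25, [], [100])] [100] (hy)
  rw [Unital, add_val]
  have key := eval_eq hσ (sym 15 ⊳ (sym 16 ⊳ sym 26 * sym 27 ⊳ sym 24)) (sym 25) ((Eqv.refl (L :=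
    []) (L' := [100]) (P := [(15, [], [0]), (16, [0], [1, 2]), (26, [1], [101]), (27, [2], [102]),
    (24, [101, 102], [100])]) hσ)
      |>.step hσ (eta_delta [n] [muB n, etaB n, x.1, y.1]) [] [(15, [], [0]), (15, [], [1]),
        (26, [0], [101]), (27, [1], [102]), (24, [101, 102], [100])]
      |>.step hσ h1 [] [(15, [], [0]), (27, [0], [101]), (25, [], [102]), (24, [102, 101], [100])]
      |>.step hσ h2 [] [(25, [], [101]), (25, [], [102]), (24, [101, 102], [100])]
      |>.step hσ h [(100, 101)] [(25, [], [100])])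
  simp only
    [Tm.eval, sym_env, coreOps,  dims_cons, dims_nil, dim_env, List.getD_cons_zero, List.getD_cons_succ, List.cons_append, List.nil_append, add_zero, Nat.reduceLT, if_false, Nat.reduceSub]
    at key
  exact key

end Vec

/-! ### Homomorphisms of the black monoid -/

/-- `f` is a homomorphism for the black multiplications. -/
structure BlackHom (n m : ℕ) (f : Mor) : Prop where
  dom : f.dom = n
  cod : f.cod = m
  mul : muB n ⟫ f = (f * f) ⟫ muB m
  unit : etaB n ⟫ f = etaB m

theorem BlackHom.mul_wr {n m : ℕ} {f : Mor} (h : BlackHom n m f) :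
    BlackHom (n + 1) (m + 1) (f * wr 1) := by
  refine ⟨by simp [h.dom], by simp [h.cod], ?_, ?_⟩

  · have hσ : (env [n, m] (coreOps ++ [muB n, muB m, f])).Typed (sig (coreSig ++ [([1, 1], [1]),
      ([2, 2], [2]), ([1], [2])])) := typed_core (by simp
      [dims_cons, dims_nil, dim_env, h.dom, h.cod])
    have hd := eqv hσ (sym 24 ⊳ sym 26) (sym 26 * sym 26 ⊳ sym 25) [100, 101]
      [(24, [100, 101], [102]), (26, [102], [202])] [(26, [100], [200]), (26, [101], [201]),
      (25, [200, 201], [202])] [202] (h.mul)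
    rw [muB, muB]
    have key := eval_eq hσ (ids [1] * swap [0] [1] * ids [0] ⊳ sym 24 * sym 14 ⊳ sym 26 * ids [0])
      (sym 26 * ids [0] * (sym 26 * ids [0]) ⊳ (ids [2] * swap [0] [2] * ids [0] ⊳ sym 25 * sym
      14)) ((Eqv.refl (L := [100, 1, 102, 3]) (L' := [204, 5]) (P := [(24, [100, 102], [101]),
      (14, [1, 3], [5]), (26, [101], [204])]) hσ)
        |>.step hσ hd [] [(26, [100], [200]), (26, [102], [201]), (25, [200, 201], [204]),
          (14, [1, 3], [5])])
    simp only
      [Tm.eval, sym_env, coreOps,  dims_cons, dims_nil, dim_env, List.getD_cons_zero, List.getD_cons_succ, List.cons_append, List.nil_append, add_zero, Nat.reduceLT, if_false, Nat.reduceSub]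
      at key
    exact key
  · have hσ : (env [n, m] (coreOps ++ [etaB n, etaB m, f])).Typed (sig (coreSig ++ [([], [1]),
      ([], [2]), ([1], [2])])) := typed_core (by simp
      [dims_cons, dims_nil, dim_env, h.dom, h.cod])
    have hd := eqv hσ (sym 24 ⊳ sym 26) (sym 25) [] [(24, [], [100]), (26, [100], [200])]
      [(25, [], [200])] [200] (h.unit)
    rw [etaB, etaB]
    have key := eval_eq hσ (sym 24 * sym 15 ⊳ sym 26 * ids [0]) (sym 25 * sym 15) ((Eqv.refl (L :=
      []) (L' := [200, 1]) (P := [(24, [], [100]), (15, [], [1]), (26, [100], [200])]) hσ)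
        |>.step hσ hd [] [(25, [], [200]), (15, [], [1])])
    simp only
      [Tm.eval, sym_env, coreOps,  dims_cons, dims_nil, dim_env, List.getD_cons_zero, List.getD_cons_succ, List.cons_append, List.nil_append, add_zero, Nat.reduceLT, if_false, Nat.reduceSub]
      at key
    exact key

theorem BlackHom.braid (n : ℕ) : BlackHom (n + 2) (n + 2) (wr n * br 1 1) := by
  refine ⟨by simp, by simp, ?_, ?_⟩

  · have hσ : (env [n] (coreOps ++ [muB n])).Typed (sig (coreSig ++ [([1, 1], [1])])) :=
      typed_core (by simp [dims_cons, dims_nil, dim_env])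
    rw [muB, muB]
    have key := eq_of_same hσ (ids [1, 0] * swap [0] [1, 0] * ids [0] ⊳ (ids [1] * swap [0] [1] *
      ids [0] ⊳ sym 24 * sym 14) * sym 14 ⊳ ids [1] * swap [0] [0]) (ids [1] * swap [0] [0] * (ids
      [1] * swap [0] [0]) ⊳ (ids [1, 0] * swap [0] [1, 0] * ids [0] ⊳ (ids [1] * swap [0] [1] *
      ids [0] ⊳ sym 24 * sym 14) * sym 14)) [1, 0, 0, 1, 0, 0]
    simp only
      [Tm.eval, sym_env, coreOps,  dims_cons, dims_nil, dim_env, List.getD_cons_zero, List.getD_cons_succ, List.cons_append, List.nil_append, add_zero, Nat.reduceLT, if_false, Nat.reduceSub]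
      at key
    exact key
  · have hσ : (env [n] (coreOps ++ [etaB n])).Typed (sig (coreSig ++ [([], [1])])) := typed_core
      (by simp [dims_cons, dims_nil, dim_env])
    rw [etaB, etaB]
    have key := eq_of_same hσ (sym 24 * sym 15 * sym 15 ⊳ ids [1] * swap [0] [0]) (sym 24 * sym 15
      * sym 15) []
    simp only
      [Tm.eval, sym_env, coreOps,  dims_cons, dims_nil, dim_env, List.getD_cons_zero, List.getD_cons_succ, List.cons_append, List.nil_append, add_zero, Nat.reduceLT, if_false, Nat.reduceSub]
      at key
    exact key

/-- Adjacent transpositions generate all braidings, so these are the only ones that have to be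
followed through the span. -/
theorem BlackHom.braid_at (k l : ℕ) :
    BlackHom (k + 2 + l) (k + 2 + l) (wr k * br 1 1 * wr l) := by
  induction l with
  | zero => rw [wr_zero, _root_.mul_one]; exact .braid k
  | succ l ih => rw [← wr_mul_wr l 1, ← mul_assoc]; exact ih.mul_wr

/-- Distributing the second c over its δ and regrouping the branches isolates two branches in the
situation of `cut`, which disconnects them. This is the form in which `cut` occurs when a sum is
contracted. -/
theorem delta_cut (d : List ℕ) (o : List Mor) : (env d (coreOps ++ o)).Eqv [0] [(16, [0], [4, 5]),
  (18, [4], [1, 6]), (18, [5], [2, 7]), (16, [7], [3, 8]), (10, [6, 8], [])] [(15, [], [1]),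
  (18, [0], [2, 3])] [1, 2, 3] :=
  (Eqv.refl typed_coreOps)
      |>.step typed_coreOps (c_delta d o) [(0, 5)] [(16, [0], [4, 5]), (18, [4], [1, 6]),
        (16, [5], [7, 8]), (18, [7], [9, 3]), (18, [8], [10, 11]), (14, [9, 10], [2]),
        (10, [6, 11], [])]
      |>.step typed_coreOps (delta_assoc d o).symm [] [(16, [0], [4, 5]), (16, [4], [6, 7]),
        (18, [6], [1, 8]), (18, [7], [9, 3]), (18, [5], [10, 11]), (14, [9, 10], [2]),
        (10, [8, 11], [])]
      |>.step typed_coreOps (delta_comm d o) [(0, 4)] [(16, [0], [4, 5]), (18, [5], [6, 7]),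
        (16, [4], [8, 9]), (18, [9], [1, 10]), (18, [8], [11, 3]), (14, [11, 6], [2]),
        (10, [10, 7], [])]
      |>.step typed_coreOps (delta_assoc d o) [] [(16, [0], [4, 5]), (16, [5], [6, 7]),
        (18, [7], [8, 9]), (18, [6], [1, 10]), (18, [4], [11, 3]), (14, [11, 8], [2]),
        (10, [10, 9], [])]
      |>.step typed_coreOps (c_comm d o) [] [(16, [0], [4, 5]), (16, [5], [6, 7]),
        (18, [6], [1, 8]), (18, [4], [9, 3]), (18, [7], [10, 11]), (14, [9, 11], [2]),
        (10, [8, 10], [])]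
      |>.step typed_coreOps (cut d o) [(0, 5)] [(16, [0], [4, 5]), (18, [4], [6, 3]),
        (17, [5], []), (15, [], [1]), (15, [], [7]), (14, [6, 7], [2])]
      |>.step typed_coreOps (mu_eta d o) [(0, 6)] [(16, [0], [4, 5]), (18, [4], [2, 3]),
        (17, [5], []), (15, [], [1])]
      |>.step typed_coreOps (delta_eps d o) [] [(15, [], [1]), (18, [0], [2, 3])]

namespace Vec
variable {n m k : ℕ}

/-- Composition with a homomorphism. -/
def post {f : Mor} (h : BlackHom n m f) : Vec n →+ Vec m where
  toFun x := ⟨x.1 ⟫ f, by simp [x.dom, h.cod]⟩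
  map_zero' := by
    apply Subtype.ext
    have hσ : (env [n, m] (coreOps ++ [etaB n, etaB m, f])).Typed (sig (coreSig ++ [([], [1]),
      ([], [2]), ([1], [2])])) := typed_core (by simp
      [dims_cons, dims_nil, dim_env, h.dom, h.cod])
    have hd := eqv hσ (sym 24 ⊳ sym 26) (sym 25) [] [(24, [], [100]), (26, [100], [200])]
      [(25, [], [200])] [200] (h.unit)
    change bcom 0 ⟫ etaB n ⟫ f = bcom 0 ⟫ etaB m
    have key := eval_eq hσ (sym 17 ⊳ sym 24 ⊳ sym 26) (sym 17 ⊳ sym 25) ((Eqv.refl (L := [0]) (L'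
      := [201]) (P := [(17, [0], []), (24, [], [100]), (26, [100], [201])]) hσ)
        |>.step hσ hd [] [(17, [0], []), (25, [], [201])])
    simp only
      [Tm.eval, sym_env, coreOps,  dims_cons, dims_nil, dim_env, List.getD_cons_zero, List.getD_cons_succ, List.cons_append, List.nil_append, add_zero, Nat.reduceLT, if_false, Nat.reduceSub]
      at key
    exact key
  map_add' x y := by
    apply Subtype.ext
    have hσ : (env [n, m] (coreOps ++ [muB n, muB m, f, x.1, y.1])).Typed (sig (coreSig ++
      [([1, 1], [1]), ([2, 2], [2]), ([1], [2]), ([0], [1]), ([0], [1])])) := typed_core (by simp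
      [dims_cons, dims_nil, dim_env, h.dom, h.cod, x.dom, y.dom, x.cod, y.cod])
    have hd := eqv hσ (sym 24 ⊳ sym 26) (sym 26 * sym 26 ⊳ sym 25) [100, 101]
      [(24, [100, 101], [102]), (26, [102], [202])] [(26, [100], [200]), (26, [101], [201]),
      (25, [200, 201], [202])] [202] (h.mul)
    change bcom 2 ⟫ (x.1 * y.1) ⟫ muB n ⟫ f = bcom 2 ⟫ ((x.1 ⟫ f) * (y.1 ⟫ f)) ⟫ muB m
    have key := eval_eq hσ (sym 16 ⊳ sym 27 * sym 28 ⊳ sym 24 ⊳ sym 26) (sym 16 ⊳ (sym 27 ⊳ sym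
      26) * (sym 28 ⊳ sym 26) ⊳ sym 25) ((Eqv.refl (L := [0]) (L' := [201]) (P :=
      [(16, [0], [1, 2]), (27, [1], [100]), (28, [2], [101]), (24, [100, 101], [102]),
      (26, [102], [201])]) hσ)
        |>.step hσ hd [] [(16, [0], [1, 2]), (27, [1], [100]), (26, [100], [200]),
          (28, [2], [101]), (26, [101], [202]), (25, [200, 202], [201])])
    simp only
      [Tm.eval, sym_env, coreOps,  dims_cons, dims_nil, dim_env, List.getD_cons_zero, List.getD_cons_succ, List.cons_append, List.nil_append, add_zero, Nat.reduceLT, if_false, Nat.reduceSub]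
      at key
    exact key

theorem post_val {f : Mor} (h : BlackHom n m f) (x : Vec n) : (post h x).1 = x.1 ⟫ f := rfl

/-! ### Sums of basis vectors -/

/-- The tensor product with a zero as a homomorphism. -/
def zeroHom (n : ℕ) : Vec n →+ Vec (n + 1) := ⟨⟨zeroR, zeroR_zero⟩, zeroR_add⟩

/-- The tensor product with a one as a homomorphism. -/
def oneHom (n : ℕ) : Vec n →+ Vec (n + 1) := ⟨⟨oneR, oneR_zero⟩, oneR_add⟩

/-- The linear combinations of basis vectors with integer coefficients. -/
def span : (n : ℕ) → AddSubmonoid (Vec n)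
  | 0 => AddMonoidHom.mrange iota
  | n + 1 => (span n).map (zeroHom n) ⊔ (span n).map (oneHom n)

theorem mem_span_succ {x : Vec (n + 1)} :
    x ∈ span (n + 1) ↔ ∃ a ∈ span n, ∃ b ∈ span n, zeroR a + oneR b = x := by
  simp [span, AddSubmonoid.mem_sup, zeroHom, oneHom]

theorem zeroR_mem_span {x : Vec n} (h : x ∈ span n) : zeroR x ∈ span (n + 1) :=
  mem_span_succ.2 ⟨x, h, 0, zero_mem _, by rw [oneR_zero, add_zero]⟩

theorem oneR_mem_span {x : Vec n} (h : x ∈ span n) : oneR x ∈ span (n + 1) :=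
  mem_span_succ.2 ⟨0, zero_mem _, x, h, by rw [zeroR_zero, zero_add]⟩

theorem e_mem_span : e ∈ span 0 := ⟨1, iota_one⟩

theorem span_induction {p : (n : ℕ) → Vec n → Prop} (he : p 0 e)
    (hneg : ∀ n x, p n x → p n (neg x)) (hadd : ∀ n x y, p n x → p n y → p n (x + y))
    (hzero : ∀ n x, p n x → p (n + 1) (zeroR x)) (hone : ∀ n x, p n x → p (n + 1) (oneR x))
    {x : Vec n} (hx : x ∈ span n) : p n x := by
  induction n with
  | zero =>
    obtain ⟨z, rfl⟩ := hx
    exact iota_induction he (hneg 0) (hadd 0) z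
  | succ n ih =>
    obtain ⟨a, ha, b, hb, rfl⟩ := mem_span_succ.1 hx
    exact hadd _ _ _ (hzero _ _ (ih ha)) (hone _ _ (ih hb))

theorem linear_of_mem_span {x : Vec n} (hx : x ∈ span n) : Linear x :=
  span_induction (p := fun _ x => Linear x) Linear.e (fun _ _ h => h.neg) (fun _ _ _ h h' => h.add h')
    (fun _ _ h => h.zeroR) (fun _ _ h => h.oneR) hx

theorem unital_of_mem_span {x : Vec n} (hx : x ∈ span n) : Unital x :=
  span_induction (p := fun _ x => Unital x) Unital.e (fun _ _ h => h.neg) (fun _ _ _ h h' => h.add h')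
    (fun _ _ h => h.zeroR) (fun _ _ h => h.oneR) hx

theorem neg_mem_span {x : Vec n} (hx : x ∈ span n) : neg x ∈ span n := by
  induction n with
  | zero =>
    obtain ⟨z, rfl⟩ := hx
    exact ⟨-z, (neg_iota z).symm⟩
  | succ n ih =>
    obtain ⟨a, ha, b, hb, rfl⟩ := mem_span_succ.1 hx
    rw [neg_add, neg_zeroR, neg_oneR]
    exact add_mem (zeroR_mem_span (ih ha)) (oneR_mem_span (ih hb))

/-- Induction on y. The operations that build y commute with the tensor product; for sums this is
the linearity of elements of the span. -/
theorem star_mem_span {x : Vec n} {y : Vec m} (hx : x ∈ span n) (hy : y ∈ span m) :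
    star x y ∈ span (n + m) :=
  span_induction (p := fun m y => star x y ∈ span (n + m)) (by rw [star_e]; exact hx)
    (fun _ _ h => by rw [star_neg]; exact neg_mem_span h)
    (fun _ _ _ h h' => by rw [(linear_of_mem_span hx).star_add]; exact add_mem h h')
    (fun _ _ h => by rw [star_zeroR]; exact zeroR_mem_span h)
    (fun _ _ h => by rw [star_oneR]; exact oneR_mem_span h) hy

theorem one_mem_span : one ∈ span 1 := by
  have : oneR e = one := by
    apply Subtype.ext
    have hσ : (env [] (coreOps ++ [])).Typed (sig (coreSig ++ [])) := typed_core (by simp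
      [dims_cons, dims_nil, dim_env])
    rw [oneR_val, e, one]
    have key := eval_eq hσ (sym 18 ⊳ sym 19 * ids [0]) (ids [0]) ((Eqv.refl (L := [0]) (L' := [1])
      (P := [(18, [0], [2, 1]), (19, [2], [])]) hσ)
        |>.step hσ (e_c [] []) [] [(0, [0], [1])])
    simp only
      [Tm.eval, sym_env, coreOps,  dims_cons, dims_nil, dim_env, List.getD_cons_zero, List.getD_cons_succ, List.cons_append, List.nil_append, add_zero, Nat.reduceLT, if_false, Nat.reduceSub]
      at key
    exact key
  exact this ▸ oneR_mem_span e_mem_span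

/-! ### Permutations -/

theorem post_braid_zero_zero (x : Vec n) :
    post (.braid n) (zeroR (zeroR x)) = zeroR (zeroR x) := by
  apply Subtype.ext
  have hσ : (env [n] (coreOps ++ [x.1])).Typed (sig (coreSig ++ [([0], [1])])) := typed_core (by
    simp [dims_cons, dims_nil, dim_env, x.dom, x.cod])
  rw [post_val, zeroR_val, zeroR_val]
  have key := eq_of_same hσ (sym 24 * sym 15 * sym 15 ⊳ ids [1] * swap [0] [0]) (sym 24 * sym 15 *
    sym 15) [0]
  simp only
    [Tm.eval, sym_env, coreOps,  dims_cons, dims_nil, dim_env, List.getD_cons_zero, List.getD_cons_succ, List.cons_append, List.nil_append, add_zero, Nat.reduceLT, if_false, Nat.reduceSub]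
    at key
  exact key

theorem post_braid_zero_one (x : Vec n) :
    post (.braid n) (zeroR (oneR x)) = oneR (zeroR x) := by
  apply Subtype.ext
  have hσ : (env [n] (coreOps ++ [x.1])).Typed (sig (coreSig ++ [([0], [1])])) := typed_core (by
    simp [dims_cons, dims_nil, dim_env, x.dom, x.cod])
  rw [post_val, zeroR_val, oneR_val, oneR_val, zeroR_val]
  have key := eq_of_same hσ ((sym 18 ⊳ sym 24 * ids [0]) * sym 15 ⊳ ids [1] * swap [0] [0]) (sym
    18 ⊳ sym 24 * sym 15 * ids [0]) [0]
  simp only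
    [Tm.eval, sym_env, coreOps,  dims_cons, dims_nil, dim_env, List.getD_cons_zero, List.getD_cons_succ, List.cons_append, List.nil_append, add_zero, Nat.reduceLT, if_false, Nat.reduceSub]
    at key
  exact key

theorem post_braid_one_zero (x : Vec n) :
    post (.braid n) (oneR (zeroR x)) = zeroR (oneR x) := by
  apply Subtype.ext
  have hσ : (env [n] (coreOps ++ [x.1])).Typed (sig (coreSig ++ [([0], [1])])) := typed_core (by
    simp [dims_cons, dims_nil, dim_env, x.dom, x.cod])
  rw [post_val, zeroR_val, oneR_val, oneR_val, zeroR_val]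
  have key := eq_of_same hσ (sym 18 ⊳ sym 24 * sym 15 * ids [0] ⊳ ids [1] * swap [0] [0]) ((sym 18
    ⊳ sym 24 * ids [0]) * sym 15) [0]
  simp only
    [Tm.eval, sym_env, coreOps,  dims_cons, dims_nil, dim_env, List.getD_cons_zero, List.getD_cons_succ, List.cons_append, List.nil_append, add_zero, Nat.reduceLT, if_false, Nat.reduceSub]
    at key
  exact key

theorem post_braid_one_one (x : Vec n) :
    post (.braid n) (oneR (oneR x)) = oneR (oneR x) := by
  apply Subtype.ext
  have hσ : (env [n] (coreOps ++ [x.1])).Typed (sig (coreSig ++ [([0], [1])])) := typed_core (by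
    simp [dims_cons, dims_nil, dim_env, x.dom, x.cod])
  rw [post_val, oneR_val, oneR_val]
  have key := eval_eq hσ (sym 18 ⊳ (sym 18 ⊳ sym 24 * ids [0]) * ids [0] ⊳ ids [1] * swap [0] [0])
    (sym 18 ⊳ (sym 18 ⊳ sym 24 * ids [0]) * ids [0]) ((Eqv.refl (L := [0]) (L' := [101, 2, 3]) (P
    := [(18, [0], [1, 2]), (18, [1], [4, 3]), (24, [4], [101])]) hσ)
      |>.step hσ (c_assoc [n] [x.1]) [] [(18, [0], [1, 4]), (18, [4], [3, 2]), (24, [1], [101])]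
      |>.step hσ (c_comm [n] [x.1]) [(0, 4)] [(18, [0], [1, 4]), (24, [1], [101]),
        (18, [4], [2, 3])]
      |>.step hσ (c_assoc [n] [x.1]).symm [] [(18, [0], [1, 3]), (18, [1], [4, 2]),
        (24, [4], [101])])
  simp only
    [Tm.eval, sym_env, coreOps,  dims_cons, dims_nil, dim_env, List.getD_cons_zero, List.getD_cons_succ, List.cons_append, List.nil_append, add_zero, Nat.reduceLT, if_false, Nat.reduceSub]
    at key
  exact key

theorem post_mul_wr_zeroR {f : Mor} (h : BlackHom n m f) (x : Vec n) :
    post h.mul_wr (zeroR x) = zeroR (post h x) := by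
  apply Subtype.ext
  have hσ : (env [n, m] (coreOps ++ [x.1, f])).Typed (sig (coreSig ++ [([0], [1]), ([1], [2])]))
    := typed_core (by simp [dims_cons, dims_nil, dim_env, x.dom, x.cod, h.dom, h.cod])
  rw [post_val, zeroR_val, zeroR_val, post_val]
  have key := eq_of_same hσ (sym 24 * sym 15 ⊳ sym 25 * ids [0]) ((sym 24 ⊳ sym 25) * sym 15) [0]
  simp only
    [Tm.eval, sym_env, coreOps,  dims_cons, dims_nil, dim_env, List.getD_cons_zero, List.getD_cons_succ, List.cons_append, List.nil_append, add_zero, Nat.reduceLT, if_false, Nat.reduceSub]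
    at key
  exact key

theorem post_mul_wr_oneR {f : Mor} (h : BlackHom n m f) (x : Vec n) :
    post h.mul_wr (oneR x) = oneR (post h x) := by
  apply Subtype.ext
  have hσ : (env [n, m] (coreOps ++ [x.1, f])).Typed (sig (coreSig ++ [([0], [1]), ([1], [2])]))
    := typed_core (by simp [dims_cons, dims_nil, dim_env, x.dom, x.cod, h.dom, h.cod])
  rw [post_val, oneR_val, oneR_val, post_val]
  have key := eq_of_same hσ (sym 18 ⊳ sym 24 * ids [0] ⊳ sym 25 * ids [0]) (sym 18 ⊳ (sym 24 ⊳ sym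
    25) * ids [0]) [0]
  simp only
    [Tm.eval, sym_env, coreOps,  dims_cons, dims_nil, dim_env, List.getD_cons_zero, List.getD_cons_succ, List.cons_append, List.nil_append, add_zero, Nat.reduceLT, if_false, Nat.reduceSub]
    at key
  exact key

theorem post_eq_post {f g : Mor} (hf : BlackHom n m f) (hg : BlackHom n m g) (h : f = g) (x : Vec n) :
    post hf x = post hg x := by
  subst h; rfl

theorem post_braid_mem_span {x : Vec (n + 2)} (hx : x ∈ span (n + 2)) :
    post (.braid n) x ∈ span (n + 2) := by
  obtain ⟨a, ha, b, hb, rfl⟩ := mem_span_succ.1 hx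
  obtain ⟨a₀, ha₀, a₁, ha₁, rfl⟩ := mem_span_succ.1 ha
  obtain ⟨b₀, hb₀, b₁, hb₁, rfl⟩ := mem_span_succ.1 hb
  rw [zeroR_add, oneR_add, map_add, map_add, map_add, post_braid_zero_zero, post_braid_zero_one,
    post_braid_one_zero, post_braid_one_one]
  exact add_mem (add_mem (zeroR_mem_span (zeroR_mem_span ha₀)) (oneR_mem_span (zeroR_mem_span ha₁)))
    (add_mem (zeroR_mem_span (oneR_mem_span hb₀)) (oneR_mem_span (oneR_mem_span hb₁)))

theorem post_braid_at_mem_span {k l : ℕ} {x : Vec (k + 2 + l)} (hx : x ∈ span (k + 2 + l)) :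
    post (.braid_at k l) x ∈ span (k + 2 + l) := by
  induction l with
  | zero =>
    rw [post_eq_post _ (.braid k) (by rw [wr_zero, _root_.mul_one])]
    exact post_braid_mem_span hx
  | succ l ih =>
    rw [post_eq_post _ (BlackHom.braid_at k l).mul_wr (by rw [← wr_mul_wr l 1, ← mul_assoc])]
    obtain ⟨a, ha, b, hb, rfl⟩ := mem_span_succ.1 hx
    rw [map_add, post_mul_wr_zeroR (.braid_at k l), post_mul_wr_oneR (.braid_at k l)]
    exact add_mem (zeroR_mem_span (ih ha)) (oneR_mem_span (ih hb))

/-! ### Contraction -/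

/-- Joining the last two wires. -/
def contract (x : Vec (n + 2)) : Vec n := ⟨x.1 ⟫ (wr n * capM), by simp [x.dom, capM]⟩

theorem contract_val (x : Vec (n + 2)) : (contract x).1 = x.1 ⟫ (wr n * capM) := rfl

theorem contract_braid (x : Vec (n + 2)) : contract (post (.braid n) x) = contract x := by
  apply Subtype.ext
  have hσ : (env [n] (coreOps ++ [x.1])).Typed (sig (coreSig ++ [([0], [1, 0, 0])])) := typed_core
    (by simp [dims_cons, dims_nil, dim_env, x.dom, x.cod])
  rw [contract_val, contract_val, post_val]
  have key := eval_eq hσ (sym 24 ⊳ ids [1] * swap [0] [0] ⊳ ids [1] * sym 10) (sym 24 ⊳ ids [1] *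
    sym 10) ((Eqv.refl (L := [0]) (L' := [101]) (P := [(24, [0], [101, 1, 2]), (10, [2, 1], [])])
    hσ)
      |>.step hσ (cap_comm [n] [x.1]) [] [(24, [0], [101, 1, 2]), (10, [1, 2], [])])
  simp only
    [Tm.eval, sym_env, coreOps,  dims_cons, dims_nil, dim_env, List.getD_cons_zero, List.getD_cons_succ, List.cons_append, List.nil_append, add_zero, Nat.reduceLT, if_false, Nat.reduceSub]
    at key
  exact key

/-- The zeros are units for μ, so on the last two wires the cap sees only y. -/
theorem contract_zero_zero_add (x : Vec n) (y : Vec (n + 2)) :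
    contract (zeroR (zeroR x) + y) = x + contract y := by
  apply Subtype.ext
  have hσ : (env [n] (coreOps ++ [muB n, x.1, y.1])).Typed (sig (coreSig ++ [([1, 1], [1]),
    ([0], [1]), ([0], [1, 0, 0])])) := typed_core (by simp
    [dims_cons, dims_nil, dim_env, x.dom, x.cod, y.dom, y.cod])
  rw [contract_val, add_val, zeroR_val, zeroR_val, add_val, contract_val, muB, muB]
  have key := eval_eq hσ (sym 16 ⊳ sym 25 * sym 15 * sym 15 * sym 26 ⊳ (ids [1, 0] * swap [0]
    [1, 0] * ids [0] ⊳ (ids [1] * swap [0] [1] * ids [0] ⊳ sym 24 * sym 14) * sym 14) ⊳ ids [1] *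
    sym 10) (sym 16 ⊳ sym 25 * (sym 26 ⊳ ids [1] * sym 10) ⊳ sym 24) ((Eqv.refl (L := [0]) (L' :=
    [101]) (P := [(16, [0], [1, 2]), (25, [1], [100]), (15, [], [3]), (15, [], [4]),
    (26, [2], [102, 5, 6]), (24, [100, 102], [101]), (14, [3, 5], [7]), (14, [4, 6], [8]),
    (10, [7, 8], [])]) hσ)
      |>.step hσ (eta_mu [n] [muB n, x.1, y.1]) [(0, 6)] [(16, [0], [1, 2]), (25, [1], [100]),
        (15, [], [3]), (26, [2], [102, 4, 5]), (24, [100, 102], [101]), (14, [3, 4], [6]),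
        (10, [6, 5], [])]
      |>.step hσ (eta_mu [n] [muB n, x.1, y.1]) [] [(16, [0], [1, 2]), (25, [1], [100]),
        (26, [2], [102, 3, 4]), (10, [3, 4], []), (24, [100, 102], [101])])
  simp only
    [Tm.eval, sym_env, coreOps,  dims_cons, dims_nil, dim_env, List.getD_cons_zero, List.getD_cons_succ, List.cons_append, List.nil_append, add_zero, Nat.reduceLT, if_false, Nat.reduceSub]
    at key
  exact key

/-- One joined wire carries the bit of the branch of x, multiplied with a wire of y; the other
carries the bit of the branch of y. The cap turns this μ into δ, and `delta_cut` disconnects x,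
which is left with input |0⟩. By unitality x then contributes only the unit of `muB`. -/
theorem contract_zero_one_add {x : Vec n} (hx : Unital x) (y : Vec (n + 1)) :
    contract (zeroR (oneR x) + oneR y) = contract (oneR y) := by
  apply Subtype.ext
  have hσ : (env [n] (coreOps ++ [muB n, etaB n, x.1, y.1])).Typed (sig (coreSig ++
    [([1, 1], [1]), ([], [1]), ([0], [1]), ([0], [1, 0])])) := typed_core (by simp
    [dims_cons, dims_nil, dim_env, x.dom, x.cod, y.dom, y.cod])
  rw [contract_val, add_val, zeroR_val, oneR_val, oneR_val, contract_val, oneR_val, muB, muB]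
  have h := eqv hσ (ids [1] * sym 25 ⊳ sym 24) (ids [1]) [100] [(25, [], [102]),
    (24, [100, 102], [101])] [(1, [100], [101])] [101] (muB_unit n)
  have hh := eqv hσ (swap [1] [1] ⊳ sym 24) (sym 24) [100, 101] [(24, [101, 100], [102])]
    [(24, [100, 101], [102])] [102] (muB_comm n)
  have hd := eqv hσ (sym 15 ⊳ sym 26) (sym 25) [] [(15, [], [0]), (26, [0], [100])]
    [(25, [], [100])] [100] (hx)
  have key := eval_eq hσ (sym 16 ⊳ (sym 18 ⊳ sym 26 * ids [0]) * sym 15 * (sym 18 ⊳ sym 27 * ids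
    [0]) ⊳ (ids [1, 0] * swap [0] [1, 0] * ids [0] ⊳ (ids [1] * swap [0] [1] * ids [0] ⊳ sym 24 *
    sym 14) * sym 14) ⊳ ids [1] * sym 10) (sym 18 ⊳ sym 27 * ids [0] ⊳ ids [1] * sym 10)
    ((Eqv.refl (L := [0]) (L' := [101]) (P := [(16, [0], [1, 2]), (18, [1], [3, 4]),
    (26, [3], [100]), (15, [], [5]), (18, [2], [6, 7]), (27, [6], [102, 8]),
    (24, [100, 102], [101]), (14, [4, 8], [9]), (14, [5, 7], [10]), (10, [9, 10], [])]) hσ)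
      |>.step hσ (eta_mu [n] [muB n, etaB n, x.1, y.1]) [] [(16, [0], [1, 2]), (18, [1], [3, 4]),
        (26, [3], [100]), (18, [2], [5, 6]), (27, [5], [102, 7]), (24, [100, 102], [101]),
        (14, [4, 7], [8]), (10, [8, 6], [])]
      |>.step hσ (cap_comm [n] [muB n, etaB n, x.1, y.1]) [] [(16, [0], [1, 2]),
        (18, [1], [3, 4]), (26, [3], [100]), (18, [2], [5, 6]), (27, [5], [102, 7]),
        (24, [100, 102], [101]), (14, [4, 7], [8]), (10, [6, 8], [])]
      |>.step hσ (delta_cap [n] [muB n, etaB n, x.1, y.1]).symm [] [(16, [0], [1, 2]),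
        (18, [1], [3, 4]), (26, [3], [100]), (18, [2], [5, 6]), (27, [5], [102, 7]),
        (24, [100, 102], [101]), (16, [6], [8, 9]), (10, [8, 4], []), (10, [9, 7], [])]
      |>.step hσ (cap_comm [n] [muB n, etaB n, x.1, y.1]) [(0, 7)] [(16, [0], [1, 2]),
        (18, [1], [3, 4]), (26, [3], [100]), (18, [2], [5, 6]), (27, [5], [102, 7]),
        (24, [100, 102], [101]), (16, [6], [8, 9]), (10, [8, 4], []), (10, [7, 9], [])]
      |>.step hσ (cap_comm [n] [muB n, etaB n, x.1, y.1]) [] [(16, [0], [1, 2]),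
        (18, [1], [3, 4]), (26, [3], [100]), (18, [2], [5, 6]), (27, [5], [102, 7]),
        (24, [100, 102], [101]), (16, [6], [8, 9]), (10, [7, 9], []), (10, [4, 8], [])]
      |>.step hσ (delta_comm [n] [muB n, etaB n, x.1, y.1]) [(0, 6)] [(16, [0], [1, 2]),
        (18, [1], [3, 4]), (26, [3], [100]), (18, [2], [5, 6]), (27, [5], [102, 7]),
        (24, [100, 102], [101]), (16, [6], [8, 9]), (10, [7, 8], []), (10, [4, 9], [])]
      |>.step hσ (delta_cut [n] [muB n, etaB n, x.1, y.1]) [] [(15, [], [1]), (18, [0], [2, 3]),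
        (26, [1], [100]), (27, [2], [102, 4]), (24, [100, 102], [101]), (10, [4, 3], [])]
      |>.step hσ hd [] [(18, [0], [1, 2]), (27, [1], [100, 3]), (10, [3, 2], []), (25, [], [102]),
        (24, [102, 100], [101])]
      |>.step hσ hh [] [(18, [0], [1, 2]), (27, [1], [100, 3]), (10, [3, 2], []), (25, [], [102]),
        (24, [100, 102], [101])]
      |>.step hσ h [] [(18, [0], [1, 2]), (27, [1], [101, 3]), (10, [3, 2], [])])
  simp only
    [Tm.eval, sym_env, coreOps,  dims_cons, dims_nil, dim_env, List.getD_cons_zero, List.getD_cons_succ, List.cons_append, List.nil_append, add_zero, Nat.reduceLT, if_false, Nat.reduceSub]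
    at key
  exact key

theorem contract_one_one (x : Vec n) : contract (oneR (oneR x)) = x := by
  apply Subtype.ext
  have hσ : (env [n] (coreOps ++ [x.1])).Typed (sig (coreSig ++ [([0], [1])])) := typed_core (by
    simp [dims_cons, dims_nil, dim_env, x.dom, x.cod])
  rw [contract_val, oneR_val, oneR_val]
  have key := eval_eq hσ (sym 18 ⊳ (sym 18 ⊳ sym 24 * ids [0]) * ids [0] ⊳ ids [1] * sym 10) (sym
    24) ((Eqv.refl (L := [0]) (L' := [101]) (P := [(18, [0], [1, 2]), (18, [1], [3, 4]),
    (24, [3], [101]), (10, [4, 2], [])]) hσ)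
      |>.step hσ (c_assoc [n] [x.1]) [] [(18, [0], [1, 2]), (18, [2], [3, 4]), (24, [1], [101]),
        (10, [3, 4], [])]
      |>.step hσ (c_loop [n] [x.1]) [(0, 2)] [(18, [0], [1, 2]), (24, [1], [101]), (19, [2], [])]
      |>.step hσ (c_e [n] [x.1]) [] [(24, [0], [101])])
  simp only
    [Tm.eval, sym_env, coreOps,  dims_cons, dims_nil, dim_env, List.getD_cons_zero, List.getD_cons_succ, List.cons_append, List.nil_append, add_zero, Nat.reduceLT, if_false, Nat.reduceSub]
    at key
  exact key

/-- The cap is not a homomorphism for μ in the interpretation (|10⟩ and |01⟩ multiply to |11⟩), so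
`post` does not apply. Splitting off the last two bits leaves four terms: the mixed ones vanish,
those for 00 and 11 survive. -/
theorem contract_mem_span {x : Vec (n + 2)} (hx : x ∈ span (n + 2)) : contract x ∈ span n := by
  obtain ⟨a, ha, b, hb, rfl⟩ := mem_span_succ.1 hx
  obtain ⟨a₀, ha₀, a₁, ha₁, rfl⟩ := mem_span_succ.1 ha
  obtain ⟨b₀, hb₀, b₁, hb₁, rfl⟩ := mem_span_succ.1 hb
  -- The second mixed term becomes the first one after exchanging the two wires, which the symmetric
  -- cap does not notice.
  have h : contract (oneR (zeroR b₀ + oneR b₁)) = b₁ := by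
    rw [← contract_braid, oneR_add, map_add, post_braid_one_zero, post_braid_one_one,
      contract_zero_one_add (unital_of_mem_span hb₀), contract_one_one]
  rw [zeroR_add, add_assoc, contract_zero_zero_add, contract_zero_one_add (unital_of_mem_span ha₁), h]
  exact add_mem ha₀ hb₁

end Vec

/-! ### The vertices as combinations of basis vectors. -/

theorem one_c (d : List ℕ) (o : List Mor) : (env d (coreOps ++ o)).Eqv [] [(22, [], [2]),
  (18, [2], [0, 1])] [(22, [], [0]), (22, [], [1])] [0, 1] :=
  (Eqv.refl typed_coreOps)
      |>.unnorm typed_coreOps [(22, [], [2]), (0, [2], [3]), (18, [3], [0, 1])]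
      |>.step typed_coreOps (x_x d o).symm [] [(22, [], [2]), (12, [2], [3]), (12, [3], [4]),
        (18, [4], [0, 1])]
      |>.step typed_coreOps (x_c d o) [(0, 3)] [(22, [], [2]), (12, [2], [3]), (18, [3], [4, 5]),
        (12, [4], [0]), (12, [5], [1])]
      |>.step typed_coreOps (one_x d o) [] [(15, [], [2]), (18, [2], [3, 4]), (12, [3], [0]),
        (12, [4], [1])]
      |>.step typed_coreOps (eta_c d o) [] [(15, [], [2]), (15, [], [3]), (12, [2], [0]),
        (12, [3], [1])]
      |>.step typed_coreOps (one_x d o).symm [] [(15, [], [2]), (12, [2], [1]), (22, [], [3]),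
        (12, [3], [4]), (12, [4], [0])]
      |>.step typed_coreOps (one_x d o).symm [] [(22, [], [2]), (12, [2], [3]), (12, [3], [0]),
        (22, [], [4]), (12, [4], [5]), (12, [5], [1])]
      |>.step typed_coreOps (x_x d o) [(0, 4)] [(22, [], [2]), (12, [2], [3]), (12, [3], [0]),
        (22, [], [1])]
      |>.step typed_coreOps (x_x d o) [] [(22, [], [0]), (22, [], [1])]

theorem bcom_add (n m : ℕ) : bcom 2 ⟫ (bcom n * bcom m) = bcom (n + m) := by
  simpa only [bcom_eq] using spider_black.comul_add n m

theorem bcom_one : bcom 1 = wr 1 := (bcom_eq 1).trans spider_black.comul_one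

theorem wcom_add (n m : ℕ) : wcom 2 ⟫ (wcom n * wcom m) = wcom (n + m) := by
  simpa only [wcom_eq] using spider_white.comul_add n m

theorem wcom_one : wcom 1 = wr 1 := (wcom_eq 1).trans spider_white.comul_one

/-- The binary black vertex is a cup with X on one leg, and XX = id. The cup thereby reduces to
vertices. -/
theorem one_delta_x : blackM 1 ⟫ bcom 2 ⟫ (wr 1 * xM) = cupM := by
  rw [bcom_eq, ← spider_black.eq_comul, spider_black.two_eq, comp_assoc (by rfl) (by rfl),
    ← wr_mul_comp _ (by rfl), spider_black.inv, wr_mul_wr]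
  exact comp_wr rfl

theorem cup_black_x (d : List ℕ) (o : List Mor) : (env d (coreOps ++ o)).Eqv [] [(22, [], [2]),
  (16, [2], [0, 3]), (12, [3], [1])] [(11, [], [0, 1])] [0, 1] :=
  eqv typed_coreOps (sym 22 ⊳ sym 16 ⊳ ids [0] * sym 12) (sym 11) _ _ _ _ (one_delta_x)

namespace Vec
variable {n m : ℕ}

/-- The vector of the black comultiplication. -/
def black (n : ℕ) : Vec n := ⟨bcom n, by simp⟩

/-- The vector of the white comultiplication. -/
def white (n : ℕ) : Vec n := ⟨wcom n, by simp⟩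

theorem black_val (n : ℕ) : (black n).1 = bcom n := rfl
theorem white_val (n : ℕ) : (white n).1 = wcom n := rfl

/-- The basis vector with all bits equal to zero. -/
def zeros (n : ℕ) : Vec n := ⟨wcom 0 * etaB n, by simp⟩

theorem zeros_zero : zeros 0 = e := Subtype.ext (_root_.mul_one _)

theorem zeros_succ (n : ℕ) : zeros (n + 1) = zeroR (zeros n) := Subtype.ext (mul_assoc _ _ _).symm

theorem zeros_mem_span (n : ℕ) : zeros n ∈ span n := by
  induction n with
  | zero => exact zeros_zero ▸ e_mem_span
  | succ n ih => exact zeros_succ n ▸ zeroR_mem_span ih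

theorem black_zero : black 0 = 0 := Subtype.ext (comp_wr rfl).symm

/-- Either the last wire carries the single 1 of δ or one of the first n does. Diagrammatically,
units and counits disappear and `bcom_add` remains. -/
theorem black_succ (n : ℕ) : black (n + 1) = zeroR (black n) + oneR (zeros n) := by
  apply Subtype.ext
  have hσ : (env [n] (coreOps ++ [muB n, etaB n, bcom n])).Typed (sig (coreSig ++ [([1, 1], [1]),
    ([], [1]), ([0], [1])])) := typed_core (by simp [dims_cons, dims_nil, dim_env])
  have h := eqv hσ (ids [1] * sym 25 ⊳ sym 24) (ids [1]) [100] [(25, [], [102]),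
    (24, [100, 102], [101])] [(1, [100], [101])] [101] (muB_unit n)
  rw [add_val, zeroR_val, oneR_val, black_val, black_val, zeros, muB, ← bcom_add n 1, bcom_one]
  have key := eval_eq hσ (sym 16 ⊳ sym 26 * sym 15 * (sym 18 ⊳ sym 19 * sym 25 * ids [0]) ⊳ (ids
    [1] * swap [0] [1] * ids [0] ⊳ sym 24 * sym 14)) (sym 16 ⊳ sym 26 * ids [0]) ((Eqv.refl (L :=
    [0]) (L' := [101, 2]) (P := [(16, [0], [1, 3]), (26, [1], [100]), (15, [], [4]),
    (18, [3], [5, 6]), (19, [5], []), (25, [], [102]), (24, [100, 102], [101]),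
    (14, [4, 6], [2])]) hσ)
      |>.step hσ (e_c [n] [muB n, etaB n, bcom n]) [] [(16, [0], [1, 3]), (26, [1], [100]),
        (15, [], [4]), (25, [], [102]), (24, [100, 102], [101]), (14, [4, 3], [2])]
      |>.step hσ (eta_mu [n] [muB n, etaB n, bcom n]) [] [(16, [0], [1, 2]), (26, [1], [100]),
        (25, [], [102]), (24, [100, 102], [101])]
      |>.step hσ h [] [(16, [0], [1, 2]), (26, [1], [101])])
  simp only
    [Tm.eval, sym_env, coreOps,  dims_cons, dims_nil, dim_env, List.getD_cons_zero, List.getD_cons_succ, List.cons_append, List.nil_append, add_zero, Nat.reduceLT, if_false, Nat.reduceSub]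
    at key
  exact Eq.symm key

theorem black_mem_span (n : ℕ) : black n ∈ span n := by
  induction n with
  | zero => exact black_zero ▸ zero_mem _
  | succ n ih => exact black_succ n ▸ add_mem (zeroR_mem_span ih) (oneR_mem_span (zeros_mem_span n))

theorem white_succ (n : ℕ) : white (n + 1) = oneR (white n) := by
  apply Subtype.ext
  rw [oneR_val, white_val, white_val, ← wcom_add n 1, wcom_one]

theorem white_mem_span (n : ℕ) : white n ∈ span n := by
  induction n with
  | zero => exact e_mem_span
  | succ n ih => exact white_succ n ▸ oneR_mem_span ih

/-- The summand `zeros n` contributes only the counit e on one leg of δ. This counit absorbs an X,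
after which |1⟩, δ and X form a cup; the cup with e is the unit z of w, and z followed by S is the
unary white vertex. -/
theorem whiteM_eq (n : ℕ) : whiteM n = blackM 1 ⟫ (zeros n + neg (white n)).1 := by
  have hσ : (env [n] (coreOps ++ [muB n, etaB n, wcom n])).Typed (sig (coreSig ++ [([1, 1], [1]),
    ([], [1]), ([0], [1])])) := typed_core (by simp [dims_cons, dims_nil, dim_env])
  have h := eqv hσ (ids [1] * sym 25 ⊳ sym 24) (ids [1]) [100] [(25, [], [102]),
    (24, [100, 102], [101])] [(1, [100], [101])] [101] (muB_unit n)
  have hh := eqv hσ (swap [1] [1] ⊳ sym 24) (sym 24) [100, 101] [(24, [101, 100], [102])]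
    [(24, [100, 101], [102])] [102] (muB_comm n)
  rw [(spider_white.eq_comul n).trans (congrArg _ (wcom_eq n).symm),
    ← whiteM_sM, add_val, neg_val, white, zeros]
  have key := eval_eq hσ (sym 22 ⊳ (sym 16 ⊳ sym 19 * sym 25 * (sym 13 ⊳ sym 26) ⊳ sym 24)) (sym
    23 ⊳ sym 13 ⊳ sym 26) ((Eqv.refl (L := []) (L' := [100]) (P := [(22, [], [0]),
    (16, [0], [1, 2]), (19, [1], []), (25, [], [101]), (13, [2], [3]), (26, [3], [102]),
    (24, [101, 102], [100])]) hσ)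
      |>.step hσ hh [] [(22, [], [0]), (16, [0], [1, 2]), (19, [1], []), (25, [], [101]),
        (13, [2], [3]), (26, [3], [102]), (24, [102, 101], [100])]
      |>.step hσ h [] [(22, [], [0]), (16, [0], [1, 2]), (19, [1], []), (13, [2], [3]),
        (26, [3], [100])]
      |>.step hσ (x_e [n] [muB n, etaB n, wcom n]).symm [] [(22, [], [0]), (16, [0], [1, 2]),
        (13, [2], [3]), (26, [3], [100]), (12, [1], [4]), (19, [4], [])]
      |>.step hσ (delta_comm [n] [muB n, etaB n, wcom n]) [] [(22, [], [0]), (16, [0], [1, 2]),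
        (13, [1], [3]), (26, [3], [100]), (12, [2], [4]), (19, [4], [])]
      |>.step hσ (cup_black_x [n] [muB n, etaB n, wcom n]) [] [(11, [], [0, 1]), (13, [0], [2]),
        (26, [2], [100]), (19, [1], [])]
      |>.step hσ (cup_comm [n] [muB n, etaB n, wcom n]) [] [(11, [], [0, 1]), (13, [1], [2]),
        (26, [2], [100]), (19, [0], [])]
      |>.step hσ (z_def [n] [muB n, etaB n, wcom n]).symm [] [(23, [], [0]), (13, [0], [1]),
        (26, [1], [100])])
  simp only
    [Tm.eval, sym_env, coreOps,  dims_cons, dims_nil, dim_env, List.getD_cons_zero, List.getD_cons_succ, List.cons_append, List.nil_append, add_zero, Nat.reduceLT, if_false, Nat.reduceSub]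
    at key
  exact Eq.symm key

end Vec

/-! ### States -/

/-- The states of the form `∑ x, ψ x • |x⟩`. -/
def IsState (n : ℕ) (s : Mor) : Prop := ∃ x ∈ Vec.span n, s = blackM 1 ⟫ x.1

theorem IsState.dom {n : ℕ} {s : Mor} (h : IsState n s) : s.dom = 0 := by
  obtain ⟨x, -, rfl⟩ := h
  simp

theorem IsState.cod {n : ℕ} {s : Mor} (h : IsState n s) : s.cod = n := by
  obtain ⟨x, -, rfl⟩ := h
  simp [x.cod]

/-- The two copies of |1⟩ are obtained from one by c (`one_c`), so juxtaposition of states is the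
tensor product of vectors. -/
theorem IsState.mul {n m : ℕ} {s t : Mor} (hs : IsState n s) (ht : IsState m t) :
    IsState (n + m) (s * t) := by
  obtain ⟨x, hx, rfl⟩ := hs
  obtain ⟨y, hy, rfl⟩ := ht
  refine ⟨x.star y, Vec.star_mem_span hx hy, ?_⟩
  have hσ : (env [n, m] (coreOps ++ [x.1, y.1])).Typed (sig (coreSig ++ [([0], [1]), ([0], [2])]))
    := typed_core (by simp [dims_cons, dims_nil, dim_env, x.dom, x.cod, y.dom, y.cod])
  rw [Vec.star_val]
  have key := eval_eq hσ ((sym 22 ⊳ sym 24) * (sym 22 ⊳ sym 25)) (sym 22 ⊳ (sym 18 ⊳ sym 24 * sym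
    25)) ((Eqv.refl (L := []) (L' := [100, 201]) (P := [(22, [], [0]), (24, [0], [100]),
    (22, [], [1]), (25, [1], [201])]) hσ)
      |>.step hσ (one_c [n, m] [x.1, y.1]).symm [] [(22, [], [0]), (18, [0], [1, 2]),
        (24, [1], [100]), (25, [2], [201])])
  simp only
    [Tm.eval, sym_env, coreOps,  dims_cons, dims_nil, dim_env, List.getD_cons_zero, List.getD_cons_succ, List.cons_append, List.nil_append, add_zero, Nat.reduceLT, if_false, Nat.reduceSub]
    at key
  exact key

theorem IsState.contract {n : ℕ} {s : Mor} (hs : IsState (n + 2) s) :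
    IsState n (s ⟫ (wr n * capM)) := by
  obtain ⟨x, hx, rfl⟩ := hs
  exact ⟨x.contract, Vec.contract_mem_span hx, comp_assoc (by simp [x.dom]) (by simp [x.cod, capM])⟩

theorem IsState.braid_at {k l : ℕ} {s : Mor} (hs : IsState (k + 2 + l) s) :
    IsState (k + 2 + l) (s ⟫ (wr k * br 1 1 * wr l)) := by
  obtain ⟨x, hx, rfl⟩ := hs
  exact ⟨_, Vec.post_braid_at_mem_span hx, comp_assoc (by simp [x.dom]) (by simp [x.cod])⟩

theorem isState_one : IsState 0 1 := by
  refine ⟨_, Vec.e_mem_span, ?_⟩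
  rw [Vec.e]
  have hσ : (env [] (coreOps ++ [])).Typed (sig (coreSig ++ [])) := typed_core (by simp
    [dims_cons, dims_nil, dim_env])
  rw [← wr_zero]
  have key := eval_eq hσ (sym 22 ⊳ sym 19) (ids []) ((Eqv.refl (L := []) (L' := []) (P :=
    [(22, [], [0]), (19, [0], [])]) hσ)
      |>.unnorm hσ [(22, [], [0]), (0, [0], [1]), (19, [1], [])]
      |>.step hσ (x_x [] []).symm [] [(22, [], [0]), (12, [0], [1]), (12, [1], [2]),
        (19, [2], [])]
      |>.step hσ (x_e [] []) [(0, 1)] [(22, [], [0]), (12, [0], [1]), (19, [1], [])]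
      |>.step hσ (one_x [] []) [] [(15, [], [0]), (19, [0], [])]
      |>.step hσ (eta_e [] []) [] [])
  simp only
    [Tm.eval, sym_env, coreOps,  dims_cons, dims_nil, dim_env, List.getD_cons_zero, List.getD_cons_succ, List.cons_append, List.nil_append, add_zero, Nat.reduceLT, if_false, Nat.reduceSub]
    at key
  exact Eq.symm key

theorem isState_blackM (n : ℕ) : IsState n (blackM n) :=
  ⟨_, Vec.black_mem_span n, (spider_black.eq_comul n).trans (congrArg _ (bcom_eq n).symm)⟩

theorem isState_whiteM (n : ℕ) : IsState n (whiteM n) :=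
  ⟨_, add_mem (Vec.zeros_mem_span n) (Vec.neg_mem_span (Vec.white_mem_span n)), Vec.whiteM_eq n⟩

/-- The morphism preserves states. -/
def Good (f : Mor) : Prop :=
  -- Spectator wires on both sides make the property stable under juxtaposition.
  ∀ k l s, IsState (k + f.dom + l) s → IsState (k + f.cod + l) (s ⟫ (wr k * f * wr l))

namespace Good
variable {f g : Mor}

theorem comp (hf : Good f) (hg : Good g) (h : f.cod = g.dom) : Good (f ⟫ g) := by
  intro k l s hs
  rw [comp_dom] at hs
  have h₁ := hf k l s hs
  rw [h] at h₁
  have h₂ := hg k l _ h₁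
  rw [comp_cod]
  rwa [comp_assoc (by rw [hs.cod]; rfl) (by simp [h]), ← comp_mul_wr _ (by simp [h]), ← wr_mul_comp _ h] at h₂

theorem wr_mul (hf : Good f) (j : ℕ) : Good (wr j * f) := by
  intro k l s hs
  have := hf (k + j) l s (by simpa [add_assoc] using hs)
  simpa [← wr_mul_wr, mul_assoc, add_assoc] using this

theorem mul_wr (hf : Good f) (j : ℕ) : Good (f * wr j) := by
  intro k l s hs
  have := hf k (j + l) s (by simpa [add_assoc] using hs)
  simpa [← wr_mul_wr, mul_assoc, add_assoc] using this

theorem wr (n : ℕ) : Good (wr n) := by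
  intro k l s hs
  rwa [wr_mul_wr, wr_mul_wr, comp_wr (by rw [hs.cod]; rfl)]

theorem mul (hf : Good f) (hg : Good g) : Good (f * g) := by
  rw [← mul_wr_comp_wr_mul rfl rfl]
  exact (hf.mul_wr _).comp (hg.wr_mul _) (by simp)

theorem br_one_one : Good (br 1 1) := fun _ _ _ hs => hs.braid_at

theorem br_one (a : ℕ) : Good (br a 1) := by
  induction a with
  | zero => rw [br_zero_left]; exact wr 1
  | succ a ih =>
    rw [br_add_left]
    exact (br_one_one.wr_mul a).comp (ih.mul_wr 1) (by simp)

theorem br (a b : ℕ) : Good (br a b) := by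
  induction b with
  | zero => rw [br_zero_right]; exact wr a
  | succ b ih =>
    rw [br_add_right]
    exact (ih.mul_wr 1).comp ((br_one a).wr_mul b) (by simp; omega)

/-- Conjugation by braidings, already known to preserve states, moves the right spectators to the
left. -/
theorem of_right (h : ∀ k s, IsState (k + f.dom) s → IsState (k + f.cod) (s ⟫ (Mor.wr k * f))) :
    Good f := by
  intro k l s hs
  have h₁ := Good.br f.dom l k 0 s (by simpa [add_assoc] using hs)
  have h₂ := h (k + l) _ (by simpa [add_assoc] using h₁)
  have h₃ := Good.br l f.cod k 0 _ (by simpa [add_assoc] using h₂)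
  have e : Mor.br f.dom l ⟫ (Mor.wr l * f) ⟫ Mor.br l f.cod = f * Mor.wr l := by
    have := br_natural f (Mor.wr l)
    rw [wr_cod, wr_dom] at this
    rw [← this, comp_assoc (by simp) (by simp), br_comp_br, comp_wr (by simp)]
  rw [mul_assoc, ← e, wr_mul_comp _ (by simp), wr_mul_comp _ (by simp),
    ← comp_assoc (by simp [hs.cod, add_assoc]) (by simp),
    ← comp_assoc (by simp [hs.cod, add_assoc]) (by simp)]
  simpa [← wr_mul_wr, wr_zero, add_assoc, mul_assoc] using h₃

theorem of_state {n : ℕ} {t : Mor} (h : IsState n t) : Good t := by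
  apply of_right
  intro k s hs
  rw [h.dom, add_zero] at hs
  have e : s ⟫ (Mor.wr k * t) = s * t := by
    have := mul_wr_comp_wr_mul (f := s) (g := t) (a := 0) (b := k) h.dom.symm hs.cod.symm
    rwa [wr_zero, mul_one] at this
  rw [e, h.cod]
  exact hs.mul h

theorem capM : Good capM := of_right fun _ _ hs => hs.contract

theorem blackM (n : ℕ) : Good (blackM n) := of_state (isState_blackM n)

theorem whiteM (n : ℕ) : Good (whiteM n) := of_state (isState_whiteM n)

theorem capsM (n : ℕ) : Good (capsM n) := by
  induction n with
  | zero => exact wr 0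
  | succ n ih =>
    rw [capsM_succ]
    exact (((br 1 n).wr_mul n).mul_wr 1).comp (ih.mul capM) (by simp; omega)

theorem bendM {n m : ℕ} (hf : Good f) (h : f.cod = n + m) : Good (bendM n m f) :=
  (hf.wr_mul n).comp ((capsM n).mul_wr m) (by simp [h, add_assoc])

theorem xM : Good xM := by rw [spider_black.bin]; exact (blackM 2).bendM rfl

theorem sM : Good sM := by rw [spider_white.bin]; exact (whiteM 2).bendM rfl

theorem bmul (n : ℕ) : Good (bmul n) := by
  rw [bmul_eq]
  exact ((blackM _).bendM rfl).comp xM (by simp)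

theorem bcom (n : ℕ) : Good (bcom n) := by
  rw [bcom_eq]
  exact xM.comp ((blackM _).bendM rfl) (bendM_dom rfl).symm

end Good

/-! ### All diagrams preserve states -/

/-- This is `cross_eq` as an equation of morphisms; its right-hand side contains only operations
already known to preserve states. -/
theorem crossM_eq : crossM = (bcom 2 * bcom 2) ⟫ (wr 1 * (bmul 2 ⟫ bcom 2) * wr 1) ⟫
    (sM * wr 2 * sM) ⟫ (bmul 2 * bmul 2) := by
  have hσ : (env [] (coreOps ++ [])).Typed (sig (coreSig ++ [])) := typed_core (by simp
    [dims_cons, dims_nil, dim_env])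
  have key := eval_eq hσ (sym 16 * sym 16 ⊳ ids [0] * (sym 14 ⊳ sym 16) * ids [0] ⊳ sym 13 * ids
    [0, 0] * sym 13 ⊳ sym 14 * sym 14) (sym 21) ((Eqv.refl (L := [0, 1]) (L' := [2, 3]) (P :=
    [(16, [0], [4, 5]), (16, [1], [6, 7]), (14, [5, 6], [8]), (16, [8], [9, 10]), (13, [4], [11]),
    (13, [7], [12]), (14, [11, 9], [2]), (14, [10, 12], [3])]) hσ)
      |>.step hσ (cross_eq [] []) [] [(21, [0, 1], [2, 3])])
  simp only
    [Tm.eval, sym_env, coreOps,  dims_cons, dims_nil, dim_env, List.getD_cons_zero, List.getD_cons_succ, List.cons_append, List.nil_append, add_zero, Nat.reduceLT, if_false, Nat.reduceSub]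
    at key
  exact Eq.symm key

theorem Good.crossM : Good crossM := by
  rw [crossM_eq]
  exact ((((Good.bcom 2).mul (.bcom 2)).comp
    (((((Good.bmul 2).comp (.bcom 2) rfl).wr_mul 1).mul_wr 1)) rfl).comp
    ((Good.sM.mul_wr 2).mul .sM) rfl).comp ((Good.bmul 2).mul (.bmul 2)) rfl

theorem Good.cupM : Good cupM := by
  rw [← one_delta_x]
  exact ((Good.blackM 1).comp (.bcom 2) rfl).comp (Good.xM.wr_mul 1) rfl

theorem good_mor {n m : ℕ} (G : Diagram n m) : Good G.mor := by
  induction G with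
  | wires n => exact .wr n
  | comp f g hf hg => rw [mor_comp]; exact hf.comp hg rfl
  | tensor f g hf hg => exact hf.mul hg
  | braid a b => exact .br a b
  | cup => exact .cupM
  | cap => exact .capM
  | black n => exact .blackM n
  | white n => exact .whiteM n
  | cross => exact .crossM

/-- By zigzag, G is the bending of the state made of cups with G on half of their legs. That state
is itself a diagram applied to the empty state, hence good. -/
theorem exists_bendM_eq {n m : ℕ} (G : Diagram n m) :
    ∃ s, IsState (n + m) s ∧ G.mor = bendM n m s := by
  refine ⟨cupsM n ⟫ (wr n * G.mor), ?_, (bendM_cups rfl rfl).symm⟩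
  have h : Good (cupsM n ⟫ (wr n * G.mor)) := (good_mor (cups n)).comp ((good_mor G).wr_mul n) rfl
  -- No spectators, applied to the empty diagram as a state on no wires.
  have := h 0 0 1 (by simpa [cupsM] using isState_one)
  have e : (cupsM n ⟫ (wr n * G.mor)).dom = 0 := by simp [cupsM]
  rw [wr_zero, one_mul, mul_one, ← wr_zero, wr_comp e.symm] at this
  simpa [cupsM] using this

/-! ### Bipartite diagrams as sums -/

theorem bmul_one : bmul 1 = wr 1 := (bmul_eq 1).trans spider_black.mul_one

theorem bmul_succ (n : ℕ) : bmul (n + 1) = (bmul n * wr 1) ⟫ bmul 2 := by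
  simpa only [bmul_eq] using spider_black.mul_succ n

theorem bmul_add (n m : ℕ) : bmul (n + m) = (bmul n * bmul m) ⟫ bmul 2 := by
  induction m with
  | zero =>
    have hσ : (env [n] (coreOps ++ [bmul n])).Typed (sig (coreSig ++ [([1], [0])])) := typed_core
      (by simp [dims_cons, dims_nil, dim_env])
    have key := eval_eq hσ (sym 24 * sym 15 ⊳ sym 14) (sym 24) ((Eqv.refl (L := [100]) (L' := [1])
      (P := [(24, [100], [0]), (15, [], [2]), (14, [0, 2], [1])]) hσ)
        |>.step hσ (mu_eta [n] [bmul n]) [] [(24, [100], [1])])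
    simp only
      [Tm.eval, sym_env, coreOps,  dims_cons, dims_nil, dim_env, List.getD_cons_zero, List.getD_cons_succ, List.cons_append, List.nil_append, add_zero, Nat.reduceLT, if_false, Nat.reduceSub]
      at key
    exact Eq.symm key
  | succ m ih =>
    rw [← add_assoc, bmul_succ (n + m), ih, bmul_succ m]
    have hσ : (env [n, m] (coreOps ++ [bmul n, bmul m])).Typed (sig (coreSig ++ [([1], [0]),
      ([2], [0])])) := typed_core (by simp [dims_cons, dims_nil, dim_env])
    have key := eval_eq hσ ((sym 24 * sym 25 ⊳ sym 14) * ids [0] ⊳ sym 14) (sym 24 * (sym 25 * ids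
      [0] ⊳ sym 14) ⊳ sym 14) ((Eqv.refl (L := [100, 201, 2]) (L' := [3]) (P := [(24, [100], [0]),
      (25, [201], [1]), (14, [0, 1], [4]), (14, [4, 2], [3])]) hσ)
        |>.step hσ (mu_assoc [n, m] [bmul n, bmul m]) [] [(24, [100], [0]), (25, [201], [1]),
          (14, [1, 2], [4]), (14, [0, 4], [3])])
    simp only
      [Tm.eval, sym_env, coreOps,  dims_cons, dims_nil, dim_env, List.getD_cons_zero, List.getD_cons_succ, List.cons_append, List.nil_append, add_zero, Nat.reduceLT, if_false, Nat.reduceSub]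
      at key
    exact key

/-- Black multiplications side by side. -/
def bmuls {n : ℕ} (d : Fin n → ℕ) : Mor := juxtM fun j => bmul (d j)

@[simp] theorem bmuls_dom {n : ℕ} (d : Fin n → ℕ) : (bmuls d).dom = ∑ j, d j := by
  induction n with
  | zero => rfl
  | succ n ih => rw [Fin.sum_univ_castSucc, ← ih]; rfl

@[simp] theorem bmuls_cod {n : ℕ} (d : Fin n → ℕ) : (bmuls d).cod = n := by
  induction n with
  | zero => rfl
  | succ n ih => exact congrArg (· + 1) (ih _)

theorem bmuls_zero (n : ℕ) : bmuls (fun _ : Fin n => 0) = etaB n := by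
  induction n with
  | zero => rfl
  | succ n ih => rw [etaB, ← ih]; rfl

@[simp] theorem mergeM_dom {n : ℕ} (c d : Fin n → ℕ) :
    (mergeM br c d).dom = (∑ j, c j) + ∑ j, d j := by
  cases n with
  | zero => rfl
  | succ n => simp only [mergeM, Fin.sum_univ_castSucc, comp_dom, mul_dom, wr_dom, br_dom]; omega

@[simp] theorem mergeM_cod {n : ℕ} (c d : Fin n → ℕ) :
    (mergeM br c d).cod = ∑ j, (c j + d j) := by
  induction n with
  | zero => rfl
  | succ n ih => simp only [mergeM, Fin.sum_univ_castSucc, comp_cod, mul_cod, wr_cod, ih]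

/-- Associativity of μ, one output at a time: multiplying c j + d j wires is multiplying the two
groups separately and then combining the results. -/
theorem mergeM_bmuls {n : ℕ} (c d : Fin n → ℕ) :
    mergeM br c d ⟫ bmuls (fun j => c j + d j) = (bmuls c * bmuls d) ⟫ muB n := by
  induction n with
  | zero => simp [mergeM, bmuls, juxtM, muB]
  | succ n ih =>
    have h := ih (fun j => c j.castSucc) (fun j => d j.castSucc)
    have hm := bmul_add (c (Fin.last n)) (d (Fin.last n))
    change (wr (∑ j : Fin n, c j.castSucc) * br (c (Fin.last n)) (∑ j : Fin n, d j.castSucc) *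
        wr (d (Fin.last n))) ⟫ (mergeM br (fun j => c j.castSucc) (fun j => d j.castSucc) *
        wr (c (Fin.last n) + d (Fin.last n))) ⟫ (bmuls (fun j : Fin n => c j.castSucc + d j.castSucc) *
        bmul (c (Fin.last n) + d (Fin.last n))) =
      ((bmuls (fun j : Fin n => c j.castSucc) * bmul (c (Fin.last n))) *
        (bmuls (fun j : Fin n => d j.castSucc) * bmul (d (Fin.last n)))) ⟫ muB (n + 1)
    rw [muB]
    have hσ : (env [n, ∑ j : Fin n, c j.castSucc, ∑ j : Fin n, d j.castSucc, c (Fin.last n),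
      d (Fin.last n), ∑ j : Fin n, (c j.castSucc + d j.castSucc)] (coreOps ++
      [muB n, bmuls (fun j : Fin n => c j.castSucc), bmuls (fun j : Fin n => d j.castSucc),
      bmul (c (Fin.last n)), bmul (d (Fin.last n)), bmul (c (Fin.last n) + d (Fin.last n)),
      mergeM br (fun j : Fin n => c j.castSucc) (fun j => d j.castSucc),
      bmuls (fun j : Fin n => c j.castSucc + d j.castSucc)])).Typed (sig (coreSig ++
      [([1, 1], [1]), ([2], [1]), ([3], [1]), ([4], [0]), ([5], [0]), ([4, 5], [0]),
      ([2, 3], [6]), ([6], [1])])) := typed_core (by simp [dims_cons, dims_nil, dim_env])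
    have h1 := eqv hσ (sym 30 ⊳ sym 31) (sym 25 * sym 26 ⊳ sym 24) [200, 301]
      [(30, [200, 301], [600]), (31, [600], [102])] [(25, [200], [100]), (26, [301], [101]),
      (24, [100, 101], [102])] [102] (h)
    have h2 := eqv hσ (sym 29) (sym 27 * sym 28 ⊳ sym 14) [400, 501] [(29, [400, 501], [2])]
      [(27, [400], [0]), (28, [501], [1]), (14, [0, 1], [2])] [2] (hm)
    have key := eval_eq hσ (ids [2] * swap [4] [3] * ids [5] ⊳ sym 30 * ids [4, 5] ⊳ sym 31 * sym
      29) (sym 25 * sym 27 * (sym 26 * sym 28) ⊳ (ids [1] * swap [0] [1] * ids [0] ⊳ sym 24 * sym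
      14)) ((Eqv.refl (L := [200, 401, 302, 503]) (L' := [104, 5]) (P := [(30, [200, 302], [600]),
      (31, [600], [104]), (29, [401, 503], [5])]) hσ)
        |>.step hσ h2 [] [(30, [200, 302], [600]), (31, [600], [104]), (27, [401], [0]),
          (28, [503], [1]), (14, [0, 1], [5])]
        |>.step hσ h1 [] [(25, [200], [100]), (27, [401], [0]), (26, [302], [101]),
          (28, [503], [1]), (24, [100, 101], [104]), (14, [0, 1], [5])])
    simp only
      [Tm.eval, sym_env, coreOps,  dims_cons, dims_nil, dim_env, List.getD_cons_zero, List.getD_cons_succ, List.cons_append, List.nil_append, add_zero, Nat.reduceLT, if_false, Nat.reduceSub]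
      at key
    exact key

theorem juxtM_dom {q : ℕ} {f : Fin q → Mor} {d : Fin q → ℕ} (h : ∀ i, (f i).dom = d i) :
    (juxtM f).dom = ∑ i, d i := by
  induction q with
  | zero => rfl
  | succ q ih => rw [juxtM, mul_dom, ih fun i => h i.castSucc, h, Fin.sum_univ_castSucc]

theorem juxtM_cod {q : ℕ} {f : Fin q → Mor} {d : Fin q → ℕ} (h : ∀ i, (f i).cod = d i) :
    (juxtM f).cod = ∑ i, d i := by
  induction q with
  | zero => rfl
  | succ q ih => rw [juxtM, mul_cod, ih fun i => h i.castSucc, h, Fin.sum_univ_castSucc]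

@[simp] theorem wiringM_dom {n q : ℕ} (b : Fin q → Fin n → ℕ) :
    (wiringM br b).dom = ∑ i, ∑ j, b i j := by
  induction q with
  | zero => rfl
  | succ q ih => rw [wiringM, comp_dom, mul_dom, ih, Fin.sum_univ_castSucc]; rfl

@[simp] theorem wiringM_cod {n q : ℕ} (b : Fin q → Fin n → ℕ) :
    (wiringM br b).cod = ∑ j, ∑ i, b i j := by
  cases q with
  | zero => simp [wiringM]
  | succ q => simp [wiringM, Fin.sum_univ_castSucc]

/-- Peeling off the last bottom vertex splits δ on q + 1 legs into a binary δ above which the other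
q branches continue. By `mergeM_bmuls` the top vertices split into `muB` of two parts. What remains
is the defining diagram of a convolution sum. -/
theorem bipartite_eq_sum {n q : ℕ} (b : Fin q → Fin n → ℕ) (f : Fin q → Mor) (x : Fin q → Vec n)
    (hd : ∀ i, (f i).dom = 1) (hc : ∀ i, (f i).cod = ∑ j, b i j)
    (hx : ∀ i, f i ⟫ bmuls (b i) = (x i).1) :
    bcom q ⟫ (juxtM f ⟫ wiringM br b ⟫ bmuls fun j => ∑ i, b i j) = (∑ i, x i).1 := by
  induction q with
  | zero =>
    simp only [Finset.univ_eq_empty, Finset.sum_empty, bmuls_zero, Vec.zero_val]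
    have e : (juxtM f ⟫ wiringM br b) = wr 0 := comp_wr (f := 1) (n := 0) rfl
    rw [e, wr_comp (by simp)]
  | succ q ih =>
    have h := ih (fun i => b i.castSucc) (fun i => f i.castSucc) (fun i => x i.castSucc)
      (fun i => hd _) (fun i => hc _) (fun i => hx _)
    have hl := hx (Fin.last q)
    have hm := mergeM_bmuls (fun j => ∑ i : Fin q, b i.castSucc j) (b (Fin.last q))
    have hjd : (juxtM fun i : Fin q => f i.castSucc).dom = q := by
      rw [juxtM_dom (d := fun _ => 1) fun i => hd _]; simp
    have hjc : (juxtM fun i : Fin q => f i.castSucc).cod = ∑ i : Fin q, ∑ j, b i.castSucc j :=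
      juxtM_cod fun i => hc _
    have hld := hd (Fin.last q)
    have hlc := hc (Fin.last q)
    have hxc := (∑ i : Fin q, x i.castSucc).cod
    have hxd := (∑ i : Fin q, x i.castSucc).dom
    have hyc := (x (Fin.last q)).cod
    have hyd := (x (Fin.last q)).dom
    simp only [Fin.sum_univ_castSucc (n := q)]
    rw [Vec.add_val, juxtM, wiringM, ← bcom_add q 1, bcom_one]
    generalize (juxtM fun i : Fin q => f i.castSucc) = J at *
    generalize (∑ i : Fin q, x i.castSucc).1 = X at *
    generalize (x (Fin.last q)).1 = Y at *
    generalize f (Fin.last q) = F at *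
    have hσ : (env
      [n, q, ∑ i : Fin q, ∑ j, b i.castSucc j, ∑ j, b (Fin.last q) j, ∑ j, ∑ i : Fin q, b i.castSucc j, ∑ j, ((∑ i : Fin q, b i.castSucc j) + b (Fin.last q) j)]
      (coreOps ++ [muB n, J, X, Y, F, bcom q, wiringM br (fun i : Fin q => b i.castSucc),
      mergeM br (fun j => ∑ i : Fin q, b i.castSucc j) (b (Fin.last q)),
      bmuls (fun j => ∑ i : Fin q, b i.castSucc j), bmuls (b (Fin.last q)),
      bmuls (fun j => (∑ i : Fin q, b i.castSucc j) + b (Fin.last q) j)])).Typed (sig (coreSig ++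
      [([1, 1], [1]), ([2], [3]), ([0], [1]), ([0], [1]), ([0], [4]), ([0], [2]), ([3], [5]),
      ([5, 4], [6]), ([5], [1]), ([4], [1]), ([6], [1])])) := typed_core (by simp
      [dims_cons, dims_nil, dim_env, hjd, hjc, hld, hlc, hxc, hxd, hyc, hyd])
    have h1 := eqv hσ (sym 31 ⊳ sym 34) (sym 32 * sym 33 ⊳ sym 24) [500, 401]
      [(31, [500, 401], [600]), (34, [600], [102])] [(32, [500], [100]), (33, [401], [101]),
      (24, [100, 101], [102])] [102] (hm)
    have h2 := eqv hσ (sym 29 ⊳ (sym 25 ⊳ sym 30 ⊳ sym 32)) (sym 26) [0] [(29, [0], [200]),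
      (25, [200], [300]), (30, [300], [500]), (32, [500], [101])] [(26, [0], [101])] [101] (h)
    have h3 := eqv hσ (sym 28 ⊳ sym 33) (sym 27) [0] [(28, [0], [400]), (33, [400], [101])]
      [(27, [0], [101])] [101] (hl)
    have key := eval_eq hσ (sym 16 ⊳ sym 29 * ids [0] ⊳ (sym 25 * sym 28 ⊳ (sym 30 * ids [4] ⊳ sym
      31) ⊳ sym 34)) (sym 16 ⊳ sym 26 * sym 27 ⊳ sym 24) ((Eqv.refl (L := [0]) (L' := [101]) (P :=
      [(16, [0], [1, 2]), (29, [1], [200]), (25, [200], [300]), (28, [2], [400]),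
      (30, [300], [500]), (31, [500, 400], [600]), (34, [600], [101])]) hσ)
        |>.step hσ h1 [] [(16, [0], [1, 2]), (29, [1], [200]), (25, [200], [300]),
          (28, [2], [400]), (30, [300], [500]), (32, [500], [100]), (33, [400], [102]),
          (24, [100, 102], [101])]
        |>.step hσ h3 [] [(16, [0], [1, 2]), (29, [1], [200]), (25, [200], [300]),
          (30, [300], [500]), (32, [500], [100]), (27, [2], [102]), (24, [100, 102], [101])]
        |>.step hσ h2 [] [(16, [0], [1, 2]), (26, [1], [100]), (27, [2], [102]),
          (24, [100, 102], [101])])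
    simp only
      [Tm.eval, sym_env, coreOps,  dims_cons, dims_nil, dim_env, List.getD_cons_zero, List.getD_cons_succ, List.cons_append, List.nil_append, add_zero, Nat.reduceLT, if_false, Nat.reduceSub]
      at key
    exact key

/-! ### Multiplication of vectors by scalars. -/

namespace Vec
variable {n m : ℕ}

/-- The zero scalar is ε, and ε on one leg of c leaves η on the other (`c_eps`); so x only meets
|0⟩. -/
theorem star_zero {x : Vec n} (hx : Unital x) : star x (0 : Vec 0) = 0 := by
  apply Subtype.ext
  have hσ : (env [n] (coreOps ++ [etaB n, x.1])).Typed (sig (coreSig ++ [([], [1]), ([0], [1])]))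
    := typed_core (by simp [dims_cons, dims_nil, dim_env, x.dom, x.cod])
  have hd := eqv hσ (sym 15 ⊳ sym 25) (sym 24) [] [(15, [], [0]), (25, [0], [100])]
    [(24, [], [100])] [100] (hx)
  rw [star_val, zero_val, zero_val, etaB, ← wr_zero]
  have key := eval_eq hσ (sym 18 ⊳ sym 25 * (sym 17 ⊳ ids [])) (sym 17 ⊳ sym 24) ((Eqv.refl (L :=
    [0]) (L' := [101]) (P := [(18, [0], [1, 2]), (25, [1], [101]), (17, [2], [])]) hσ)
      |>.step hσ (c_eps [n] [etaB n, x.1]) [] [(17, [0], []), (15, [], [1]), (25, [1], [101])]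
      |>.step hσ hd [] [(17, [0], []), (24, [], [101])])
  simp only
    [Tm.eval, sym_env, coreOps,  dims_cons, dims_nil, dim_env, List.getD_cons_zero, List.getD_cons_succ, List.cons_append, List.nil_append, add_zero, Nat.reduceLT, if_false, Nat.reduceSub]
    at key
  exact key

/-- Thus `star one y` is multiplication by the scalar y as a morphism on one wire, the form in which
coefficients occur in a branch of the normal form. -/
theorem star_scalar_comp (x : Vec n) (y : Vec 0) : (star one y).1 ⟫ x.1 = (star x y).1 := by
  have hσ : (env [n] (coreOps ++ [x.1, y.1])).Typed (sig (coreSig ++ [([0], [1]), ([0], [])])) :=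
    typed_core (by simp [dims_cons, dims_nil, dim_env, x.dom, x.cod, y.dom, y.cod])
  rw [star_val, star_val, one]
  have key := eq_of_same hσ (sym 18 ⊳ ids [0] * sym 25 ⊳ sym 24) (sym 18 ⊳ sym 24 * sym 25) [0]
  simp only
    [Tm.eval, sym_env, coreOps,  dims_cons, dims_nil, dim_env, List.getD_cons_zero, List.getD_cons_succ, List.cons_append, List.nil_append, add_zero, Nat.reduceLT, if_false, Nat.reduceSub]
    at key
  exact key

theorem star_one_neg (y : Vec 0) : (star one y).1 ⟫ sM = (star one (neg y)).1 := by
  have hσ : (env [] (coreOps ++ [y.1])).Typed (sig (coreSig ++ [([0], [])])) := typed_core (by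
    simp [dims_cons, dims_nil, dim_env, y.dom, y.cod])
  rw [star_val, star_val, neg_val, one]
  have key := eval_eq hσ (sym 18 ⊳ ids [0] * sym 24 ⊳ sym 13) (sym 18 ⊳ ids [0] * (sym 13 ⊳ sym
    24)) ((Eqv.refl (L := [0]) (L' := [1]) (P := [(18, [0], [2, 3]), (24, [3], []),
    (13, [2], [1])]) hσ)
      |>.step hσ (s_c_left [] [y.1]).symm [] [(13, [0], [2]), (18, [2], [1, 3]), (24, [3], [])]
      |>.step hσ (s_c [] [y.1]) [] [(18, [0], [1, 2]), (13, [2], [3]), (24, [3], [])])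
  simp only
    [Tm.eval, sym_env, coreOps,  dims_cons, dims_nil, dim_env, List.getD_cons_zero, List.getD_cons_succ, List.cons_append, List.nil_append, add_zero, Nat.reduceLT, if_false, Nat.reduceSub]
    at key
  exact key

theorem star_zeroR_left (x : Vec n) (y : Vec 0) : star (zeroR x) y = zeroR (star x y) := by
  apply Subtype.ext
  have hσ : (env [n] (coreOps ++ [x.1, y.1])).Typed (sig (coreSig ++ [([0], [1]), ([0], [])])) :=
    typed_core (by simp [dims_cons, dims_nil, dim_env, x.dom, x.cod, y.dom, y.cod])
  rw [star_val, zeroR_val, zeroR_val, star_val]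
  have key := eq_of_same hσ (sym 18 ⊳ sym 24 * sym 15 * sym 25) ((sym 18 ⊳ sym 24 * sym 25) * sym
    15) [0]
  simp only
    [Tm.eval, sym_env, coreOps,  dims_cons, dims_nil, dim_env, List.getD_cons_zero, List.getD_cons_succ, List.cons_append, List.nil_append, add_zero, Nat.reduceLT, if_false, Nat.reduceSub]
    at key
  exact key

theorem star_oneR_left (x : Vec n) (y : Vec 0) : star (oneR x) y = oneR (star x y) := by
  apply Subtype.ext
  have hσ : (env [n] (coreOps ++ [x.1, y.1])).Typed (sig (coreSig ++ [([0], [1]), ([0], [])])) :=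
    typed_core (by simp [dims_cons, dims_nil, dim_env, x.dom, x.cod, y.dom, y.cod])
  rw [star_val, oneR_val, oneR_val, star_val]
  have key := eval_eq hσ (sym 18 ⊳ (sym 18 ⊳ sym 24 * ids [0]) * sym 25) (sym 18 ⊳ (sym 18 ⊳ sym
    24 * sym 25) * ids [0]) ((Eqv.refl (L := [0]) (L' := [101, 2]) (P := [(18, [0], [1, 3]),
    (18, [1], [4, 2]), (24, [4], [101]), (25, [3], [])]) hσ)
      |>.step hσ (c_assoc [n] [x.1, y.1]) [] [(18, [0], [1, 3]), (18, [3], [2, 4]),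
        (24, [1], [101]), (25, [4], [])]
      |>.step hσ (c_comm [n] [x.1, y.1]) [(0, 3)] [(18, [0], [1, 3]), (24, [1], [101]),
        (18, [3], [4, 2]), (25, [4], [])]
      |>.step hσ (c_assoc [n] [x.1, y.1]).symm [] [(18, [0], [1, 2]), (18, [1], [3, 4]),
        (24, [3], [101]), (25, [4], [])])
  simp only
    [Tm.eval, sym_env, coreOps,  dims_cons, dims_nil, dim_env, List.getD_cons_zero, List.getD_cons_succ, List.cons_append, List.nil_append, add_zero, Nat.reduceLT, if_false, Nat.reduceSub]
    at key
  exact key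

theorem star_e_left (y : Vec 0) : star e y = y := by
  apply Subtype.ext
  have hσ : (env [] (coreOps ++ [y.1])).Typed (sig (coreSig ++ [([0], [])])) := typed_core (by
    simp [dims_cons, dims_nil, dim_env, y.dom, y.cod])
  rw [star_val, e]
  have key := eval_eq hσ (sym 18 ⊳ sym 19 * sym 24) (sym 24) ((Eqv.refl (L := [0]) (L' := []) (P
    := [(18, [0], [1, 2]), (19, [1], []), (24, [2], [])]) hσ)
      |>.step hσ (e_c [] [y.1]) [] [(24, [0], [])])
  simp only
    [Tm.eval, sym_env, coreOps,  dims_cons, dims_nil, dim_env, List.getD_cons_zero, List.getD_cons_succ, List.cons_append, List.nil_append, add_zero, Nat.reduceLT, if_false, Nat.reduceSub]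
    at key
  exact key

/-! ### Basis vectors -/

/-- The basis vector of a bit string. -/
def ket : {n : ℕ} → (Fin n → Fin 2) → Vec n
  | 0, _ => e
  | n + 1, b => if b (Fin.last n) = 0 then zeroR (ket fun j => b j.castSucc)
      else oneR (ket fun j => b j.castSucc)

theorem ket_mem_span (b : Fin n → Fin 2) : ket b ∈ span n := by
  induction n with
  | zero => exact e_mem_span
  | succ n ih =>
    rw [ket]
    split
    · exact zeroR_mem_span (ih _)
    · exact oneR_mem_span (ih _)

theorem wcom_bmuls (b : Fin n → Fin 2) :
    wcom (∑ j, (b j : ℕ)) ⟫ bmuls (fun j => (b j : ℕ)) = (ket b).1 := by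
  induction n with
  | zero => exact comp_wr (n := 0) rfl
  | succ n ih =>
    have h := ih fun j => b j.castSucc
    have hb : bmuls (fun j => (b j : ℕ)) =
      bmuls (fun j : Fin n => (b j.castSucc : ℕ)) * bmul (b (Fin.last n)) := rfl
    rw [hb, Fin.sum_univ_castSucc, ket]
    split
    next h0 =>
      have e : ((0 : Fin 2) : ℕ) = 0 := rfl
      have := comp_mul_comp (f := wcom (∑ j : Fin n, (b j.castSucc : ℕ)))
        (g := bmuls fun j : Fin n => (b j.castSucc : ℕ)) (f' := wr 0) (g' := bmul 0) (by simp) rfl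
      rw [wr_comp (f := bmul 0) (n := 0) rfl, wr_zero, _root_.mul_one] at this
      rw [h0, zeroR_val, ← h, e, add_zero, this]
    next h0 =>
      have h1 : b (Fin.last n) = 1 := by omega
      rw [h1, oneR_val, ← h]
      have e : ((1 : Fin 2) : ℕ) = 1 := rfl
      rw [e, ← wcom_add, wcom_one, bmul_one, comp_mul_wr _ (by simp), comp_assoc (by simp) (by simp)]

/-! ### Multiples -/

/-- A loop of k wires is the convolution sum of k identities; the tensor product with the identity
is additive, so this is the identity times k. -/
theorem iota_natCast (k : ℕ) : bcom k ⟫ bmul k = (star one (iota k)).1 := by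
  induction k with
  | zero =>
    rw [Nat.cast_zero, map_zero, star_zero (unital_of_mem_span one_mem_span), zero_val, etaB, etaB,
      _root_.one_mul]
  | succ k ih =>
    rw [Nat.cast_succ, map_add, (linear_of_mem_span one_mem_span).star_add, iota_one, star_e, add_val,
      muB_one, ← ih, one, ← bcom_add k 1, bcom_one, bmul_succ, ← comp_assoc (by simp) (by simp),
      comp_mul_wr _ (by simp), ← comp_assoc (f := bcom 2) (by simp) (by simp)]

theorem branch_bmuls (z : ℤ) (b : Fin n → Fin 2) :
    (branch z (∑ j, (b j : ℕ))).mor ⟫ bmuls (fun j => (b j : ℕ)) = (star (ket b) (iota z)).1 := by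
  have h : bcom z.natAbs ⟫ bmul z.natAbs ⟫ (if z < 0 then whiteBin else wires 1).mor =
      (star one (iota z)).1 := by
    rw [iota_natCast]
    split
    next hz =>
      have e : z = -(z.natAbs : ℤ) := by omega
      conv_rhs => rw [e, ← neg_iota, ← star_one_neg]
      rfl
    next hz =>
      have e : (z.natAbs : ℤ) = z := by omega
      rw [e, mor_wires, comp_wr (star one (iota z)).cod]
  rw [branch, mor_comp, mor_comp, mor_comp]
  change bcom z.natAbs ⟫ bmul z.natAbs ⟫ (if z < 0 then whiteBin else wires 1).mor ⟫
    wcom (∑ j, (b j : ℕ)) ⟫ bmuls (fun j => (b j : ℕ)) = _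
  rw [h, comp_assoc (star one (iota z)).cod (by simp), wcom_bmuls, star_scalar_comp]

/-- The q-ary black vertex is |1⟩ followed by δ_q, so `bipartite_eq_sum` applies with the branches
as summands. -/
theorem normalState_mor (ψ : (Fin n → Fin 2) → ℤ) :
    (normalState ψ).mor = blackM 1 ⟫ (∑ b, star (ket b) (iota (ψ b))).1 := by
  have h := bipartite_eq_sum (q := (support ψ).length) (n := n)
    (fun i j => ((support ψ).get i j : ℕ))
    (fun i => (branch (ψ ((support ψ).get i)) (∑ j, ((support ψ).get i j : ℕ))).mor)
    (fun i => star (ket ((support ψ).get i)) (iota (ψ ((support ψ).get i))))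
    (fun _ => rfl) (fun _ => rfl) (fun i => branch_bmuls _ _)
  have e : ∑ i : Fin (support ψ).length, star (ket ((support ψ).get i)) (iota (ψ ((support ψ).get i))) =
      ∑ b, star (ket b) (iota (ψ b)) := by
    set g : (Fin n → Fin 2) → Vec n := fun b => star (ket b) (iota (ψ b)) with hg
    -- The normal form lists only non-zero coefficients; the omitted summands are zero in the
    -- convolution monoid, so the sum may run over all bit strings.
    have hz : ∀ b, ψ b = 0 → g b = 0 := fun b hb => by
      rw [hg]
      dsimp only
      rw [hb, map_zero, star_zero (unital_of_mem_span (ket_mem_span b))]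
    have hf : ∀ l : List (Fin n → Fin 2),
        ((l.filter fun x => ψ x ≠ 0).map g).sum = (l.map g).sum := by
      intro l
      induction l with
      | nil => rfl
      | cons a l ih =>
        by_cases ha : ψ a = 0
        · simpa [ha, hz a ha] using ih
        · simpa [ha] using congrArg (g a + ·) ih
    have h₁ : ∑ i : Fin (support ψ).length, g ((support ψ).get i) = ((support ψ).map g).sum := by
      rw [← List.sum_ofFn]
      conv_rhs => rw [← List.ofFn_get (support ψ), List.map_ofFn]
      rfl
    have h₂ : ((List.finRange (2 ^ n)).map finFunctionFinEquiv.symm |>.map g).sum = ∑ b, g b := by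
      rw [List.map_map, ← Equiv.sum_comp finFunctionFinEquiv.symm g, Fin.sum_univ_def]
      rfl
    rw [h₁, support, hf, h₂]
  rw [e] at h
  rw [normalState, mor_comp, mor_bipartite, ← h]
  change blackM (support ψ).length ⟫ _ = _
  rw [spider_black.eq_comul, ← bcom_eq, comp_assoc (by simp)]
  · rfl
  · rw [comp_dom, comp_dom, juxtM_dom (d := fun _ => 1) fun _ => rfl]
    simp

theorem exists_eq_sum {x : Vec n} (hx : x ∈ span n) :
    ∃ ψ : (Fin n → Fin 2) → ℤ, x = ∑ b, star (ket b) (iota (ψ b)) := by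
  induction n with
  | zero =>
    obtain ⟨z, rfl⟩ := hx
    refine ⟨fun _ => z, ?_⟩
    rw [Fintype.sum_unique]
    exact (star_e_left _).symm
  | succ n ih =>
    obtain ⟨a, ha, b, hb, rfl⟩ := mem_span_succ.1 hx
    obtain ⟨φ, rfl⟩ := ih ha
    obtain ⟨χ, rfl⟩ := ih hb
    refine ⟨fun b => if b (Fin.last n) = 0 then φ fun j => b j.castSucc else χ fun j => b j.castSucc, ?_⟩
    -- The sum over bit strings is split by the last bit, which is how the span is built.
    rw [← Equiv.sum_comp (Fin.snocEquiv fun _ => Fin 2), Fintype.sum_prod_type, Fin.sum_univ_two]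
    have h₀ := map_sum (zeroHom n) (fun b => star (ket b) (iota (φ b))) Finset.univ
    have h₁ := map_sum (oneHom n) (fun b => star (ket b) (iota (χ b))) Finset.univ
    refine congrArg₂ _ (h₀.trans ?_) (h₁.trans ?_)
    · refine Finset.sum_congr rfl fun b _ => ?_
      simp only [Fin.snocEquiv, Equiv.coe_fn_mk, Fin.snoc_last, Fin.snoc_castSucc, ket, if_true]
      exact (star_zeroR_left _ _).symm
    · refine Finset.sum_congr rfl fun b _ => ?_
      simp only [Fin.snocEquiv, Equiv.coe_fn_mk, Fin.snoc_last, Fin.snoc_castSucc, ket,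
        Fin.one_eq_zero_iff, OfNat.ofNat_ne_one, if_false]
      exact (star_oneR_left _ _).symm

end Vec

/-! ### Realization of coefficients by a homomorphism, and the conclusion. -/

theorem exists_transposeState {n m : ℕ} (ψ : (Fin (n + m) → Fin 2) → ℤ) :
    ∃ f : Qubits n →ₗ[ℤ] Qubits m, transposeState f = ψ := by
  -- On free modules the matrix entries may be prescribed: the entry at row y and column x is the
  -- coefficient of |xy⟩.
  refine ⟨(ketBasis n).constr ℤ fun x => (ketBasis m).equivFun.symm fun y => ψ (Fin.append x y), ?_⟩
  funext z
  rw [transposeState, Module.Basis.constr_basis, ← Module.Basis.equivFun_apply,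
    LinearEquiv.apply_symm_apply]
  congr 1
  exact Fin.append_castAdd_natAdd

end ZW

theorem mainTheorem2 (n m : ℕ) (G : ZW.Diagram n m) :
    ∃ f : ZW.Qubits n →ₗ[ℤ] ZW.Qubits m, ZW.Rewrites G (ZW.N f) := by
  obtain ⟨s, ⟨x, hx, rfl⟩, h⟩ := ZW.exists_bendM_eq G
  obtain ⟨ψ, rfl⟩ := ZW.Vec.exists_eq_sum hx
  obtain ⟨f, hf⟩ := ZW.exists_transposeState ψ
  refine ⟨f, ZW.mor_eq_iff.1 ?_⟩
  rw [h, ZW.N, ZW.mor_bend, hf, ZW.Vec.normalState_mor]
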